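/- Let $\mathfrak g$ be a finite-dimensional complex semisimple Lie algebra with Cartan subalgebra $\mathfrak h$, base $\Pi^+$ of simple roots, and an invariant inner product $(\cdot,\cdot)$ on $\mathfrak h^*$ normalized so that $d_\alpha=\tfrac12(\alpha,\alpha)$ is a positive integer for every $\alpha\in\Pi^+$. Let $q\in\mathbb C$ be non-zero and not a root of unity, and let $U_q(\mathfrak g)$ be the quantized universal enveloping algebra: the complex unital algebra generated by $e_\alpha,f_\alpha,q^{\pm h_\alpha}$ ($\alpha\in\Pi^+$), where the $q^{\pm h_\alpha}$ commute with each other and $q^{h_\alpha}q^{-h_\alpha}=1=q^{-h_\alpha}q^{h_\alpha}$, with relations $$q^{h_\alpha}e_\beta=q^{(\alpha,\beta)}e_\beta q^{h_\alpha},\qquad q^{h_\alpha}f_\beta=q^{-(\alpha,\beta)}f_\beta q^{h_\alpha},\qquad [e_\alpha,f_\beta]=\delta_{\alpha,\beta}\frac{q^{h_\alpha}-q^{-h_\alpha}}{q-q^{-1}},$$ and the quantum Serre relations (with parameter $q^{d_\alpha}$) among the $e_\alpha$ and among the $f_\alpha$; its comultiplication is $$\Delta(e_\alpha)=e_\alpha\otimes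 q^{h_\alpha}+1\otimes e_\alpha,\qquad \Delta(f_\alpha)=f_\alpha\otimes1+q^{-h_\alpha}\otimes f_\alpha,\qquad \Delta(q^{\pm h_\alpha})=q^{\pm h_\alpha}\otimes q^{\pm h_\alpha}.$$ Let $\omega$ be the algebra anti-automorphism of $U_q(\mathfrak g)$ with $\omega(e_\alpha)=-f_\alpha q^{h_\alpha}$, $\omega(f_\alpha)=-q^{-h_\alpha}e_\alpha$, $\omega(q^{\pm h_\alpha})=q^{\pm h_\alpha}$. A symmetric bilinear form on a $U_q(\mathfrak g)$-module is called contravariant if $\langle xv,w\rangle=\langle v,\omega(x)w\rangle$ for all $x\in U_q(\mathfrak g)$ and all $v,w$. A Shapovalov form of a highest weight module is a non-zero contravariant form on it. Let $V$ and $Z$ be irreducible finite-dimensional highest weight $U_q(\mathfrak g)$-modules. A canonical form on $V\otimes Z$ is the product $\langle v\otimes z,v'\otimes z'\rangle=\langle v,v'\rangle\langle z,z'\rangle$ of a Shapovalov form of $V$ and a Shapovalov form of $Z$. Let $(V\otimes Z)^+\subset V\otimes Z$ be the span of the singular vectors, that is, of the non-zero weight vectors annihilated by all $e_\alpha$, $\alpha\in\Pi^+$.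 Then $V\otimes Z$ has a canonical form, and every canonical form on $V\otimes Z$ has non-degenerate restriction to $(V\otimes Z)^+$. -/

import Mathlib

open scoped TensorProduct

namespace QuantumGroup

/-- The symmetric Gaussian binomial coefficient `[n]! / ([k]! [n - k]!)` at the parameter `c`,
where `[j] = (c ^ j - c ^ (-j)) / (c - c⁻¹)`, through its Pascal recursion
`[n + 1, k + 1] = c ^ (k + 1) [n, k + 1] + c ^ (k - n) [n, k]`. -/
noncomputable def qBinom (c : ℂˣ) : ℕ → ℕ → ℂ
  | _, 0 => 1
  | 0, _ + 1 => 0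
  | n + 1, k + 1 =>
      ((c ^ ((k : ℤ) + 1) : ℂˣ) : ℂ) * qBinom c n (k + 1) +
        ((c ^ ((k : ℤ) - (n : ℤ)) : ℂˣ) : ℂ) * qBinom c n k

/-- The quantum Serre expression
`∑ r, (-1) ^ r [m, r] x ^ (m - r) y x ^ r`, with Gaussian binomials at the parameter `c`. -/
noncomputable def qSerre {R : Type*} [Ring R] [Algebra ℂ R] (c : ℂˣ) (m : ℕ) (x y : R) : R :=
  ∑ r ∈ Finset.range (m + 1), ((-1) ^ r * qBinom c m r) • (x ^ (m - r) * y * x ^ r)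

section Aux
variable {R : Type*} [Ring R] [Algebra ℂ R]

theorem qBinom_zero_right (c : ℂˣ) (n : ℕ) : qBinom c n 0 = 1 := by cases n <;> rfl

theorem qBinom_succ (c : ℂˣ) (n k : ℕ) : qBinom c (n + 1) (k + 1) =
      ((c ^ ((k : ℤ) + 1) : ℂˣ) : ℂ) * qBinom c n (k + 1) +
        ((c ^ ((k : ℤ) - (n : ℤ)) : ℂˣ) : ℂ) * qBinom c n k := rfl

theorem qBinom_eq_zero (c : ℂˣ) : ∀ n k : ℕ, n < k → qBinom c n k = 0
  | 0, k + 1, _ => rfl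
  | n + 1, k + 1, h => by
      rw [qBinom_succ, qBinom_eq_zero c n (k + 1) (by omega), qBinom_eq_zero c n k (by omega)]
      simp

theorem qBinom_succ' (c : ℂˣ) : ∀ n k : ℕ, qBinom c (n + 1) (k + 1) =
      ((c ^ (-(k : ℤ) - 1) : ℂˣ) : ℂ) * qBinom c n (k + 1) +
        ((c ^ ((n : ℤ) - (k : ℤ)) : ℂˣ) : ℂ) * qBinom c n k
  | 0, 0 => by simp [qBinom]
  | 0, k + 1 => by simp [qBinom]
  | n + 1, 0 => by
      rw [qBinom_succ c (n + 1) 0]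
      conv_lhs => rw [qBinom_succ' c n 0]
      conv_rhs => rw [qBinom_succ c n 0]
      simp only [qBinom_zero_right, mul_add, ← mul_assoc, mul_one, ← Units.val_mul, ← zpow_add]
      push_cast
      ring_nf
  | n + 1, k + 1 => by
      have h1 := qBinom_succ' c n (k + 1)
      have h2 := qBinom_succ' c n k
      rw [qBinom_succ c (n + 1) (k + 1)]
      conv_lhs => rw [h1, h2]
      conv_rhs => rw [qBinom_succ c n (k + 1), qBinom_succ c n k]
      simp only [mul_add, ← mul_assoc, ← Units.val_mul, ← zpow_add]
      push_cast
      ring_nf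

theorem qBinom_inv (c : ℂˣ) : ∀ n k : ℕ, qBinom c⁻¹ n k = qBinom c n k
  | _, 0 => by simp [qBinom_zero_right]
  | 0, _ + 1 => rfl
  | n + 1, k + 1 => by
      rw [qBinom_succ, qBinom_succ' c n k, qBinom_inv c n, qBinom_inv c n]
      simp only [inv_zpow', neg_add, neg_sub]
      ring_nf

theorem qSerre_inv (c : ℂˣ) (m : ℕ) (x y : R) : qSerre c⁻¹ m x y = qSerre c m x y := by
  simp [qSerre, qBinom_inv]

/-- Iterated `q`-commutators of `x` with `z`; used only to check the Serre relations below. -/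
def qIter (x z : R) (s : ℕ → ℂ) : ℕ → R
  | 0 => z
  | k + 1 => x * qIter x z s k - s k • (qIter x z s k * x)

theorem qIter_eq_sum (c : ℂˣ) (x z : R) : ∀ (m : ℕ) (l : ℂ) (s : ℕ → ℂ)
    (_ : ∀ k < m, s k = l * ((c ^ ((m : ℤ) - 1 - 2 * k) : ℂˣ) : ℂ)),
    qIter x z s m = ∑ r ∈ Finset.range (m + 1),
      ((-1) ^ r * qBinom c m r * l ^ r) • (x ^ (m - r) * z * x ^ r)
  | 0, l, s, hs => by simp [qIter, qBinom]
  | m + 1, l, s, hs => by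
      have ih := qIter_eq_sum c x z m (l * c) s (by
        intro k hk
        rw [hs k (by omega), mul_assoc, ← Units.val_mul, ← zpow_one_add]
        push_cast; ring_nf)
      have h0 : s m = l * ((c ^ (-(m : ℤ)) : ℂˣ) : ℂ) := by
        rw [hs m (by omega)]; push_cast; ring_nf
      have e1 : x * qIter x z s m = ∑ r ∈ Finset.range (m + 2),
          ((-1) ^ r * qBinom c m r * (l * c) ^ r) • (x ^ (m + 1 - r) * z * x ^ r) := by
        rw [ih, Finset.sum_range_succ _ (m + 1), qBinom_eq_zero c m (m + 1) (by omega),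
          Finset.mul_sum]
        simp only [mul_zero, zero_mul, zero_smul, add_zero]
        refine Finset.sum_congr rfl fun r hr => ?_
        have : m + 1 - r = (m - r) + 1 := by have := Finset.mem_range.1 hr; omega
        rw [this, pow_succ', mul_smul_comm]
        simp only [mul_assoc]
      have e2 : qIter x z s m * x = ∑ r ∈ Finset.range (m + 1),
          ((-1) ^ r * qBinom c m r * (l * c) ^ r) • (x ^ (m - r) * z * x ^ (r + 1)) := by
        rw [ih, Finset.sum_mul]
        refine Finset.sum_congr rfl fun r hr => ?_
        rw [smul_mul_assoc, pow_succ]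
        simp only [mul_assoc]
      rw [qIter, e1, e2, Finset.sum_range_succ', Finset.sum_range_succ' _ (m + 1), h0,
        Finset.smul_sum, add_sub_right_comm, ← Finset.sum_sub_distrib]
      congr 1
      · refine Finset.sum_congr rfl fun r _ => ?_
        rw [Nat.add_sub_add_right, smul_smul, ← sub_smul, qBinom_succ]
        congr 1
        have hc : (c : ℂ) ≠ 0 := c.ne_zero
        push_cast
        rw [zpow_add₀ hc, zpow_sub₀ hc, zpow_neg, zpow_natCast, zpow_natCast]
        field_simp
        ring
      · simp [qBinom_zero_right]

theorem qSerre_eq_qIter (c : ℂˣ) (m : ℕ) (x z : R) :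
    qSerre c m x z = qIter x z (fun k => ((c ^ ((m : ℤ) - 1 - 2 * k) : ℂˣ) : ℂ)) m := by
  rw [qIter_eq_sum c x z m 1 _ (by simp)]
  simp [qSerre]

theorem qSerre_eq_qIter' (c : ℂˣ) (m : ℕ) (x z : R) :
    qSerre c m x z = qIter x z (fun k => ((c ^ (1 - (m : ℤ) + 2 * k) : ℂˣ) : ℂ)) m := by
  rw [← qSerre_inv, qSerre_eq_qIter]
  congr 1
  funext k
  rw [inv_zpow']
  congr 2
  ring

theorem map_qSerre {S : Type*} [Ring S] [Algebra ℂ S] (φ : R →ₐ[ℂ] S) (c : ℂˣ) (m : ℕ)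
    (x y : R) : φ (qSerre c m x y) = qSerre c m (φ x) (φ y) := by
  simp [qSerre]

theorem qSerre_smul (c : ℂˣ) (m : ℕ) (a b : ℂ) (x y : R) :
    qSerre c m (a • x) (b • y) = (a ^ m * b) • qSerre c m x y := by
  simp only [qSerre, Finset.smul_sum]
  refine Finset.sum_congr rfl fun r hr => ?_
  have : a ^ m = a ^ (m - r) * a ^ r := by
    rw [← pow_add, Nat.sub_add_cancel (by have := Finset.mem_range.1 hr; omega)]
  simp only [smul_pow, smul_mul_assoc, mul_smul_comm, smul_smul]
  congr 1
  rw [this]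
  ring

theorem qSerre_op (c : ℂˣ) (m : ℕ) (x y : R) (h : qSerre c m x y = 0) :
    qSerre c m (MulOpposite.op x) (MulOpposite.op y) = 0 := by
  have key : ∀ k, ∃ a : ℂ, qIter (MulOpposite.op x) (MulOpposite.op y)
      (fun k => ((c ^ ((m : ℤ) - 1 - 2 * k) : ℂˣ) : ℂ)) k =
      MulOpposite.op (a • qIter x y (fun k => ((c ^ (1 - (m : ℤ) + 2 * k) : ℂˣ) : ℂ)) k) := by
    intro k
    induction k with
    | zero => exact ⟨1, by simp [qIter]⟩
    | succ k ih =>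
      obtain ⟨a, ha⟩ := ih
      refine ⟨-(a * ((c ^ ((m : ℤ) - 1 - 2 * k) : ℂˣ) : ℂ)), ?_⟩
      have hs : ((c ^ ((m : ℤ) - 1 - 2 * k) : ℂˣ) : ℂ) *
          ((c ^ (1 - (m : ℤ) + 2 * k) : ℂˣ) : ℂ) = 1 := by
        rw [← Units.val_mul, ← zpow_add]; ring_nf; simp
      rw [qIter, ha, qIter, ← MulOpposite.op_mul, ← MulOpposite.op_mul, ← MulOpposite.op_smul,
        ← MulOpposite.op_sub]
      congr 1
      simp only [smul_sub, smul_mul_assoc, mul_smul_comm, smul_smul]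
      rw [neg_mul, mul_assoc, hs, mul_one, mul_comm a, neg_smul, neg_smul]
      abel
  obtain ⟨a, ha⟩ := key m
  rw [qSerre_eq_qIter, ha, ← qSerre_eq_qIter', h]
  simp

theorem qIter_mul {x y k l : R} {v u : ℂ} (s : ℕ → ℂ) (hkx : k * x = v • (x * k))
    (hky : k * y = u • (y * k)) (hlx : l * x = u • (x * l)) (hkl : k * l = l * k) (n : ℕ) :
    ∃ a : ℂ, qIter (x * k) (y * l) s n = a • (qIter x y s n * (k ^ n * l)) := by
  have h1 : ∀ n, k * qIter x y s n = (v ^ n * u) • (qIter x y s n * k) := by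
    intro n
    induction n with
    | zero => simp [qIter, hky]
    | succ n ih =>
      have e1 : k * (x * qIter x y s n) = (v ^ (n + 1) * u) • (x * qIter x y s n * k) := by
        rw [← mul_assoc, hkx, smul_mul_assoc, mul_assoc, ih, mul_smul_comm, smul_smul, mul_assoc]
        congr 1; ring
      have e2 : k * (qIter x y s n * x) = (v ^ (n + 1) * u) • (qIter x y s n * x * k) := by
        rw [← mul_assoc, ih, smul_mul_assoc, mul_assoc, hkx, mul_smul_comm, smul_smul, ← mul_assoc]
        congr 1; ring
      rw [qIter, mul_sub, mul_smul_comm, e1, e2, sub_mul, smul_sub, smul_mul_assoc, smul_comm]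
  have h2 : ∀ n, k ^ n * l * x = (v ^ n * u) • (x * (k ^ n * l)) := by
    intro n
    induction n with
    | zero => simp [hlx]
    | succ n ih =>
      rw [pow_succ', mul_assoc k, mul_assoc k, ih, mul_smul_comm, ← mul_assoc k x, hkx,
        smul_mul_assoc, smul_smul, mul_assoc x k]
      congr 1; ring
  have h3 : ∀ n, k * (k ^ n * l) = k ^ n * l * k := by
    intro n
    rw [mul_assoc, ← hkl, ← mul_assoc, ← mul_assoc, pow_mul_comm']
  induction n with
  | zero => exact ⟨1, by simp [qIter]⟩
  | succ n ih =>
    obtain ⟨a, ha⟩ := ih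
    refine ⟨a * (v ^ n * u), ?_⟩
    have e1 : x * k * (qIter x y s n * (k ^ n * l)) =
        (v ^ n * u) • (x * qIter x y s n * (k ^ (n + 1) * l)) := by
      rw [mul_assoc x, ← mul_assoc k, h1, smul_mul_assoc, mul_smul_comm, pow_succ']
      simp only [mul_assoc]
    have e2 : qIter x y s n * (k ^ n * l) * (x * k) =
        (v ^ n * u) • (qIter x y s n * x * (k ^ (n + 1) * l)) := by
      rw [mul_assoc, ← mul_assoc _ x, h2, smul_mul_assoc, mul_smul_comm, mul_assoc x, ← h3,
        pow_succ']
      simp only [mul_assoc]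
    rw [qIter, ha, qIter, mul_smul_comm, smul_mul_assoc, e1, e2, sub_mul, smul_sub,
      smul_mul_assoc]
    simp only [smul_smul]
    congr 2; ring

theorem qSerre_mul (c : ℂˣ) (m : ℕ) {x y k l : R} {v u : ℂ} (hkx : k * x = v • (x * k))
    (hky : k * y = u • (y * k)) (hlx : l * x = u • (x * l)) (hkl : k * l = l * k)
    (h : qSerre c m x y = 0) : qSerre c m (x * k) (y * l) = 0 := by
  obtain ⟨a, ha⟩ := qIter_mul (fun k => ((c ^ ((m : ℤ) - 1 - 2 * k) : ℂˣ) : ℂ)) hkx hky hlx hkl m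
  rw [qSerre_eq_qIter, ha, ← qSerre_eq_qIter, h]
  simp

theorem qIter_add_right (s : ℕ → ℂ) (x z w : R) (n : ℕ) :
    qIter x (z + w) s n = qIter x z s n + qIter x w s n := by
  induction n with
  | zero => rfl
  | succ n ih => simp only [qIter, ih, mul_add, add_mul, smul_add]; abel

theorem qSerre_add (c : ℂˣ) (m : ℕ) {x y x' y' : R}
    (hxy : x * y = ((c ^ (2 : ℤ) : ℂˣ) : ℂ) • (y * x))
    (hx'y : x' * y = ((c ^ (1 - (m : ℤ)) : ℂˣ) : ℂ) • (y * x'))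
    (hxy' : x * y' = ((c ^ (1 - (m : ℤ)) : ℂˣ) : ℂ) • (y' * x))
    (hx : qSerre c m x x' = 0) (hy : qSerre c m y y' = 0) :
    qSerre c m (x + y) (x' + y') = 0 := by
  have split : qSerre c m (x + y) (x' + y') =
      qSerre c m (x + y) x' + qSerre c m (x + y) y' := by
    rw [qSerre_eq_qIter, qIter_add_right, ← qSerre_eq_qIter, ← qSerre_eq_qIter]
  have A : ∀ n, qIter (x + y) x' (fun k => ((c ^ ((m : ℤ) - 1 - 2 * k) : ℂˣ) : ℂ)) n =
      qIter x x' (fun k => ((c ^ ((m : ℤ) - 1 - 2 * k) : ℂˣ) : ℂ)) n ∧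
      qIter x x' (fun k => ((c ^ ((m : ℤ) - 1 - 2 * k) : ℂˣ) : ℂ)) n * y =
      ((c ^ (1 - (m : ℤ) + 2 * n) : ℂˣ) : ℂ) •
        (y * qIter x x' (fun k => ((c ^ ((m : ℤ) - 1 - 2 * k) : ℂˣ) : ℂ)) n) := by
    intro n
    induction n with
    | zero => simp [qIter, hx'y]
    | succ n ih =>
      obtain ⟨ih1, ih2⟩ := ih
      constructor
      · rw [qIter, ih1, qIter, add_mul, mul_add, ih2, smul_add, smul_smul, ← Units.val_mul,
          ← zpow_add]
        ring_nf
        simp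
      · rw [qIter, sub_mul, smul_mul_assoc, mul_assoc, ih2, mul_assoc, hxy, mul_smul_comm,
          mul_smul_comm, ← mul_assoc, ← mul_assoc, hxy, ih2]
        simp only [smul_mul_assoc, smul_smul, mul_sub, smul_sub, mul_smul_comm, mul_assoc,
          ← Units.val_mul, ← zpow_add]
        push_cast
        ring_nf
  have B : ∀ n, qIter (x + y) y' (fun k => ((c ^ (1 - (m : ℤ) + 2 * k) : ℂˣ) : ℂ)) n =
      qIter y y' (fun k => ((c ^ (1 - (m : ℤ) + 2 * k) : ℂˣ) : ℂ)) n ∧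
      x * qIter y y' (fun k => ((c ^ (1 - (m : ℤ) + 2 * k) : ℂˣ) : ℂ)) n =
      ((c ^ (1 - (m : ℤ) + 2 * n) : ℂˣ) : ℂ) •
        (qIter y y' (fun k => ((c ^ (1 - (m : ℤ) + 2 * k) : ℂˣ) : ℂ)) n * x) := by
    intro n
    induction n with
    | zero => simp [qIter, hxy']
    | succ n ih =>
      obtain ⟨ih1, ih2⟩ := ih
      constructor
      · rw [qIter, ih1, qIter, add_mul, mul_add, ih2, smul_add]
        abel
      · rw [qIter, mul_sub, mul_smul_comm, ← mul_assoc, hxy, ← mul_assoc, ih2, smul_mul_assoc,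
          smul_mul_assoc, mul_assoc, mul_assoc _ x y, hxy, ih2]
        simp only [mul_smul_comm, smul_smul, sub_mul, smul_sub, smul_mul_assoc, mul_assoc,
          ← Units.val_mul, ← zpow_add]
        push_cast
        ring_nf
  rw [split, qSerre_eq_qIter, (A m).1, ← qSerre_eq_qIter, hx, qSerre_eq_qIter', (B m).1,
    ← qSerre_eq_qIter', hy, add_zero]

end Aux

/-- A symmetrizable Cartan matrix `a i j = α_j (α_i^∨)` together with the half square lengths
`d i = (α_i, α_i) / 2` of the simple roots for an inner product `(·, ·)`, so that
`(α_i, α_j) = d i * a i j`. -/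
structure CartanDatum (ι : Type*) where
  a : Matrix ι ι ℤ
  d : ι → ℕ
  d_pos : ∀ i, 0 < d i
  diag : ∀ i, a i i = 2
  nonpos : ∀ i j, i ≠ j → a i j ≤ 0
  symm : ∀ i j, (d i : ℤ) * a i j = (d j : ℤ) * a j i

/-- The inner product `(α_i, α_j)` of two simple roots. -/
def CartanDatum.form {ι : Type*} (C : CartanDatum ι) (i j : ι) : ℤ := (C.d i : ℤ) * C.a i j

/-- The Cartan datum of a semisimple complex Lie algebra `𝔤` with Cartan subalgebra `𝔥`, a base
`Pi` of simple roots, and an invariant inner product on `𝔥^*` for which the simple root `α_i` has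
square length `2 * d i`. Mathlib's `Pi.cartanMatrix j i` is `α_j (α_i^∨)`, hence the transpose. -/
noncomputable def CartanDatum.ofBase {𝔤 : Type*} [LieRing 𝔤] [LieAlgebra ℂ 𝔤] [FiniteDimensional ℂ 𝔤]
    [LieAlgebra.IsSemisimple ℂ 𝔤] {𝔥 : LieSubalgebra ℂ 𝔤} [𝔥.IsCartanSubalgebra]
    (Pi : (LieAlgebra.IsKilling.rootSystem 𝔥).Base) (d : Pi.support → ℕ) (hd : ∀ i, 0 < d i)
    (hsymm : ∀ i j, (d i : ℤ) * Pi.cartanMatrix j i = (d j : ℤ) * Pi.cartanMatrix i j) :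
    CartanDatum Pi.support where
  a := Pi.cartanMatrix.transpose
  d := d
  d_pos := hd
  diag i := by simp
  nonpos i j h := Pi.cartanMatrix_le_zero_of_ne _ _ h.symm
  symm := hsymm

/-- The generators `e_α`, `f_α`, `q^{h_α}`, `q^{-h_α}`, one of each for every simple root. -/
inductive UqGen (ι : Type*)
  | e (i : ι)
  | f (i : ι)
  | k (i : ι)
  | kInv (i : ι)

namespace UqGen
variable {ι : Type*}
abbrev E (i : ι) : FreeAlgebra ℂ (UqGen ι) := FreeAlgebra.ι ℂ (UqGen.e i)
abbrev F (i : ι) : FreeAlgebra ℂ (UqGen ι) := FreeAlgebra.ι ℂ (UqGen.f i)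
abbrev K (i : ι) : FreeAlgebra ℂ (UqGen ι) := FreeAlgebra.ι ℂ (UqGen.k i)
abbrev Kinv (i : ι) : FreeAlgebra ℂ (UqGen ι) := FreeAlgebra.ι ℂ (UqGen.kInv i)
end UqGen

open UqGen in
/-- The defining relations of the quantized universal enveloping algebra. -/
inductive UqRel {ι : Type*} (C : CartanDatum ι) (q : ℂˣ) :
    FreeAlgebra ℂ (UqGen ι) → FreeAlgebra ℂ (UqGen ι) → Prop
  | k_kInv (i : ι) : UqRel C q (K i * Kinv i) 1
  | kInv_k (i : ι) : UqRel C q (Kinv i * K i) 1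
  | k_k (i j : ι) : UqRel C q (K i * K j) (K j * K i)
  | k_e (i j : ι) : UqRel C q (K i * E j) (((q ^ C.form i j : ℂˣ) : ℂ) • (E j * K i))
  | k_f (i j : ι) : UqRel C q (K i * F j) (((q ^ (-C.form i j) : ℂˣ) : ℂ) • (F j * K i))
  | e_f_same (i : ι) :
      UqRel C q (E i * F i - F i * E i) (((q : ℂ) - (q : ℂ)⁻¹)⁻¹ • (K i - Kinv i))
  | e_f_ne (i j : ι) (h : i ≠ j) : UqRel C q (E i * F j - F j * E i) 0
  | serre_e (i j : ι) (h : i ≠ j) :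
      UqRel C q (qSerre (q ^ C.d i) (1 - C.a i j).toNat (E i) (E j)) 0
  | serre_f (i j : ι) (h : i ≠ j) :
      UqRel C q (qSerre (q ^ C.d i) (1 - C.a i j).toNat (F i) (F j)) 0

/-- The quantized universal enveloping algebra `U_q(𝔤)`. -/
def Uq {ι : Type*} (C : CartanDatum ι) (q : ℂˣ) : Type _ := RingQuot (UqRel C q)

namespace Uq
variable {ι : Type*} {C : CartanDatum ι} {q : ℂˣ}

noncomputable instance : Ring (Uq C q) := inferInstanceAs (Ring (RingQuot (UqRel C q)))
noncomputable instance : Algebra ℂ (Uq C q) := inferInstanceAs (Algebra ℂ (RingQuot (UqRel C q)))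

variable (C q) in
/-- The quotient map from the free algebra. -/
noncomputable def mk : FreeAlgebra ℂ (UqGen ι) →ₐ[ℂ] Uq C q := RingQuot.mkAlgHom ℂ (UqRel C q)

theorem mk_rel {x y : FreeAlgebra ℂ (UqGen ι)} (h : UqRel C q x y) : mk C q x = mk C q y :=
  RingQuot.mkAlgHom_rel ℂ h

variable (C q) in
/-- The generator `e_α`. -/
noncomputable def e (i : ι) : Uq C q := mk C q (UqGen.E i)
variable (C q) in
/-- The generator `f_α`. -/
noncomputable def f (i : ι) : Uq C q := mk C q (UqGen.F i)
variable (C q) in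
/-- The generator `q^{h_α}`. -/
noncomputable def k (i : ι) : Uq C q := mk C q (UqGen.K i)
variable (C q) in
/-- The generator `q^{-h_α}`. -/
noncomputable def kInv (i : ι) : Uq C q := mk C q (UqGen.Kinv i)

end Uq

/-- Elements of an algebra that satisfy the defining relations of `U_q(𝔤)`. -/
structure IsUqFamily {ι R : Type*} [Ring R] [Algebra ℂ R] (C : CartanDatum ι) (q : ℂˣ)
    (e f k kInv : ι → R) : Prop where
  k_kInv : ∀ i, k i * kInv i = 1
  kInv_k : ∀ i, kInv i * k i = 1
  k_k : ∀ i j, k i * k j = k j * k i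
  k_e : ∀ i j, k i * e j = ((q ^ C.form i j : ℂˣ) : ℂ) • (e j * k i)
  k_f : ∀ i j, k i * f j = ((q ^ (-C.form i j) : ℂˣ) : ℂ) • (f j * k i)
  e_f_same : ∀ i, e i * f i - f i * e i = ((q : ℂ) - (q : ℂ)⁻¹)⁻¹ • (k i - kInv i)
  e_f_ne : ∀ i j, i ≠ j → e i * f j - f j * e i = 0
  serre_e : ∀ i j, i ≠ j → qSerre (q ^ C.d i) (1 - C.a i j).toNat (e i) (e j) = 0
  serre_f : ∀ i j, i ≠ j → qSerre (q ^ C.d i) (1 - C.a i j).toNat (f i) (f j) = 0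

namespace Uq
variable {ι : Type*} {C : CartanDatum ι} {q : ℂˣ}

theorem isUqFamily : IsUqFamily C q (e C q) (f C q) (k C q) (kInv C q) where
  k_kInv i := by simpa [e, f, k, kInv] using mk_rel (UqRel.k_kInv (C := C) (q := q) i)
  kInv_k i := by simpa [e, f, k, kInv] using mk_rel (UqRel.kInv_k (C := C) (q := q) i)
  k_k i j := by simpa [e, f, k, kInv] using mk_rel (UqRel.k_k (C := C) (q := q) i j)
  k_e i j := by simpa only [e, f, k, kInv, map_mul, map_smul] using mk_rel (UqRel.k_e (C := C) (q := q) i j)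
  k_f i j := by simpa only [e, f, k, kInv, map_mul, map_smul] using mk_rel (UqRel.k_f (C := C) (q := q) i j)
  e_f_same i := by
    simpa only [e, f, k, kInv, map_mul, map_smul, map_sub] using mk_rel (UqRel.e_f_same (C := C) (q := q) i)
  e_f_ne i j h := by
    simpa only [e, f, k, kInv, map_mul, map_zero, map_sub] using mk_rel (UqRel.e_f_ne (C := C) (q := q) i j h)
  serre_e i j h := by
    simpa only [e, f, k, kInv, map_qSerre, map_zero] using mk_rel (UqRel.serre_e (C := C) (q := q) i j h)
  serre_f i j h := by
    simpa only [e, f, k, kInv, map_qSerre, map_zero] using mk_rel (UqRel.serre_f (C := C) (q := q) i j h)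

/-- The universal property of `U_q(𝔤)`. -/
noncomputable def lift {R : Type*} [Ring R] [Algebra ℂ R] {e f k kInv : ι → R}
    (h : IsUqFamily C q e f k kInv) : Uq C q →ₐ[ℂ] R :=
  RingQuot.liftAlgHom ℂ ⟨FreeAlgebra.lift ℂ fun
    | .e i => e i
    | .f i => f i
    | .k i => k i
    | .kInv i => kInv i, by
      intro x y hxy
      cases hxy with
      | k_kInv i => simpa using h.k_kInv i
      | kInv_k i => simpa using h.kInv_k i
      | k_k i j => simpa using h.k_k i j
      | k_e i j => simpa using h.k_e i j
      | k_f i j => simpa using h.k_f i j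
      | e_f_same i => simpa using h.e_f_same i
      | e_f_ne i j hij => simpa using h.e_f_ne i j hij
      | serre_e i j hij => simpa [map_qSerre] using h.serre_e i j hij
      | serre_f i j hij => simpa [map_qSerre] using h.serre_f i j hij⟩

section lift
variable {R : Type*} [Ring R] [Algebra ℂ R] {E F K Kinv : ι → R} (h : IsUqFamily C q E F K Kinv)

@[simp] theorem lift_e (i : ι) : lift h (e C q i) = E i :=
  (RingQuot.liftAlgHom_mkAlgHom_apply ℂ _ _ _).trans (FreeAlgebra.lift_ι_apply _ _)
@[simp] theorem lift_f (i : ι) : lift h (f C q i) = F i :=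
  (RingQuot.liftAlgHom_mkAlgHom_apply ℂ _ _ _).trans (FreeAlgebra.lift_ι_apply _ _)
@[simp] theorem lift_k (i : ι) : lift h (k C q i) = K i :=
  (RingQuot.liftAlgHom_mkAlgHom_apply ℂ _ _ _).trans (FreeAlgebra.lift_ι_apply _ _)
@[simp] theorem lift_kInv (i : ι) : lift h (kInv C q i) = Kinv i :=
  (RingQuot.liftAlgHom_mkAlgHom_apply ℂ _ _ _).trans (FreeAlgebra.lift_ι_apply _ _)
end lift
end Uq


theorem inv_commute_smul {R : Type*} [Ring R] [Algebra ℂ R] {x L L' : R} {u : ℂˣ}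
    (h1 : L * L' = 1) (h2 : L' * L = 1) (hx : L * x = (u : ℂ) • (x * L)) :
    L' * x = ((u⁻¹ : ℂˣ) : ℂ) • (x * L') := by
  have h3 : x * L' = (u : ℂ) • (L' * x) := by
    calc x * L' = L' * (L * x) * L' := by rw [← mul_assoc, h2, one_mul]
      _ = _ := by rw [hx, mul_smul_comm, smul_mul_assoc, mul_assoc, mul_assoc, h1, mul_one]
  rw [h3, smul_smul]
  simp

theorem CartanDatum.form_comm {ι : Type*} (C : CartanDatum ι) (i j : ι) :
    C.form i j = C.form j i := C.symm i j

theorem CartanDatum.form_self {ι : Type*} (C : CartanDatum ι) (q : ℂˣ) (i : ι) :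
    q ^ C.form i i = (q ^ C.d i) ^ (2 : ℤ) := by
  rw [CartanDatum.form, C.diag, ← zpow_natCast, ← zpow_mul]

theorem CartanDatum.form_ne {ι : Type*} (C : CartanDatum ι) (q : ℂˣ) {i j : ι} (h : i ≠ j) :
    q ^ C.form i j = (q ^ C.d i) ^ (1 - ((1 - C.a i j).toNat : ℤ)) := by
  have := C.nonpos i j h
  rw [CartanDatum.form, ← zpow_natCast, ← zpow_mul, Int.toNat_of_nonneg (by omega)]
  congr 2
  ring

namespace IsUqFamily
variable {ι R : Type*} [Ring R] [Algebra ℂ R] {C : CartanDatum ι} {q : ℂˣ}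
  {e f k kInv : ι → R}

theorem kInv_e (h : IsUqFamily C q e f k kInv) (i j : ι) :
    kInv i * e j = ((q ^ (-C.form i j) : ℂˣ) : ℂ) • (e j * kInv i) := by
  rw [zpow_neg]; exact inv_commute_smul (h.k_kInv i) (h.kInv_k i) (h.k_e i j)

theorem kInv_f (h : IsUqFamily C q e f k kInv) (i j : ι) :
    kInv i * f j = ((q ^ (C.form i j) : ℂˣ) : ℂ) • (f j * kInv i) := by
  have := inv_commute_smul (h.k_kInv i) (h.kInv_k i) (h.k_f i j)
  rwa [zpow_neg, inv_inv] at this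

theorem kInv_kInv (h : IsUqFamily C q e f k kInv) (i j : ι) : kInv i * kInv j = kInv j * kInv i := by
  have h1 : (kInv i * kInv j) * (k j * k i) = 1 := by
    rw [mul_assoc, ← mul_assoc _ (k j), h.kInv_k, one_mul, h.kInv_k]
  have h2 : (k j * k i) * (kInv j * kInv i) = 1 := by
    rw [h.k_k, mul_assoc, ← mul_assoc _ (kInv j), h.k_kInv, one_mul, h.k_kInv]
  exact left_inv_eq_right_inv h1 h2

theorem comul (h : IsUqFamily C q e f k kInv) : IsUqFamily C q (R := R ⊗[ℂ] R)
    (fun i => e i ⊗ₜ k i + 1 ⊗ₜ e i) (fun i => f i ⊗ₜ 1 + kInv i ⊗ₜ f i)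
    (fun i => k i ⊗ₜ k i) (fun i => kInv i ⊗ₜ kInv i) where
  k_kInv i := by simp [h.k_kInv, Algebra.TensorProduct.one_def]
  kInv_k i := by simp [h.kInv_k, Algebra.TensorProduct.one_def]
  k_k i j := by simp [h.k_k i j]
  k_e i j := by
    simp only [mul_add, add_mul, Algebra.TensorProduct.tmul_mul_tmul, h.k_e i j, h.k_k i j,
      TensorProduct.tmul_smul, ← TensorProduct.smul_tmul', smul_add, mul_one, one_mul]
  k_f i j := by
    have : k i * kInv j = kInv j * k i := by
      have h3 : k i * k j = ((1 : ℂˣ) : ℂ) • (k j * k i) := by simp [h.k_k i j]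
      have h4 : k j * k i = ((1 : ℂˣ) : ℂ) • (k i * k j) := by simp [h.k_k i j]
      simpa using (inv_commute_smul (h.k_kInv j) (h.kInv_k j) h4).symm
    simp only [mul_add, add_mul, Algebra.TensorProduct.tmul_mul_tmul, h.k_f i j, this,
      TensorProduct.tmul_smul, ← TensorProduct.smul_tmul', smul_add, mul_one, one_mul]
  e_f_same i := by
    have h5 : (e i * kInv i) ⊗ₜ[ℂ] (k i * f i) = (kInv i * e i) ⊗ₜ[ℂ] (f i * k i) := by
      rw [h.k_f, h.kInv_e, TensorProduct.tmul_smul, ← TensorProduct.smul_tmul']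
    have h6 := congrArg (fun x => x ⊗ₜ[ℂ] k i) (h.e_f_same i)
    have h7 := congrArg (fun x => kInv i ⊗ₜ[ℂ] x) (h.e_f_same i)
    simp only [TensorProduct.sub_tmul, TensorProduct.tmul_sub, TensorProduct.tmul_smul,
      ← TensorProduct.smul_tmul', smul_sub] at h6 h7
    simp only [mul_add, add_mul, Algebra.TensorProduct.tmul_mul_tmul, mul_one, one_mul, h5,
      smul_sub]
    have h8 := congrArg₂ (· + ·) h6 h7
    refine (Eq.trans ?_ h8).trans ?_ <;> abel
  e_f_ne i j hij := by
    have h5 : (e i * kInv j) ⊗ₜ[ℂ] (k i * f j) = (kInv j * e i) ⊗ₜ[ℂ] (f j * k i) := by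
      rw [h.k_f, h.kInv_e, TensorProduct.tmul_smul, ← TensorProduct.smul_tmul', C.form_comm]
    have h6 := congrArg (fun x => x ⊗ₜ[ℂ] k i) (h.e_f_ne i j hij)
    have h7 := congrArg (fun x => kInv j ⊗ₜ[ℂ] x) (h.e_f_ne i j hij)
    simp only [TensorProduct.sub_tmul, TensorProduct.tmul_sub, TensorProduct.zero_tmul,
      TensorProduct.tmul_zero] at h6 h7
    simp only [mul_add, add_mul, Algebra.TensorProduct.tmul_mul_tmul, mul_one, one_mul, h5]
    have h8 := congrArg₂ (· + ·) h6 h7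
    refine (Eq.trans ?_ h8).trans ?_ <;> abel
  serre_e i j hij := by
    have hl := map_qSerre (Algebra.TensorProduct.includeLeft : R →ₐ[ℂ] R ⊗[ℂ] R)
      (q ^ C.d i) (1 - C.a i j).toNat (e i) (e j)
    have hr := map_qSerre (Algebra.TensorProduct.includeRight : R →ₐ[ℂ] R ⊗[ℂ] R)
      (q ^ C.d i) (1 - C.a i j).toNat (e i) (e j)
    rw [h.serre_e i j hij, map_zero] at hl hr
    replace hl := hl.symm
    replace hr := hr.symm
    rw [Algebra.TensorProduct.includeLeft_apply, Algebra.TensorProduct.includeLeft_apply] at hl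
    rw [Algebra.TensorProduct.includeRight_apply, Algebra.TensorProduct.includeRight_apply] at hr
    refine qSerre_add _ _ ?_ ?_ ?_ ?_ hr
    · simp [← C.form_self, h.k_e, TensorProduct.tmul_smul]
    · rw [← C.form_ne q hij]; simp [h.k_e j i, TensorProduct.tmul_smul, C.form_comm j i]
    · rw [← C.form_ne q hij]; simp [h.k_e i j, TensorProduct.tmul_smul]
    · have := qSerre_mul _ _ (k := (1 : R) ⊗ₜ[ℂ] k i) (l := (1 : R) ⊗ₜ[ℂ] k j) (v := 1) (u := 1)
        (by simp) (by simp) (by simp) (by simp [h.k_k i j]) hl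
      simpa using this
  serre_f i j hij := by
    have hl := map_qSerre (Algebra.TensorProduct.includeLeft : R →ₐ[ℂ] R ⊗[ℂ] R)
      (q ^ C.d i) (1 - C.a i j).toNat (f i) (f j)
    have hr := map_qSerre (Algebra.TensorProduct.includeRight : R →ₐ[ℂ] R ⊗[ℂ] R)
      (q ^ C.d i) (1 - C.a i j).toNat (f i) (f j)
    rw [h.serre_f i j hij, map_zero] at hl hr
    replace hl := hl.symm
    replace hr := hr.symm
    rw [Algebra.TensorProduct.includeLeft_apply, Algebra.TensorProduct.includeLeft_apply] at hl
    rw [Algebra.TensorProduct.includeRight_apply, Algebra.TensorProduct.includeRight_apply] at hr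
    rw [add_comm (f i ⊗ₜ[ℂ] (1 : R)), add_comm (f j ⊗ₜ[ℂ] (1 : R))]
    refine qSerre_add _ _ ?_ ?_ ?_ ?_ hl
    · simp [← C.form_self, h.kInv_f, ← TensorProduct.smul_tmul']
    · rw [← C.form_ne q hij]; simp [h.kInv_f j i, ← TensorProduct.smul_tmul', C.form_comm j i]
    · rw [← C.form_ne q hij]; simp [h.kInv_f i j, ← TensorProduct.smul_tmul']
    · have := qSerre_mul _ _ (k := kInv i ⊗ₜ[ℂ] (1 : R)) (l := kInv j ⊗ₜ[ℂ] (1 : R)) (v := 1)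
        (u := 1) (by simp) (by simp) (by simp) (by simp [h.kInv_kInv i j]) hr
      simpa using this

open MulOpposite in
theorem omega (h : IsUqFamily C q e f k kInv) : IsUqFamily C q (R := Rᵐᵒᵖ)
    (fun i => op (-(f i * k i))) (fun i => op (-(kInv i * e i)))
    (fun i => op (k i)) (fun i => op (kInv i)) where
  k_kInv i := by rw [← op_mul, h.kInv_k, op_one]
  kInv_k i := by rw [← op_mul, h.k_kInv, op_one]
  k_k i j := by rw [← op_mul, ← op_mul, h.k_k]
  k_e i j := by
    rw [← op_mul, ← op_mul, ← op_smul, mul_neg, neg_mul, ← mul_assoc, h.k_f, smul_mul_assoc,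
      smul_neg, smul_smul, ← Units.val_mul, ← zpow_add, mul_assoc, mul_assoc, h.k_k i j]
    simp
  k_f i j := by
    have : k i * kInv j = kInv j * k i := by
      have h4 : k j * k i = ((1 : ℂˣ) : ℂ) • (k i * k j) := by simp [h.k_k i j]
      simpa using (inv_commute_smul (h.k_kInv j) (h.kInv_k j) h4).symm
    rw [← op_mul, ← op_mul, ← op_smul, mul_neg, neg_mul, ← mul_assoc, this, mul_assoc (kInv j) (k i),
      h.k_e, mul_smul_comm, smul_neg, smul_smul, ← Units.val_mul, ← zpow_add, ← mul_assoc]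
    simp
  e_f_same i := by
    have h1 : kInv i * e i * (f i * k i) = e i * f i := by
      rw [h.kInv_e, smul_mul_assoc, mul_assoc, ← mul_assoc (kInv i), h.kInv_f, smul_mul_assoc,
        mul_smul_comm, smul_smul, ← Units.val_mul, ← zpow_add, mul_assoc, h.kInv_k]
      simp
    have h2 : f i * k i * (kInv i * e i) = f i * e i := by
      rw [mul_assoc, ← mul_assoc (k i), h.k_kInv, one_mul]
    rw [← op_mul, ← op_mul, ← op_sub, ← op_sub, ← op_smul, neg_mul_neg, neg_mul_neg, h1, h2,
      h.e_f_same]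
  e_f_ne i j hij := by
    have hc : e j * f i = f i * e j := sub_eq_zero.1 (h.e_f_ne j i hij.symm)
    have h0 : k i * kInv j = kInv j * k i := by
      have h4 : k j * k i = ((1 : ℂˣ) : ℂ) • (k i * k j) := by simp [h.k_k i j]
      simpa using (inv_commute_smul (h.k_kInv j) (h.kInv_k j) h4).symm
    have h1 : kInv j * e j * (f i * k i) =
        ((q ^ C.form j i : ℂˣ) : ℂ) • (f i * kInv j * (e j * k i)) := by
      rw [mul_assoc, ← mul_assoc (e j), hc, mul_assoc (f i), ← mul_assoc (kInv j), h.kInv_f,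
        smul_mul_assoc]
    have h2 : f i * k i * (kInv j * e j) =
        ((q ^ C.form i j : ℂˣ) : ℂ) • (f i * kInv j * (e j * k i)) := by
      rw [mul_assoc, ← mul_assoc (k i), h0, mul_assoc (kInv j), h.k_e, mul_smul_comm,
        mul_smul_comm, ← mul_assoc]
    rw [← op_mul, ← op_mul, ← op_sub, neg_mul_neg, neg_mul_neg, h1, h2, C.form_comm, sub_self,
      op_zero]
  serre_e i j hij := by
    refine qSerre_op _ _ _ _ ?_
    have := qSerre_mul _ _ (h.k_f i i) (h.k_f i j)
      (by rw [h.k_f j i, C.form_comm j i]) (h.k_k i j) (h.serre_f i j hij)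
    have h2 := qSerre_smul (q ^ C.d i) (1 - C.a i j).toNat (-1) (-1) (f i * k i) (f j * k j)
    rw [this, smul_zero] at h2
    simpa only [neg_smul, one_smul] using h2
  serre_f i j hij := by
    refine qSerre_op _ _ _ _ ?_
    have := qSerre_mul _ _ (h.kInv_e i i) (h.kInv_e i j)
      (by rw [h.kInv_e j i, C.form_comm j i]) (h.kInv_kInv i j) (h.serre_e i j hij)
    have h2 := qSerre_smul (q ^ C.d i) (1 - C.a i j).toNat
      (-((q ^ (-C.form i i) : ℂˣ) : ℂ)) (-((q ^ (-C.form j j) : ℂˣ) : ℂ))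
      (e i * kInv i) (e j * kInv j)
    rw [this, smul_zero] at h2
    simpa only [neg_smul, ← h.kInv_e] using h2

end IsUqFamily

namespace Uq
variable {ι : Type*} {C : CartanDatum ι} {q : ℂˣ}

/-- The comultiplication: `Δ(e) = e ⊗ q^h + 1 ⊗ e`, `Δ(f) = f ⊗ 1 + q^{-h} ⊗ f`,
`Δ(q^{±h}) = q^{±h} ⊗ q^{±h}`. -/
noncomputable def comul : Uq C q →ₐ[ℂ] Uq C q ⊗[ℂ] Uq C q := lift isUqFamily.comul

/-- The algebra anti-automorphism `ω = γ⁻¹ ∘ σ`, where `γ` is the antipode and `σ` is the algebra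
automorphism `e ↦ f`, `f ↦ e`, `q^h ↦ q^{-h}`. On generators `ω(e) = γ⁻¹(f) = -f q^h`,
`ω(f) = γ⁻¹(e) = -q^{-h} e`, `ω(q^{±h}) = q^{±h}`. -/
noncomputable def omega : Uq C q →ₐ[ℂ] (Uq C q)ᵐᵒᵖ := lift isUqFamily.omega

end Uq

/-- Representations of `U_q(𝔤)` on a complex vector space `V`. -/
abbrev UqRep {ι : Type*} (C : CartanDatum ι) (q : ℂˣ) (V : Type*) [AddCommGroup V] [Module ℂ V] :=
  Uq C q →ₐ[ℂ] Module.End ℂ V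

namespace UqRep
variable {ι : Type*} {C : CartanDatum ι} {q : ℂˣ}
  {V : Type*} [AddCommGroup V] [Module ℂ V] {Z : Type*} [AddCommGroup Z] [Module ℂ Z]

/-- The tensor product of two representations, through the comultiplication. -/
noncomputable def tensor (ρ : UqRep C q V) (τ : UqRep C q Z) : UqRep C q (V ⊗[ℂ] Z) :=
  ((Module.endTensorEndAlgHom (R := ℂ) (S := ℂ) (A := ℂ) (M := V) (N := Z)).comp
    (Algebra.TensorProduct.map ρ τ)).comp Uq.comul

/-- `v` lies in the weight space of weight `μ`; a weight is recorded by the scalars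
`μ i = q^{(α_i, μ)}` by which the `q^{h_{α_i}}` act. -/
def IsWeightVector (ρ : UqRep C q V) (μ : ι → ℂ) (v : V) : Prop :=
  ∀ i, ρ (Uq.k C q i) v = μ i • v

/-- A singular vector: a non-zero weight vector killed by all `e_α`. -/
def IsSingular (ρ : UqRep C q V) (v : V) : Prop :=
  v ≠ 0 ∧ (∃ μ : ι → ℂ, ρ.IsWeightVector μ v) ∧ ∀ i, ρ (Uq.e C q i) v = 0

/-- The span `V⁺` of the singular vectors. -/
def singularSpace (ρ : UqRep C q V) : Submodule ℂ V :=
  Submodule.span ℂ {v | ρ.IsSingular v}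

/-- Highest weight modules: generated by one singular vector. -/
def IsHighestWeight (ρ : UqRep C q V) : Prop :=
  ∃ v : V, ρ.IsSingular v ∧ ∀ w : V, ∃ x : Uq C q, ρ x v = w

/-- Irreducible modules. -/
def IsIrreducible (ρ : UqRep C q V) : Prop :=
  Nontrivial V ∧
    ∀ W : Submodule ℂ V, (∀ x : Uq C q, ∀ w ∈ W, ρ x w ∈ W) → W = ⊥ ∨ W = ⊤

/-- Contravariant forms: symmetric bilinear forms with `⟨x v, w⟩ = ⟨v, ω(x) w⟩`. -/
def IsContravariant (ρ : UqRep C q V) (B : LinearMap.BilinForm ℂ V) : Prop :=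
  B.IsSymm ∧ ∀ (x : Uq C q) (v w : V), B (ρ x v) w = B v (ρ (Uq.omega x).unop w)

/-- Shapovalov forms of a highest weight module: its non-zero contravariant forms. They are
unique up to a non-zero scalar. -/
def IsShapovalovForm (ρ : UqRep C q V) (B : LinearMap.BilinForm ℂ V) : Prop :=
  ρ.IsContravariant B ∧ B ≠ 0

/-- The canonical form on `V ⊗ Z`: the product of Shapovalov forms,
`⟨v ⊗ z, v' ⊗ z'⟩ = ⟨v, v'⟩ ⟨z, z'⟩`. -/
def IsCanonicalForm (ρ : UqRep C q V) (τ : UqRep C q Z)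
    (B : LinearMap.BilinForm ℂ (V ⊗[ℂ] Z)) : Prop :=
  ∃ (BV : LinearMap.BilinForm ℂ V) (BZ : LinearMap.BilinForm ℂ Z),
    ρ.IsShapovalovForm BV ∧ τ.IsShapovalovForm BZ ∧ B = LinearMap.BilinForm.tmul BV BZ

end UqRep

end QuantumGroup

open QuantumGroup

/-! Put `M = V ⊗ Z`. By irreducibility both Shapovalov forms are non-degenerate, so the product form
on `M` is symmetric and non-degenerate, and for it `f_α` is adjoint to `-q^{-h_α} e_α`
(`tensor_contravariant_f`). Hence the orthogonal complement of `∑ f_α M` is the common kernel of the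
`e_α`, which is `M⁺` because `M` is spanned by weight vectors. The radical of the restricted form is
therefore `M⁺ ∩ ∑ f_α M`, and this intersection has to vanish. Complete reducibility would give
this; a Casimir argument takes its place here.

The free algebra on the simple roots carries Lusztig's symmetric form, for which multiplication by a
letter is adjoint to a skew derivation. The same skew derivations govern the commutators of words in
the `f_α` with `e_j` and of words in the `e_α` with `f_j`. So the canonical element of the form,
with words in the `f_α` in one factor and words in the `e_α` in the other, acts on `M` as an
operator `T` that commutes with the `q^{h_α}`, fixes every vector killed by all `e_α`, and commutes
with `e_j` and `f_j` up to `q^{-2 h_j}` (`exists_quasiCasimir`). It is well defined once the radical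
of Lusztig's form acts by zero on `M`. For words in the `e_α`, the vectors killed by the radical
form a submodule, which is everything for a highest weight module (`radicalKernel_eq_top`) and then
for the tensor product (`tensor_radicalKernel_eq_top`). Adjointness transfers this to words in the
`f_α` (`evalRev_eq_zero_of_form`).

Let `v` be a singular vector of weight `μ` in `W = ∑ f_j M_{μ + α_j}`. If `T` had on `M_{μ + α_j}`
the eigenvalue `a = q^{c(μ + α_j) - c(μ)}`, where `c(λ) = (λ, λ + 2ρ)`, then raising an eigenvector
as far as possible would give a singular vector of weight `ν = μ + β`, `β > 0`, with `q^{c(ν) -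
c(μ)} = 1`. This contradicts the dominance of `μ` and `ν`, as `q` is not a root of unity. So `T - a`
is bijective on `M_{μ + α_j}`, whence `W ⊆ (T - 1) W`. By dimension `T - 1` is injective on `W`, and
it kills `v`, so `v = 0` (`eq_zero_of_mem_iSup_map_f`).

A Shapovalov form is the matrix coefficient `(x v₀, y v₀) ↦ φ(ω(x) y v₀)` of a highest weight
functional `φ` (`exists_shapovalov`). -/

namespace QuantumGroup

/-! ### Words, skew derivations and Lusztig's form on the free algebra. -/

/-- The free algebra on the simple roots, as the vector space with basis the words. -/
abbrev WordSpace (ι : Type*) := List ι →₀ ℂ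

namespace WordSpace
variable {ι : Type*}

/-- Left multiplication by a letter. -/
noncomputable def cons (j : ι) : WordSpace ι →ₗ[ℂ] WordSpace ι :=
  Finsupp.lmapDomain ℂ ℂ (List.cons j)

/-- Right multiplication by a letter. -/
noncomputable def snoc (j : ι) : WordSpace ι →ₗ[ℂ] WordSpace ι :=
  Finsupp.lmapDomain ℂ ℂ (· ++ [j])

/-- Rescaling of each word by the product of the scalars of its letters. -/
noncomputable def twist (χ : ι → ℂ) : WordSpace ι →ₗ[ℂ] WordSpace ι :=
  Finsupp.linearCombination ℂ fun w => Finsupp.single w (w.map χ).prod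

@[simp] theorem cons_single (j : ι) (w : List ι) (a : ℂ) :
    cons j (Finsupp.single w a) = Finsupp.single (j :: w) a := by simp [cons]

@[simp] theorem snoc_single (j : ι) (w : List ι) (a : ℂ) :
    snoc j (Finsupp.single w a) = Finsupp.single (w ++ [j]) a := by simp [snoc]

@[simp] theorem twist_single (χ : ι → ℂ) (w : List ι) (a : ℂ) :
    twist χ (Finsupp.single w a) = Finsupp.single w (a * (w.map χ).prod) := by simp [twist]

/-- Linear maps out of the word space agree if they agree on the words. -/
theorem hom_ext {N : Type*} [AddCommGroup N] [Module ℂ N] {φ ψ : WordSpace ι →ₗ[ℂ] N}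
    (h : ∀ w : List ι, φ (Finsupp.single w 1) = ψ (Finsupp.single w 1)) : φ = ψ :=
  Finsupp.lhom_ext' fun w => LinearMap.ext_ring (h w)

theorem twist_cons (χ : ι → ℂ) (j : ι) (x : WordSpace ι) :
    twist χ (cons j x) = χ j • cons j (twist χ x) := by
  have : twist χ ∘ₗ cons j = χ j • cons j ∘ₗ twist χ := hom_ext fun w => by simp
  exact LinearMap.congr_fun this x

theorem twist_twist_inv (χ χ' : ι → ℂ) (h : ∀ i, χ i * χ' i = 1) (x : WordSpace ι) :
    twist χ (twist χ' x) = x := by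
  have : twist χ ∘ₗ twist χ' = LinearMap.id := hom_ext fun w => by
    have : (w.map χ').prod * (w.map χ).prod = 1 := by
      induction w with
      | nil => simp
      | cons i w ih => simp only [List.map_cons, List.prod_cons]; linear_combination ih + (w.map χ').prod * (w.map χ).prod * h i
    simp [this]
  exact LinearMap.congr_fun this x

theorem cons_apply_nil (j : ι) (x : WordSpace ι) : cons j x [] = 0 := by
  have : Finsupp.lapply [] ∘ₗ cons j = 0 := hom_ext fun w => by simp
  exact LinearMap.congr_fun this x

/-- The projection to the span of the words of length less than `N`. -/
noncomputable def truncate (N : ℕ) : WordSpace ι →ₗ[ℂ] WordSpace ι :=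
  Finsupp.linearCombination ℂ fun w => if w.length < N then Finsupp.single w 1 else 0

theorem truncate_single (N : ℕ) (w : List ι) :
    truncate N (Finsupp.single w 1) = if w.length < N then Finsupp.single w 1 else 0 := by
  simp [truncate]

theorem truncate_cons (N : ℕ) (j : ι) (x : WordSpace ι) :
    truncate (N + 1) (cons j x) = cons j (truncate N x) := by
  have : truncate (N + 1) ∘ₗ cons j = cons j ∘ₗ truncate N := hom_ext fun w => by
    simp only [LinearMap.comp_apply, cons_single, truncate_single, List.length_cons,
      add_lt_add_iff_right]
    split_ifs <;> simp
  exact LinearMap.congr_fun this x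

theorem truncate_zero (x : WordSpace ι) : truncate 0 x = 0 := by
  have : truncate 0 = (0 : WordSpace ι →ₗ[ℂ] WordSpace ι) := hom_ext fun w => by
    simp [truncate_single]
  exact LinearMap.congr_fun this x

variable (C : CartanDatum ι) (q : ℂˣ)

/-- The scalar `q ^ (α_j, α_i)`. -/
noncomputable def qForm (j i : ι) : ℂ := ((q ^ C.form j i : ℂˣ) : ℂ)

/-- The scalar `q ^ (-(α_j, α_i))`. -/
noncomputable def qFormInv (j i : ι) : ℂ := ((q ^ (-C.form j i) : ℂˣ) : ℂ)

theorem qForm_mul_inv (j i : ι) : qForm C q j i * qFormInv C q j i = 1 := by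
  rw [qForm, qFormInv, ← Units.val_mul, ← zpow_add]; simp

theorem qFormInv_mul (j i : ι) : qFormInv C q j i * qForm C q j i = 1 := by
  rw [mul_comm, qForm_mul_inv]

theorem qForm_comm (j i : ι) : qForm C q j i = qForm C q i j := by
  rw [qForm, qForm, C.form_comm]

theorem qFormInv_comm (j i : ι) : qFormInv C q j i = qFormInv C q i j := by
  rw [qFormInv, qFormInv, C.form_comm]

variable [DecidableEq ι]

/-- The skew derivation that removes a letter `j` from a word, with the twist
`q ^ (-(α_j, ·))` of the letters to the left, on words. -/
noncomputable def leftDerivWord (j : ι) : List ι → WordSpace ι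
  | [] => 0
  | i :: w => (if i = j then Finsupp.single w 1 else 0) +
      qFormInv C q j i • cons i (leftDerivWord j w)

/-- The skew derivation that removes a letter `j` from a word, with the twist
`q ^ (-(α_j, ·))` of the letters to the right, on words. -/
noncomputable def rightDerivWord (j : ι) : List ι → WordSpace ι
  | [] => 0
  | i :: w => (if i = j then Finsupp.single w (w.map (qFormInv C q j)).prod else 0) +
      cons i (rightDerivWord j w)

/-- The left skew derivation. -/
noncomputable def leftDeriv (j : ι) : WordSpace ι →ₗ[ℂ] WordSpace ι :=
  Finsupp.linearCombination ℂ (leftDerivWord C q j)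

/-- The right skew derivation. -/
noncomputable def rightDeriv (j : ι) : WordSpace ι →ₗ[ℂ] WordSpace ι :=
  Finsupp.linearCombination ℂ (rightDerivWord C q j)

theorem leftDeriv_single (j : ι) (w : List ι) :
    leftDeriv C q j (Finsupp.single w 1) = leftDerivWord C q j w := by simp [leftDeriv]

theorem rightDeriv_single (j : ι) (w : List ι) :
    rightDeriv C q j (Finsupp.single w 1) = rightDerivWord C q j w := by simp [rightDeriv]

theorem leftDeriv_cons (j i : ι) (x : WordSpace ι) :
    leftDeriv C q j (cons i x) =
      (if i = j then x else 0) + qFormInv C q j i • cons i (leftDeriv C q j x) := by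
  by_cases h : i = j
  · have : leftDeriv C q j ∘ₗ cons i = LinearMap.id + qFormInv C q j i • cons i ∘ₗ leftDeriv C q j :=
      hom_ext fun w => by simp [leftDeriv_single, leftDerivWord, h]
    simpa [h] using LinearMap.congr_fun this x
  · have : leftDeriv C q j ∘ₗ cons i = qFormInv C q j i • cons i ∘ₗ leftDeriv C q j :=
      hom_ext fun w => by simp [leftDeriv_single, leftDerivWord, h]
    simpa [h] using LinearMap.congr_fun this x

theorem rightDeriv_cons (j i : ι) (x : WordSpace ι) :
    rightDeriv C q j (cons i x) =
      (if i = j then twist (qFormInv C q j) x else 0) + cons i (rightDeriv C q j x) := by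
  by_cases h : i = j
  · have : rightDeriv C q j ∘ₗ cons i = twist (qFormInv C q j) + cons i ∘ₗ rightDeriv C q j :=
      hom_ext fun w => by simp [rightDeriv_single, rightDerivWord, h]
    simpa [h] using LinearMap.congr_fun this x
  · have : rightDeriv C q j ∘ₗ cons i = cons i ∘ₗ rightDeriv C q j :=
      hom_ext fun w => by simp [rightDeriv_single, rightDerivWord, h]
    simpa [h] using LinearMap.congr_fun this x

@[simp] theorem leftDeriv_nil (j : ι) (a : ℂ) : leftDeriv C q j (Finsupp.single [] a) = 0 := by
  simp [leftDeriv, leftDerivWord]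

@[simp] theorem rightDeriv_nil (j : ι) (a : ℂ) : rightDeriv C q j (Finsupp.single [] a) = 0 := by
  simp [rightDeriv, rightDerivWord]

theorem leftDeriv_twist (χ : ι → ℂ) (j : ι) (x : WordSpace ι) :
    leftDeriv C q j (twist χ x) = χ j • twist χ (leftDeriv C q j x) := by
  have : leftDeriv C q j ∘ₗ twist χ = χ j • twist χ ∘ₗ leftDeriv C q j := hom_ext fun w => by
    induction w with
    | nil => simp
    | cons i w ih =>
      simp only [LinearMap.comp_apply, LinearMap.smul_apply] at ih ⊢
      rw [← cons_single, twist_cons, map_smul, leftDeriv_cons, leftDeriv_cons, ih, map_add, map_smul (twist χ),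
        twist_cons, map_smul]
      split_ifs with h
      · subst h; simp only [smul_add, smul_smul]
      · simp only [smul_add, smul_smul, map_zero, smul_zero]; congr 2; ring
  exact LinearMap.congr_fun this x

/-- When the letter removed by the right derivation stands to the left of the other one, each order
of removal loses one factor, `q ^ (-(α_i, α_j))` or `q ^ (-(α_j, α_i))`; otherwise nothing is lost.
The symmetry of the inner product makes the two agree. -/
theorem leftDeriv_rightDeriv (i j : ι) (x : WordSpace ι) :
    leftDeriv C q i (rightDeriv C q j x) = rightDeriv C q j (leftDeriv C q i x) := by
  have : leftDeriv C q i ∘ₗ rightDeriv C q j = rightDeriv C q j ∘ₗ leftDeriv C q i :=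
    hom_ext fun w => by
    induction w with
    | nil => simp
    | cons l w ih =>
      simp only [LinearMap.comp_apply] at ih ⊢
      rw [← cons_single, leftDeriv_cons, rightDeriv_cons, map_add, map_add, leftDeriv_cons, map_smul,
        rightDeriv_cons, ih]
      by_cases h1 : l = i <;> by_cases h2 : l = j
      · subst h1; subst h2; simp [leftDeriv_twist, -twist_single]; abel
      · subst h1; simp [h2]
      · subst h2; simp [h1, leftDeriv_twist, qFormInv_comm C q l i, -twist_single]
      · simp [h1, h2]
  exact LinearMap.congr_fun this x

/-- The form on the word space for which `cons j` is adjoint to `leftDeriv j`, on words. -/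
noncomputable def formWord : List ι → WordSpace ι →ₗ[ℂ] ℂ
  | [] => Finsupp.lapply []
  | j :: w => formWord w ∘ₗ leftDeriv C q j

/-- The form on the word space for which `cons j` is adjoint to `leftDeriv j`. -/
noncomputable def form : WordSpace ι →ₗ[ℂ] WordSpace ι →ₗ[ℂ] ℂ :=
  Finsupp.linearCombination ℂ (formWord C q)

theorem form_nil (y : WordSpace ι) : form C q (Finsupp.single [] 1) y = y [] := by
  simp [form, formWord]

theorem form_cons (j : ι) (x y : WordSpace ι) :
    form C q (cons j x) y = form C q x (leftDeriv C q j y) := by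
  have : form C q ∘ₗ cons j = (form C q).compl₂ (leftDeriv C q j) :=
    hom_ext fun w => by ext; simp [form, formWord]
  exact LinearMap.congr_fun (LinearMap.congr_fun this x) y

theorem form_cons_right (j : ι) (x y : WordSpace ι) :
    form C q x (cons j y) = form C q (leftDeriv C q j x) y := by
  have : (form C q).compl₂ (cons j) = form C q ∘ₗ leftDeriv C q j := hom_ext fun w => by
    induction w with
    | nil => ext y; simp [form_nil]
    | cons i w ih =>
      refine LinearMap.ext fun y => ?_
      have ih' := fun y => LinearMap.congr_fun ih y
      simp only [LinearMap.compl₂_apply, LinearMap.comp_apply] at ih' ⊢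
      rw [← cons_single, form_cons, leftDeriv_cons, leftDeriv_cons, map_add, map_add, map_smul,
        map_smul, ih', LinearMap.add_apply, LinearMap.smul_apply, form_cons, qFormInv_comm C q i j]
      by_cases h : i = j
      · simp [h]
      · simp [h, Ne.symm h]
  exact LinearMap.congr_fun (LinearMap.congr_fun this x) y

theorem form_symm (x y : WordSpace ι) : form C q x y = form C q y x := by
  have : form C q = (form C q).flip := hom_ext fun w => by
    induction w with
    | nil =>
      refine hom_ext fun w => ?_
      cases w with
      | nil => simp
      | cons j w => rw [LinearMap.flip_apply, form_nil, ← cons_single, form_cons]; simp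
    | cons i w ih =>
      refine LinearMap.ext fun y => ?_
      rw [LinearMap.flip_apply, ← cons_single, form_cons, form_cons_right, ih, LinearMap.flip_apply]
  exact LinearMap.congr_fun (LinearMap.congr_fun this x) y

theorem leftDeriv_apply_nil (j : ι) (x : WordSpace ι) :
    leftDeriv C q j x [] = rightDeriv C q j x [] := by
  have : Finsupp.lapply [] ∘ₗ leftDeriv C q j = Finsupp.lapply [] ∘ₗ rightDeriv C q j :=
    hom_ext fun w => by
    cases w with
    | nil => simp
    | cons i w =>
      simp only [LinearMap.comp_apply, ← cons_single i, leftDeriv_cons, rightDeriv_cons,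
        Finsupp.lapply_apply, Finsupp.add_apply, Finsupp.smul_apply, cons_apply_nil]
      by_cases h : i = j
      · cases w <;> simp [h]
      · simp [h]
  exact LinearMap.congr_fun this x

/-- Since the two derivations commute, letters can be peeled off `x` from the left until the empty
word remains, where both derivations have the same constant term. -/
theorem form_snoc (j : ι) (x y : WordSpace ι) :
    form C q (snoc j x) y = form C q x (rightDeriv C q j y) := by
  have : form C q ∘ₗ snoc j = (form C q).compl₂ (rightDeriv C q j) := hom_ext fun w => by
    induction w with
    | nil =>
      refine LinearMap.ext fun y => ?_
      rw [LinearMap.comp_apply, snoc_single, List.nil_append, ← cons_single, form_cons,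
        LinearMap.compl₂_apply, form_nil, form_nil, leftDeriv_apply_nil]
    | cons i w ih =>
      refine LinearMap.ext fun y => ?_
      have ih' := fun y => LinearMap.congr_fun ih y
      simp only [LinearMap.compl₂_apply, LinearMap.comp_apply, snoc_single] at ih' ⊢
      rw [List.cons_append, ← cons_single, form_cons, ih', ← cons_single, form_cons,
        leftDeriv_rightDeriv]
  exact LinearMap.congr_fun (LinearMap.congr_fun this x) y

theorem form_twist (χ : ι → ℂ) (x y : WordSpace ι) :
    form C q (twist χ x) y = form C q x (twist χ y) := by
  have : form C q ∘ₗ twist χ = (form C q).compl₂ (twist χ) := hom_ext fun w => by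
    induction w with
    | nil => refine hom_ext fun w => ?_
             cases w <;> simp [form_nil]
    | cons i w ih =>
      refine LinearMap.ext fun y => ?_
      have ih' := fun y => LinearMap.congr_fun ih y
      simp only [LinearMap.compl₂_apply, LinearMap.comp_apply] at ih' ⊢
      rw [← cons_single, twist_cons, map_smul, LinearMap.smul_apply, form_cons, ih', form_cons,
        leftDeriv_twist, map_smul]
  exact LinearMap.congr_fun (LinearMap.congr_fun this x) y

/-- The radical of the form. -/
noncomputable def radical : Submodule ℂ (WordSpace ι) := LinearMap.ker (form C q)

variable {C q}

theorem mem_radical {x : WordSpace ι} : x ∈ radical C q ↔ ∀ y, form C q x y = 0 := by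
  rw [radical, LinearMap.mem_ker]
  exact ⟨fun h y => by rw [h]; rfl, fun h => LinearMap.ext h⟩

theorem apply_nil_of_mem_radical {x : WordSpace ι} (hx : x ∈ radical C q) : x [] = 0 := by
  rw [← form_nil C q, form_symm, mem_radical.1 hx]

/-- An operator that has an adjoint preserves the radical. This and the next three closure
properties make the vectors killed by the radical a submodule. -/
theorem snoc_mem_radical {x : WordSpace ι} (hx : x ∈ radical C q) (j : ι) :
    snoc j x ∈ radical C q :=
  mem_radical.2 fun y => by rw [form_snoc, mem_radical.1 hx]

theorem twist_mem_radical {x : WordSpace ι} (hx : x ∈ radical C q) (χ : ι → ℂ) :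
    twist χ x ∈ radical C q :=
  mem_radical.2 fun y => by rw [form_twist, mem_radical.1 hx]

theorem leftDeriv_mem_radical {x : WordSpace ι} (hx : x ∈ radical C q) (j : ι) :
    leftDeriv C q j x ∈ radical C q :=
  mem_radical.2 fun y => by rw [form_symm, ← form_cons, form_symm, mem_radical.1 hx]

theorem rightDeriv_mem_radical {x : WordSpace ι} (hx : x ∈ radical C q) (j : ι) :
    rightDeriv C q j x ∈ radical C q :=
  mem_radical.2 fun y => by rw [form_symm, ← form_snoc, form_symm, mem_radical.1 hx]

variable (C q)

theorem leftDeriv_truncate (N : ℕ) (j : ι) (x : WordSpace ι) :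
    leftDeriv C q j (truncate (N + 1) x) = truncate N (leftDeriv C q j x) := by
  have : leftDeriv C q j ∘ₗ truncate (N + 1) = truncate N ∘ₗ leftDeriv C q j := hom_ext fun w => by
    induction w generalizing N with
    | nil => simp [truncate_single]
    | cons i w ih =>
      simp only [LinearMap.comp_apply] at ih ⊢
      rw [← cons_single, truncate_cons, leftDeriv_cons, leftDeriv_cons, map_add, map_smul]
      congr 1
      · split_ifs <;> simp
      · cases N with
        | zero => simp [truncate_zero]
        | succ N => rw [truncate_cons, ih]
  exact LinearMap.congr_fun this x

/-- Words of different lengths are orthogonal, because each derivation lowers the length by exactly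
one. -/
theorem form_truncate (N : ℕ) (x y : WordSpace ι) :
    form C q (truncate N x) y = form C q x (truncate N y) := by
  have : form C q ∘ₗ truncate N = (form C q).compl₂ (truncate N) := hom_ext fun w => by
    induction w generalizing N with
    | nil =>
      refine hom_ext fun w => ?_
      simp only [LinearMap.comp_apply, LinearMap.compl₂_apply, truncate_single]
      cases w <;> cases N <;> simp [form_nil]
      split_ifs <;> simp
    | cons i w ih =>
      refine LinearMap.ext fun y => ?_
      simp only [LinearMap.compl₂_apply, LinearMap.comp_apply]
      cases N with
      | zero => simp [truncate_zero]
      | succ N =>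
        have ih' := fun y => LinearMap.congr_fun (ih N) y
        simp only [LinearMap.compl₂_apply, LinearMap.comp_apply] at ih'
        rw [← cons_single, truncate_cons, form_cons, form_cons, ih', leftDeriv_truncate]
  exact LinearMap.congr_fun (LinearMap.congr_fun this x) y

end WordSpace

/-! ### Evaluation of words in an algebra. -/

namespace WordSpace
variable {ι R : Type*} [Ring R] [Algebra ℂ R]

/-- The algebra map from the free algebra that evaluates the letters, as a linear map. -/
noncomputable def eval (x : ι → R) : WordSpace ι →ₗ[ℂ] R :=
  Finsupp.linearCombination ℂ fun w => (w.map x).prod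

/-- The evaluation of the reversed words. -/
noncomputable def evalRev (x : ι → R) : WordSpace ι →ₗ[ℂ] R :=
  Finsupp.linearCombination ℂ fun w => (w.reverse.map x).prod

theorem eval_single (x : ι → R) (w : List ι) :
    eval x (Finsupp.single w 1) = (w.map x).prod := by simp [eval]

theorem evalRev_single (x : ι → R) (w : List ι) :
    evalRev x (Finsupp.single w 1) = (w.reverse.map x).prod := by simp [evalRev]

theorem eval_cons (x : ι → R) (j : ι) (a : WordSpace ι) :
    eval x (cons j a) = x j * eval x a := by
  have : eval x ∘ₗ cons j = LinearMap.mulLeft ℂ (x j) ∘ₗ eval x :=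
    hom_ext fun w => by simp [eval_single]
  exact LinearMap.congr_fun this a

theorem eval_snoc (x : ι → R) (j : ι) (a : WordSpace ι) :
    eval x (snoc j a) = eval x a * x j := by
  have : eval x ∘ₗ snoc j = LinearMap.mulRight ℂ (x j) ∘ₗ eval x :=
    hom_ext fun w => by simp [eval_single]
  exact LinearMap.congr_fun this a

theorem evalRev_cons (x : ι → R) (j : ι) (a : WordSpace ι) :
    evalRev x (cons j a) = evalRev x a * x j := by
  have : evalRev x ∘ₗ cons j = LinearMap.mulRight ℂ (x j) ∘ₗ evalRev x :=
    hom_ext fun w => by simp [evalRev_single]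
  exact LinearMap.congr_fun this a

theorem evalRev_snoc (x : ι → R) (j : ι) (a : WordSpace ι) :
    evalRev x (snoc j a) = x j * evalRev x a := by
  have : evalRev x ∘ₗ snoc j = LinearMap.mulLeft ℂ (x j) ∘ₗ evalRev x :=
    hom_ext fun w => by simp [evalRev_single]
  exact LinearMap.congr_fun this a

theorem mul_eval_twist {y : R} {x : ι → R} {χ : ι → ℂ} (h : ∀ i, y * x i = χ i • (x i * y))
    (a : WordSpace ι) : y * eval x a = eval x (twist χ a) * y := by
  have : LinearMap.mulLeft ℂ y ∘ₗ eval x = LinearMap.mulRight ℂ y ∘ₗ eval x ∘ₗ twist χ :=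
    hom_ext fun w => by
    induction w with
    | nil => simp [eval_single]
    | cons i w ih =>
      simp only [LinearMap.comp_apply, LinearMap.mulLeft_apply, LinearMap.mulRight_apply] at ih ⊢
      rw [← cons_single, twist_cons, map_smul, eval_cons, eval_cons, ← mul_assoc, h,
        smul_mul_assoc, mul_assoc, ih, smul_mul_assoc, mul_assoc]
  exact LinearMap.congr_fun this a

theorem mul_evalRev_twist {y : R} {x : ι → R} {χ : ι → ℂ} (h : ∀ i, y * x i = χ i • (x i * y))
    (a : WordSpace ι) : y * evalRev x a = evalRev x (twist χ a) * y := by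
  have : LinearMap.mulLeft ℂ y ∘ₗ evalRev x = LinearMap.mulRight ℂ y ∘ₗ evalRev x ∘ₗ twist χ :=
    hom_ext fun w => by
    induction w with
    | nil => simp [evalRev_single]
    | cons i w ih =>
      simp only [LinearMap.comp_apply, LinearMap.mulLeft_apply, LinearMap.mulRight_apply] at ih ⊢
      rw [← cons_single, twist_cons, map_smul, evalRev_cons, evalRev_cons, ← mul_assoc, ih,
        smul_mul_assoc, mul_assoc, h, mul_smul_comm, mul_assoc]
  exact LinearMap.congr_fun this a

end WordSpace

open WordSpace

/-! ### Commutation of words in the `e_α` and `f_α` with the generators. -/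

/-- The scalar `1 / (q - q⁻¹)` in the commutation relation of `e` and `f`. -/
noncomputable def qInvDiff (q : ℂˣ) : ℂ := ((q : ℂ) - (q : ℂ)⁻¹)⁻¹

theorem qInvDiff_ne_zero {q : ℂˣ} (hq : ¬ IsOfFinOrder q) : qInvDiff q ≠ 0 := by
  refine inv_ne_zero fun h => hq ?_
  rw [isOfFinOrder_iff_pow_eq_one]
  refine ⟨2, by norm_num, Units.ext ?_⟩
  have h0 : (q : ℂ) ≠ 0 := q.ne_zero
  field_simp at h
  push_cast
  linear_combination h

namespace IsUqFamily
variable {ι R : Type*} [Ring R] [Algebra ℂ R] {C : CartanDatum ι} {q : ℂˣ}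
  {e f k kInv : ι → R}

theorem map {S : Type*} [Ring S] [Algebra ℂ S] (h : IsUqFamily C q e f k kInv) (φ : R →ₐ[ℂ] S) :
    IsUqFamily C q (fun i => φ (e i)) (fun i => φ (f i)) (fun i => φ (k i))
      (fun i => φ (kInv i)) where
  k_kInv i := by simp only [← map_mul, h.k_kInv, map_one]
  kInv_k i := by simp only [← map_mul, h.kInv_k, map_one]
  k_k i j := by simp only [← map_mul, h.k_k i j]
  k_e i j := by simp only [← map_mul, ← map_smul, h.k_e i j]
  k_f i j := by simp only [← map_mul, ← map_smul, h.k_f i j]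
  e_f_same i := by simp only [← map_mul, ← map_smul, ← map_sub, h.e_f_same i]
  e_f_ne i j hij := by simp only [← map_mul, ← map_sub, h.e_f_ne i j hij, map_zero]
  serre_e i j hij := by simp only [← map_qSerre, h.serre_e i j hij, map_zero]
  serre_f i j hij := by simp only [← map_qSerre, h.serre_f i j hij, map_zero]

/-- The rescaled generators `(q⁻¹ - q) q^{-h_α} e_α`. -/
noncomputable def twistedE (q : ℂˣ) (e kInv : ι → R) (i : ι) : R :=
  (-(qInvDiff q)⁻¹) • (kInv i * e i)

theorem k_evalRev (h : IsUqFamily C q e f k kInv) (j : ι) (a : WordSpace ι) :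
    k j * evalRev f a = evalRev f (twist (qFormInv C q j) a) * k j :=
  mul_evalRev_twist (fun i => h.k_f j i) a

theorem kInv_evalRev (h : IsUqFamily C q e f k kInv) (j : ι) (a : WordSpace ι) :
    kInv j * evalRev f a = evalRev f (twist (qForm C q j) a) * kInv j :=
  mul_evalRev_twist (fun i => h.kInv_f j i) a

theorem k_kInv_comm (h : IsUqFamily C q e f k kInv) (i j : ι) : k i * kInv j = kInv j * k i := by
  have h4 : k j * k i = ((1 : ℂˣ) : ℂ) • (k i * k j) := by simp [h.k_k i j]
  simpa using (inv_commute_smul (h.k_kInv j) (h.kInv_k j) h4).symm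

theorem k_twistedE (h : IsUqFamily C q e f k kInv) (j i : ι) :
    k j * twistedE q e kInv i = qForm C q j i • (twistedE q e kInv i * k j) := by
  rw [twistedE, mul_smul_comm, ← mul_assoc, h.k_kInv_comm, mul_assoc, h.k_e, mul_smul_comm,
    smul_comm, smul_mul_assoc, mul_assoc, qForm]

theorem kInv_twistedE (h : IsUqFamily C q e f k kInv) (j i : ι) :
    kInv j * twistedE q e kInv i = qFormInv C q j i • (twistedE q e kInv i * kInv j) := by
  rw [twistedE, mul_smul_comm, ← mul_assoc, h.kInv_kInv, mul_assoc, h.kInv_e, mul_smul_comm,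
    smul_comm, smul_mul_assoc, mul_assoc, qFormInv]

theorem k_eval (h : IsUqFamily C q e f k kInv) (j : ι) (a : WordSpace ι) :
    k j * eval (twistedE q e kInv) a = eval (twistedE q e kInv) (twist (qForm C q j) a) * k j :=
  mul_eval_twist (fun i => h.k_twistedE j i) a

theorem kInv_eval (h : IsUqFamily C q e f k kInv) (j : ι) (a : WordSpace ι) :
    kInv j * eval (twistedE q e kInv) a =
      eval (twistedE q e kInv) (twist (qFormInv C q j) a) * kInv j :=
  mul_eval_twist (fun i => h.kInv_twistedE j i) a

variable [DecidableEq ι]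

theorem e_f (h : IsUqFamily C q e f k kInv) (i j : ι) :
    e j * f i = f i * e j + if i = j then qInvDiff q • (k j - kInv j) else 0 := by
  split_ifs with hij
  · subst hij; rw [qInvDiff, ← h.e_f_same i]; abel
  · rw [add_zero]; exact sub_eq_zero.1 (h.e_f_ne j i (Ne.symm hij))

/-- Each occurrence of `f_j` contributes `q^{h_j} - q^{-h_j}`, which is then moved to the right end
past the remaining letters; the scalars so collected are the twists of the two derivations. As the
words are reversed, these letters are the ones to the left in `a`, which is the twist of
`leftDeriv`; for `rightDeriv` the outer `twist` exchanges the sides. -/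
theorem e_evalRev (h : IsUqFamily C q e f k kInv) (j : ι) (a : WordSpace ι) :
    e j * evalRev f a = evalRev f a * e j + qInvDiff q • (evalRev f (leftDeriv C q j a) * k j) -
      qInvDiff q • (evalRev f (twist (qForm C q j) (rightDeriv C q j a)) * kInv j) := by
  have : LinearMap.mulLeft ℂ (e j) ∘ₗ evalRev f = LinearMap.mulRight ℂ (e j) ∘ₗ evalRev f +
      qInvDiff q • LinearMap.mulRight ℂ (k j) ∘ₗ evalRev f ∘ₗ leftDeriv C q j -
      qInvDiff q • LinearMap.mulRight ℂ (kInv j) ∘ₗ evalRev f ∘ₗ twist (qForm C q j) ∘ₗ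
        rightDeriv C q j := hom_ext fun w => by
    induction w with
    | nil => simp [evalRev_single]
    | cons i w ih =>
      simp only [LinearMap.comp_apply, LinearMap.mulLeft_apply, LinearMap.mulRight_apply,
        LinearMap.sub_apply, LinearMap.add_apply, LinearMap.smul_apply] at ih ⊢
      have hk : ∀ b, evalRev f b * k j * f i = qFormInv C q j i • (evalRev f b * f i * k j) := by
        intro b; rw [mul_assoc, h.k_f, mul_smul_comm, mul_assoc, qFormInv]
      have hkI : ∀ b, evalRev f b * kInv j * f i = qForm C q j i • (evalRev f b * f i * kInv j) := by
        intro b; rw [mul_assoc, h.kInv_f, mul_smul_comm, mul_assoc, qForm]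
      rw [← cons_single, evalRev_cons, ← mul_assoc, ih, sub_mul, add_mul, smul_mul_assoc,
        smul_mul_assoc, hk, hkI, mul_assoc _ (e j), h.e_f i j, leftDeriv_cons, rightDeriv_cons]
      by_cases hij : i = j
      · subst hij
        simp only [if_true, map_add, map_smul, twist_cons, evalRev_cons,
          twist_twist_inv _ _ (qForm_mul_inv C q i), smul_add, mul_add, mul_smul_comm, mul_sub,
          smul_sub, add_mul, smul_mul_assoc, mul_assoc]
        abel
      · simp only [if_neg hij, map_smul, twist_cons, evalRev_cons, smul_mul_assoc, mul_assoc,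
          zero_add, add_zero]
  exact LinearMap.congr_fun this a

theorem twistedE_f (h : IsUqFamily C q e f k kInv) (hq : qInvDiff q ≠ 0) (i j : ι) :
    twistedE q e kInv i * f j = qForm C q j i • (f j * twistedE q e kInv i) -
      if i = j then 1 - kInv j * kInv j else 0 := by
  rw [twistedE, smul_mul_assoc, mul_assoc, h.e_f j i, mul_add, ← mul_assoc, h.kInv_f,
    smul_mul_assoc, mul_assoc, mul_smul_comm, smul_add, smul_comm, qForm_comm, ← qForm]
  rw [sub_eq_add_neg _ (ite _ _ _)]
  congr 1
  by_cases hij : i = j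
  · subst hij
    simp only [if_true, mul_smul_comm, smul_smul, mul_sub, h.kInv_k]
    rw [neg_mul, inv_mul_cancel₀ hq, neg_one_smul]
  · simp [hij, Ne.symm hij]

/-- The counterpart of `e_evalRev` with the roles of `e` and `f` exchanged. That the same two
derivations occur is what makes the canonical element of the form commute with the generators up to
torus factors. -/
theorem eval_f (h : IsUqFamily C q e f k kInv) (hq : qInvDiff q ≠ 0) (j : ι) (a : WordSpace ι) :
    eval (twistedE q e kInv) a * f j =
      f j * eval (twistedE q e kInv) (twist (qForm C q j) a) -
      eval (twistedE q e kInv) (twist (qForm C q j) (leftDeriv C q j a)) +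
      eval (twistedE q e kInv) (rightDeriv C q j a) * (kInv j * kInv j) := by
  set E := twistedE q e kInv with hE
  have : LinearMap.mulRight ℂ (f j) ∘ₗ eval E =
      LinearMap.mulLeft ℂ (f j) ∘ₗ eval E ∘ₗ twist (qForm C q j) -
      eval E ∘ₗ twist (qForm C q j) ∘ₗ leftDeriv C q j +
      LinearMap.mulRight ℂ (kInv j * kInv j) ∘ₗ eval E ∘ₗ rightDeriv C q j := hom_ext fun w => by
    induction w with
    | nil => simp [eval_single]
    | cons i w ih =>
      simp only [LinearMap.comp_apply, LinearMap.mulLeft_apply, LinearMap.mulRight_apply,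
        LinearMap.sub_apply, LinearMap.add_apply] at ih ⊢
      have hk : kInv j * kInv j * eval E (twist (qForm C q j) (Finsupp.single w 1)) =
          eval E (twist (qFormInv C q j) (Finsupp.single w 1)) * (kInv j * kInv j) := by
        rw [mul_assoc, h.kInv_eval, twist_twist_inv _ _ (qFormInv_mul C q j), ← mul_assoc,
          h.kInv_eval, mul_assoc]
      rw [← cons_single, eval_cons, mul_assoc, ih, mul_add, mul_sub, ← mul_assoc, hE,
        h.twistedE_f hq, ← hE, leftDeriv_cons, rightDeriv_cons]
      by_cases hij : i = j
      · subst hij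
        simp only [if_true, map_add, map_smul, twist_cons, eval_cons, mul_smul_comm, add_mul,
          sub_mul, smul_mul_assoc, mul_assoc, one_mul, smul_smul, qFormInv_mul, one_smul]
        rw [← mul_assoc (kInv i), hk]
        abel
      · simp only [if_neg hij, map_smul, twist_cons, eval_cons, mul_smul_comm, smul_mul_assoc,
          mul_assoc, smul_smul, qFormInv_mul, one_smul, sub_zero, zero_add]
  exact LinearMap.congr_fun this a

end IsUqFamily

/-! ### Tensors determined by their pairings modulo the radical. -/

namespace WordSpace
variable {ι R : Type*} [Ring R] [Algebra ℂ R]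

/-- The multiplication `a ⊗ g ↦ φ a * g`. -/
noncomputable def contract (φ : WordSpace ι →ₗ[ℂ] R) : WordSpace ι ⊗[ℂ] R →ₗ[ℂ] R :=
  TensorProduct.lift ((LinearMap.mul ℂ R).comp φ)

@[simp] theorem contract_tmul (φ : WordSpace ι →ₗ[ℂ] R) (a : WordSpace ι) (g : R) :
    contract φ (a ⊗ₜ g) = φ a * g := by simp [contract]

theorem contract_mul (φ : WordSpace ι →ₗ[ℂ] R) (Y : WordSpace ι ⊗[ℂ] R) (z : R) :
    contract φ Y * z =
      contract φ (TensorProduct.map LinearMap.id (LinearMap.mulRight ℂ z) Y) := by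
  induction Y with
  | zero => simp
  | tmul a g => simp [mul_assoc]
  | add a b ha hb => simp only [map_add, add_mul, ha, hb]

variable (C : CartanDatum ι) (q : ℂˣ) [DecidableEq ι]

/-- The pairing `a ⊗ g ↦ (x, a) g` with a vector `x` of the word space. -/
noncomputable def pairing (x : WordSpace ι) : WordSpace ι ⊗[ℂ] R →ₗ[ℂ] R :=
  TensorProduct.lift ((LinearMap.lsmul ℂ R).comp (form C q x))

@[simp] theorem pairing_tmul (x a : WordSpace ι) (g : R) :
    pairing C q x (a ⊗ₜ g) = form C q x a • g := by simp [pairing]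

variable {C q}

/-- Expand `Y` in a basis of `R`: the vanishing of all pairings puts each coefficient in the
radical, which `φ` kills. An identity between contracted tensors can thus be checked after pairing
with a word. -/
theorem contract_eq_zero [Module.Finite ℂ R] {φ : WordSpace ι →ₗ[ℂ] R}
    (hφ : ∀ x ∈ radical C q, φ x = 0) {Y : WordSpace ι ⊗[ℂ] R}
    (hY : ∀ x, pairing C q x Y = 0) : contract φ Y = 0 := by
  let b := Module.finBasis ℂ R
  obtain ⟨g, rfl⟩ := (TensorProduct.equivFinsuppOfBasisRight (M := WordSpace ι) b).symm.surjective Y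
  have hg : (TensorProduct.equivFinsuppOfBasisRight (M := WordSpace ι) b).symm g =
      ∑ i, g i ⊗ₜ b i := by
    rw [TensorProduct.equivFinsuppOfBasisRight_symm_apply]
    exact Finsupp.sum_fintype _ _ (by simp)
  rw [hg] at hY ⊢
  have hr : ∀ i, g i ∈ radical C q := fun i => mem_radical.2 fun x => by
    have h1 := hY x
    simp only [map_sum, pairing_tmul] at h1
    rw [form_symm]
    exact Fintype.linearIndependent_iff.1 b.linearIndependent _ h1 i
  simp [hφ _ (hr _)]

theorem contract_congr [Module.Finite ℂ R] {φ : WordSpace ι →ₗ[ℂ] R}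
    (hφ : ∀ x ∈ radical C q, φ x = 0) {Y Y' : WordSpace ι ⊗[ℂ] R}
    (hY : ∀ x, pairing C q x Y = pairing C q x Y') : contract φ Y = contract φ Y' := by
  rw [← sub_eq_zero, ← map_sub]
  exact contract_eq_zero hφ fun x => by rw [map_sub, hY, sub_self]

/-- A linear map on the word space that vanishes on the radical of the form and on all long words
is represented by a tensor. -/
theorem exists_pairing_eq [Finite ι] {ψ : WordSpace ι →ₗ[ℂ] R}
    (hψ : ∀ x ∈ radical C q, ψ x = 0) {N : ℕ}
    (hN : ∀ w : List ι, N ≤ w.length → ψ (Finsupp.single w 1) = 0) :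
    ∃ Y : WordSpace ι ⊗[ℂ] R, ∀ x, pairing C q x Y = ψ x := by
  have hfin : {w : List ι | w.length < N}.Finite := List.finite_length_lt ι N
  let W := hfin.toFinset
  have htr : ∀ x, ψ (truncate N x) = ψ x := by
    have : ψ ∘ₗ truncate N = ψ := hom_ext fun w => by
      simp only [LinearMap.comp_apply, truncate_single]
      split_ifs with h
      · rfl
      · rw [map_zero, hN w (not_lt.1 h)]
    exact fun x => LinearMap.congr_fun this x
  -- Modulo the radical, the truncation of `x` is determined by its pairings with the finitely many
  -- words shorter than `N`, so `ψ` factors through `S`.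
  let S : WordSpace ι →ₗ[ℂ] (W → ℂ) :=
    LinearMap.pi fun w => (form C q).flip (Finsupp.single (w : List ι) 1)
  have hker : LinearMap.ker S ≤ LinearMap.ker ψ := by
    intro x hx
    rw [LinearMap.mem_ker] at hx ⊢
    rw [← htr]
    refine hψ _ (mem_radical.2 fun y => ?_)
    rw [form_truncate]
    have : (form C q x) ∘ₗ truncate N = 0 := hom_ext fun w => by
      simp only [LinearMap.comp_apply, truncate_single]
      split_ifs with h
      · exact congrFun hx ⟨w, hfin.mem_toFinset.2 h⟩
      · simp
    exact LinearMap.congr_fun this y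
  obtain ⟨g, hg⟩ : ∃ g : (W → ℂ) →ₗ[ℂ] R, g ∘ₗ S = ψ := by
    obtain ⟨s, hs⟩ := LinearMap.exists_extend
      (((LinearMap.ker S).liftQ ψ hker) ∘ₗ S.quotKerEquivRange.symm.toLinearMap)
    refine ⟨s, LinearMap.ext fun x => ?_⟩
    have := LinearMap.congr_fun hs (S.rangeRestrict x)
    simp only [LinearMap.comp_apply, Submodule.subtype_apply, LinearEquiv.coe_coe] at this
    have h2 : S.quotKerEquivRange.symm (S.rangeRestrict x) = (LinearMap.ker S).mkQ x := by
      rw [LinearEquiv.symm_apply_eq]; rfl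
    rw [h2] at this
    simpa using this
  -- The pairing of `x` with this tensor is `g` applied to the coordinate expansion of `S x`.
  refine ⟨∑ w : W, Finsupp.single (w : List ι) 1 ⊗ₜ g (Pi.single w 1), fun x => ?_⟩
  rw [map_sum, ← hg]
  simp only [pairing_tmul, LinearMap.comp_apply]
  conv_rhs => rw [← Finset.univ_sum_single (S x), map_sum]
  refine Finset.sum_congr rfl fun w _ => ?_
  rw [← map_smul, ← Pi.single_smul', smul_eq_mul, mul_one]
  rfl

end WordSpace

/-! ### The quasi-Casimir operator. -/

namespace IsUqFamily
variable {ι R : Type*} [Ring R] [Algebra ℂ R] {C : CartanDatum ι} {q : ℂˣ}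
  {e f k kInv : ι → R} [DecidableEq ι]

/-- The quasi-Casimir operator, which represents the canonical element of the form on the word
space. -/
theorem exists_quasiCasimir [Finite ι] [Module.Finite ℂ R] (h : IsUqFamily C q e f k kInv)
    (hq : qInvDiff q ≠ 0)
    (he : ∀ x ∈ radical C q, eval (twistedE q e kInv) x = 0)
    (hf : ∀ x ∈ radical C q, evalRev f x = 0)
    {N : ℕ} (hN : ∀ w : List ι, N ≤ w.length → (w.map (twistedE q e kInv)).prod = 0) :
    ∃ T : R, (∀ j, e j * T = T * (kInv j * kInv j) * e j) ∧
      (∀ j, T * f j = f j * T * (kInv j * kInv j)) ∧ (∀ j, T * k j = k j * T) ∧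
      ∀ y : R, (∀ j, e j * y = 0) → T * y = y := by
  -- `Y` plays the role of `∑ b ⊗ E(b*)` over dual bases of the free algebra modulo the radical. It
  -- is a finite tensor because long words in the `e_α` act by zero.
  obtain ⟨Y, hY⟩ := exists_pairing_eq he (N := N) fun w hw => by rw [eval_single, hN w hw]
  set E := twistedE q e kInv with hE
  have key : ∀ (φ : WordSpace ι →ₗ[ℂ] WordSpace ι) (ψ : R →ₗ[ℂ] R) (φ' : WordSpace ι →ₗ[ℂ] WordSpace ι),
      (∀ x y, form C q x (φ y) = form C q (φ' x) y) →
      ∀ x (Y : WordSpace ι ⊗[ℂ] R), pairing C q x (TensorProduct.map φ ψ Y) =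
        ψ (pairing C q (φ' x) Y) := by
    intro φ ψ φ' hφ x Y
    induction Y with
    | zero => simp
    | tmul a g => simp [hφ]
    | add a b ha hb => simp only [map_add, ha, hb]
  -- An operator on the first factor of `Y` becomes its adjoint inside `eval E`, so each claim about
  -- `T` turns into an identity between words in `E`.
  have keyY : ∀ (φ : WordSpace ι →ₗ[ℂ] WordSpace ι) (ψ : R →ₗ[ℂ] R) (φ' : WordSpace ι →ₗ[ℂ] WordSpace ι),
      (∀ x y, form C q x (φ y) = form C q (φ' x) y) →
      ∀ x, pairing C q x (TensorProduct.map φ ψ Y) = ψ (eval E (φ' x)) := by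
    intro φ ψ φ' hφ x
    rw [key φ ψ φ' hφ, hY]
  have hid : ∀ x y : WordSpace ι, form C q x (LinearMap.id (R := ℂ) y) =
      form C q (LinearMap.id (R := ℂ) x) y := fun _ _ => rfl
  have htw : ∀ χ : ι → ℂ, ∀ x y, form C q x (twist χ y) = form C q (twist χ x) y :=
    fun χ x y => (form_twist C q χ x y).symm
  have hkE : ∀ j, k j * E j = -(qInvDiff q)⁻¹ • e j := fun j => by
    rw [hE, twistedE, mul_smul_comm, ← mul_assoc, h.k_kInv, one_mul]
  refine ⟨contract (evalRev f) Y, fun j => ?_, fun j => ?_, fun j => ?_, fun y hy => ?_⟩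
  · have h1 : ∀ Y, e j * contract (evalRev f) Y =
        contract (evalRev f) (TensorProduct.map LinearMap.id (LinearMap.mulLeft ℂ (e j)) Y) +
        qInvDiff q • contract (evalRev f)
          (TensorProduct.map (leftDeriv C q j) (LinearMap.mulLeft ℂ (k j)) Y) -
        qInvDiff q • contract (evalRev f) (TensorProduct.map
          (twist (qForm C q j) ∘ₗ rightDeriv C q j) (LinearMap.mulLeft ℂ (kInv j)) Y) := by
      intro Y
      induction Y with
      | zero => simp
      | tmul a g =>
        simp only [TensorProduct.map_tmul, contract_tmul, LinearMap.mulLeft_apply,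
          LinearMap.comp_apply, LinearMap.id_apply]
        rw [← mul_assoc, h.e_evalRev]
        simp only [add_mul, sub_mul, smul_mul_assoc, mul_assoc]
      | add a b ha hb => simp only [map_add, mul_add, ha, hb, smul_add]; abel
    rw [h1, mul_assoc, contract_mul, ← map_smul (contract _), ← map_smul (contract _), ← map_add,
      ← map_sub]
    refine contract_congr hf fun x => ?_
    rw [map_sub, map_add, map_smul, map_smul, keyY _ _ _ hid,
      keyY _ _ (cons j) fun x y => (form_cons C q j x y).symm,
      keyY _ _ (snoc j ∘ₗ twist (qForm C q j)) fun x y => by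
        rw [LinearMap.comp_apply, LinearMap.comp_apply, form_snoc, form_twist],
      keyY _ _ _ hid]
    -- The derivation terms have become multiplications by `E j` on the left and on the right. The
    -- left one cancels `e j * eval E x`, and the right one is the right-hand side of the claim.
    simp only [LinearMap.mulLeft_apply, LinearMap.mulRight_apply, LinearMap.id_apply, eval_cons,
      eval_snoc, LinearMap.comp_apply]
    rw [← mul_assoc (k j), hkE, ← mul_assoc (kInv j), h.kInv_eval,
      twist_twist_inv _ _ (qFormInv_mul C q j)]
    have : kInv j * E j = -(qInvDiff q)⁻¹ • (kInv j * kInv j * e j) := by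
      rw [hE, twistedE, mul_smul_comm, mul_assoc]
    rw [mul_assoc _ (kInv j), this]
    simp only [neg_smul, smul_mul_assoc, mul_smul_comm, smul_smul, mul_neg, smul_neg, neg_mul,
      mul_inv_cancel₀ hq, one_smul, mul_assoc]
    abel
  · rw [contract_mul]
    have h3 : ∀ Y, f j * contract (evalRev f) Y * (kInv j * kInv j) =
        contract (evalRev f)
          (TensorProduct.map (snoc j) (LinearMap.mulRight ℂ (kInv j * kInv j)) Y) := by
      intro Y
      induction Y with
      | zero => simp
      | tmul a g => simp [mul_assoc, evalRev_snoc]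
      | add a b ha hb => simp only [map_add, mul_add, add_mul, ha, hb]
    -- A letter `f j` at the junction of the two factors can be absorbed in either. The difference
    -- of the two forms is added to the goal, and the paired identity is then exactly `eval_f`.
    have h4 : ∀ Y, contract (evalRev f)
          (TensorProduct.map (twist (qForm C q j)) (LinearMap.mulLeft ℂ (f j)) Y) =
        contract (evalRev f)
          (TensorProduct.map (cons j ∘ₗ twist (qForm C q j)) LinearMap.id Y) := by
      intro Y
      induction Y with
      | zero => simp
      | tmul a g => simp [mul_assoc, evalRev_cons]
      | add a b ha hb => simp only [map_add, ha, hb]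
    rw [h3, ← zero_add (contract _ (TensorProduct.map (snoc j) _ _)), ← sub_eq_zero.2 (h4 Y),
      ← map_sub, ← map_add]
    refine contract_congr hf fun x => ?_
    rw [map_add, map_sub, keyY _ _ _ hid, keyY _ _ _ (htw _),
      keyY _ _ (twist (qForm C q j) ∘ₗ leftDeriv C q j) fun x y => by
        rw [LinearMap.comp_apply, LinearMap.comp_apply, form_cons_right, form_twist],
      keyY _ _ (rightDeriv C q j) fun x y => by
        rw [form_symm, form_snoc, form_symm]]
    simp only [LinearMap.mulLeft_apply, LinearMap.mulRight_apply, LinearMap.id_apply,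
      LinearMap.comp_apply]
    rw [hE, h.eval_f hq]
  · have h3 : ∀ Y, k j * contract (evalRev f) Y = contract (evalRev f)
        (TensorProduct.map (twist (qFormInv C q j)) (LinearMap.mulLeft ℂ (k j)) Y) := by
      intro Y
      induction Y with
      | zero => simp
      | tmul a g =>
        rw [TensorProduct.map_tmul, contract_tmul, contract_tmul, ← mul_assoc, h.k_evalRev]
        simp [mul_assoc]
      | add a b ha hb => simp only [map_add, mul_add, ha, hb]
    rw [contract_mul, h3]
    refine contract_congr hf fun x => ?_
    rw [keyY _ _ _ hid, keyY _ _ _ (htw _), LinearMap.mulLeft_apply, LinearMap.mulRight_apply,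
      hE, h.k_eval, twist_twist_inv _ _ (qForm_mul_inv C q j)]
    rfl
  -- On `y` only the empty word survives, so `Y` multiplied by `y` pairs in the same way as `1 ⊗ y`.
  · have h3 : ∀ x, eval E x * y = x [] • y := by
      have : LinearMap.mulRight ℂ y ∘ₗ eval E =
          (LinearMap.toSpanSingleton ℂ R y) ∘ₗ Finsupp.lapply [] := hom_ext fun w => by
        induction w with
        | nil => simp [eval_single]
        | cons i w ih =>
          simp only [LinearMap.comp_apply, LinearMap.mulRight_apply] at ih ⊢
          have h5 : E i * y = 0 := by
            rw [hE, twistedE, smul_mul_assoc, mul_assoc, hy, mul_zero, smul_zero]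
          rw [← cons_single, eval_cons, mul_assoc, ih]
          simp [h5]
      exact fun x => LinearMap.congr_fun this x
    have h4 : contract (evalRev f) (Finsupp.single [] 1 ⊗ₜ y) = y := by simp [evalRev_single]
    conv_rhs => rw [← h4]
    rw [contract_mul]
    refine contract_congr hf fun x => ?_
    rw [keyY _ _ _ hid, pairing_tmul, form_symm, form_nil]
    exact h3 x
end IsUqFamily

/-! ### Gradings by height. -/

/-- The existence of a coweight that takes a constant non-zero value at the simple roots. -/
def CartanDatum.HasGrading {ι : Type*} [Fintype ι] (C : CartanDatum ι) : Prop :=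
  ∃ (n : ι → ℤ) (D : ℤ), D ≠ 0 ∧ ∀ j, ∑ i, n i * C.form i j = D

/-- Cramer's rule: the row `(1, …, 1)` times the adjugate is an integral solution whose constant
value is the determinant of the symmetrized matrix. -/
theorem CartanDatum.hasGrading_of_det_ne_zero {ι : Type*} [Fintype ι] [DecidableEq ι]
    (C : CartanDatum ι) (hC : C.a.det ≠ 0) : C.HasGrading := by
  have hdet : (Matrix.of C.form).det ≠ 0 := by
    have : Matrix.of C.form = Matrix.diagonal (fun i => (C.d i : ℤ)) * C.a := by
      ext i j; simp [CartanDatum.form, Matrix.diagonal_mul]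
    rw [this, Matrix.det_mul, Matrix.det_diagonal]
    refine mul_ne_zero (Finset.prod_ne_zero_iff.2 fun i _ => ?_) hC
    exact_mod_cast (C.d_pos i).ne'
  refine ⟨Matrix.vecMul (fun _ => 1) (Matrix.of C.form).adjugate, (Matrix.of C.form).det, hdet,
    fun j => ?_⟩
  have h1 : Matrix.vecMul (Matrix.vecMul (fun _ => 1) (Matrix.of C.form).adjugate)
      (Matrix.of C.form) = (Matrix.of C.form).det • fun _ => 1 := by
    rw [Matrix.vecMul_vecMul, Matrix.adjugate_mul, Matrix.vecMul_smul, Matrix.vecMul_one]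
  simpa [Matrix.vecMul, dotProduct] using congrFun h1 j

theorem zpow_mul_eq_smul {R : Type*} [Ring R] [Algebra ℂ R] {u : Rˣ} {x : R} {a : ℂˣ}
    (h : (u : R) * x = (a : ℂ) • (x * u)) (n : ℤ) :
    ((u ^ n : Rˣ) : R) * x = ((a ^ n : ℂˣ) : ℂ) • (x * ((u ^ n : Rˣ) : R)) := by
  have h' : ((u⁻¹ : Rˣ) : R) * x = ((a⁻¹ : ℂˣ) : ℂ) • (x * ((u⁻¹ : Rˣ) : R)) :=
    inv_commute_smul u.mul_inv u.inv_mul h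
  induction n with
  | zero => simp
  | succ n ih =>
    rw [zpow_add_one, zpow_add_one, Units.val_mul, Units.val_mul, mul_assoc, h, mul_smul_comm,
      ← mul_assoc, ih, smul_mul_assoc, smul_smul, mul_assoc, mul_comm (a : ℂ)]
  | pred n ih =>
    rw [zpow_sub_one, zpow_sub_one, Units.val_mul, Units.val_mul, mul_assoc, h', mul_smul_comm,
      ← mul_assoc, ih, smul_mul_assoc, smul_smul, mul_assoc, mul_comm ((a⁻¹ : ℂˣ) : ℂ)]

theorem zpow_apply_of_apply_eq_smul {M : Type*} [AddCommGroup M] [Module ℂ M]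
    {u : (Module.End ℂ M)ˣ} {v : M} {a : ℂˣ} (h : (u : Module.End ℂ M) v = (a : ℂ) • v) (n : ℤ) :
    ((u ^ n : (Module.End ℂ M)ˣ) : Module.End ℂ M) v = ((a ^ n : ℂˣ) : ℂ) • v := by
  have h' : ((u⁻¹ : (Module.End ℂ M)ˣ) : Module.End ℂ M) v = ((a⁻¹ : ℂˣ) : ℂ) • v := by
    have : ((u⁻¹ : (Module.End ℂ M)ˣ) : Module.End ℂ M) ((u : Module.End ℂ M) v) = v := by
      rw [← Module.End.mul_apply, u.inv_mul, Module.End.one_apply]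
    rw [h, map_smul] at this
    rw [← this, smul_smul]
    simp [this]
  induction n with
  | zero => simp
  | succ n ih =>
    rw [zpow_add_one, zpow_add_one, Units.val_mul, Units.val_mul, Module.End.mul_apply, h, map_smul,
      ih, smul_smul, mul_comm]
  | pred n ih =>
    rw [zpow_sub_one, zpow_sub_one, Units.val_mul, Units.val_mul, Module.End.mul_apply, h', map_smul,
      ih, smul_smul, mul_comm]

/-! ### Weight spaces and nilpotency. -/

section Weight
variable {ι M : Type*} [AddCommGroup M] [Module ℂ M]

/-- The simultaneous eigenspaces of a family of endomorphisms. -/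
def weightSpace (k : ι → Module.End ℂ M) (μ : ι → ℂ) : Submodule ℂ M :=
  ⨅ i, (k i).eigenspace (μ i)

theorem mem_weightSpace {k : ι → Module.End ℂ M} {μ : ι → ℂ} {m : M} :
    m ∈ weightSpace k μ ↔ ∀ i, k i m = μ i • m := by
  simp [weightSpace, Submodule.mem_iInf]

theorem iSupIndep_weightSpace {k : ι → Module.End ℂ M} (hk : ∀ i j, Commute (k i) (k j)) :
    iSupIndep (weightSpace k) := by
  refine (Module.End.independent_iInf_maxGenEigenspace_of_forall_mapsTo k fun i j φ =>
    Module.End.mapsTo_maxGenEigenspace_of_comm (hk j i) φ).mono fun μ => ?_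
  exact iInf_mono fun i => ((k i).genEigenspace (μ i)).mono le_top

/-- The projections to the weight spaces of a module that is spanned by weight vectors. -/
theorem exists_weightProj {k : ι → Module.End ℂ M} (hk : ∀ i j, Commute (k i) (k j))
    (hM : ⨆ μ, weightSpace k μ = ⊤) :
    ∃ P : (ι → ℂ) → Module.End ℂ M, (∀ μ m, P μ m ∈ weightSpace k μ) ∧
      (∀ μ, ∀ m ∈ weightSpace k μ, P μ m = m) ∧
      (∀ μ ν, μ ≠ ν → ∀ m ∈ weightSpace k ν, P μ m = 0) ∧
      ∀ (p : Submodule ℂ M) (m : M), (∀ μ, P μ m ∈ p) → m ∈ p := by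
  classical
  have hI := DirectSum.isInternal_submodule_of_iSupIndep_of_iSup_eq_top
    (iSupIndep_weightSpace hk) hM
  let E := LinearEquiv.ofBijective (DirectSum.coeLinearMap (weightSpace k)) hI
  have hE : ∀ μ (m : weightSpace k μ), E.symm (m : M) = DirectSum.lof ℂ _ _ μ m := by
    intro μ m
    rw [LinearEquiv.symm_apply_eq]
    exact (DirectSum.coeLinearMap_lof (weightSpace k) μ m).symm
  refine ⟨fun μ => (weightSpace k μ).subtype ∘ₗ DirectSum.component ℂ _ _ μ ∘ₗ
    E.symm.toLinearMap, fun μ m => Submodule.coe_mem _, fun μ m hm => ?_,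
    fun μ ν hμν m hm => ?_, fun p m hm => ?_⟩
  · simp only [LinearMap.comp_apply, LinearEquiv.coe_coe, hE μ ⟨m, hm⟩]
    rw [DirectSum.component.lof_self]; rfl
  · simp only [LinearMap.comp_apply, LinearEquiv.coe_coe, hE ν ⟨m, hm⟩]
    rw [DirectSum.component.of, dif_neg hμν.symm, map_zero]
  · have : m = E (E.symm m) := (E.apply_symm_apply m).symm
    rw [this]
    have h2 : E (E.symm m) = ∑ μ ∈ (E.symm m).support, ((E.symm m) μ : M) :=
      DirectSum.coeLinearMap_eq_dfinsuppSum _ _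
    rw [h2]
    exact Submodule.sum_mem _ fun μ _ => hm μ

/-- If the product did not kill `v`, the suffixes of `w` would give `w.length + 1` eigenvectors of
`K` with distinct eigenvalues `a ^ t * b`, too many for the dimension. -/
theorem prod_map_apply_eq_zero [FiniteDimensional ℂ M] {K : Module.End ℂ M} {a : ℂˣ}
    (ha : ¬ IsOfFinOrder a) {x : ι → Module.End ℂ M} (hK : ∀ i, K * x i = (a : ℂ) • (x i * K))
    {v : M} {b : ℂ} (hb : b ≠ 0) (hv : K v = b • v) (w : List ι)
    (hw : Module.finrank ℂ M ≤ w.length) : (w.map x).prod v = 0 := by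
  by_contra hne
  have hdrop : ∀ t, t ≤ w.length → ((w.drop t).map x).prod v ≠ 0 := by
    intro t _ h0
    apply hne
    rw [← List.take_append_drop t w, List.map_append, List.prod_append, Module.End.mul_apply, h0,
      map_zero]
  have heig : ∀ u : List ι, K ((u.map x).prod v) =
      (((a ^ u.length : ℂˣ) : ℂ) * b) • (u.map x).prod v := by
    intro u
    induction u with
    | nil => simp [hv]
    | cons i u ih =>
      rw [List.map_cons, List.prod_cons, Module.End.mul_apply, ← Module.End.mul_apply, hK,
        LinearMap.smul_apply, Module.End.mul_apply, ih, map_smul, smul_smul, List.length_cons,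
        pow_succ']
      push_cast
      rw [mul_assoc]
  have hli : LinearIndependent ℂ fun t : Fin (w.length + 1) => ((w.drop t).map x).prod v := by
    refine Module.End.eigenvectors_linearIndependent' K
      (fun t : Fin (w.length + 1) => (((a ^ (w.drop t).length : ℂˣ) : ℂ) * b)) ?_ _ fun t =>
        ⟨Module.End.mem_eigenspace_iff.2 (heig _), hdrop _ (Nat.lt_succ_iff.1 t.2)⟩
    intro s t hst
    have h1 := Units.ext (mul_right_cancel₀ hb hst)
    have h2 := injective_pow_iff_not_isOfFinOrder.2 ha h1
    simp only [List.length_drop] at h2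
    have := s.2; have := t.2
    ext; omega
  have := hli.fintype_card_le_finrank
  rw [Fintype.card_fin] at this
  omega

end Weight

/-! ### Nilpotency of the generators and dominance of singular weights. -/

namespace IsUqFamily
variable {ι M : Type*} [AddCommGroup M] [Module ℂ M] {C : CartanDatum ι} {q : ℂˣ}
  {e f k kInv : ι → Module.End ℂ M}

theorem commute_k (h : IsUqFamily C q e f k kInv) (i j : ι) : Commute (k i) (k j) := h.k_k i j

theorem weight_ne_zero (h : IsUqFamily C q e f k kInv) {μ : ι → ℂ} {v : M}
    (hv : v ∈ weightSpace k μ) (hv0 : v ≠ 0) (i : ι) : μ i ≠ 0 := by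
  intro h0
  have h1 := mem_weightSpace.1 hv i
  have h2 : kInv i (k i v) = v := by rw [← Module.End.mul_apply, h.kInv_k, Module.End.one_apply]
  rw [h1, h0, zero_smul, map_zero] at h2
  exact hv0 h2.symm

theorem kInv_apply (h : IsUqFamily C q e f k kInv) {μ : ι → ℂ} {v : M}
    (hv : v ∈ weightSpace k μ) (i : ι) : kInv i v = (μ i)⁻¹ • v := by
  by_cases hv0 : v = 0
  · simp [hv0]
  · have h2 : kInv i (k i v) = v := by rw [← Module.End.mul_apply, h.kInv_k, Module.End.one_apply]
    rw [mem_weightSpace.1 hv i, map_smul] at h2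
    conv_rhs => rw [← h2]
    rw [smul_smul, inv_mul_cancel₀ (h.weight_ne_zero hv hv0 i), one_smul]

theorem e_mem_weightSpace (h : IsUqFamily C q e f k kInv) {μ : ι → ℂ} {v : M}
    (hv : v ∈ weightSpace k μ) (j : ι) :
    e j v ∈ weightSpace k fun i => qForm C q i j * μ i := by
  refine mem_weightSpace.2 fun i => ?_
  rw [← Module.End.mul_apply, h.k_e, LinearMap.smul_apply, Module.End.mul_apply,
    mem_weightSpace.1 hv i, map_smul, smul_smul, qForm]

theorem f_mem_weightSpace (h : IsUqFamily C q e f k kInv) {μ : ι → ℂ} {v : M}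
    (hv : v ∈ weightSpace k μ) (j : ι) :
    f j v ∈ weightSpace k fun i => qFormInv C q i j * μ i := by
  refine mem_weightSpace.2 fun i => ?_
  rw [← Module.End.mul_apply, h.k_f, LinearMap.smul_apply, Module.End.mul_apply,
    mem_weightSpace.1 hv i, map_smul, smul_smul, qFormInv]

/-- An operator that grades the module by the height. -/
theorem exists_grading [Fintype ι] (h : IsUqFamily C q e f k kInv) (hC : C.HasGrading)
    (hq : ¬ IsOfFinOrder q) :
    ∃ (K : Module.End ℂ M) (a : ℂˣ), ¬ IsOfFinOrder a ∧
      (∀ j, K * e j = (a : ℂ) • (e j * K)) ∧ (∀ j, K * f j = ((a⁻¹ : ℂˣ) : ℂ) • (f j * K)) ∧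
      (∀ j, K * kInv j = kInv j * K) ∧
      ∀ μ, ∀ v ∈ weightSpace k μ, v ≠ 0 → ∃ b : ℂ, b ≠ 0 ∧ K v = b • v := by
  obtain ⟨n, D, hD, hn⟩ := hC
  let u : ι → (Module.End ℂ M)ˣ := fun i => ⟨k i, kInv i, h.k_kInv i, h.kInv_k i⟩
  -- `K` is the product of the `k i ^ n i`, built along a list; on the list of all simple roots its
  -- exponent at `e j` is the constant `D`.
  have key : ∀ l : List ι, ∃ K : Module.End ℂ M,
      (∀ j, K * e j = ((q ^ (l.map fun i => n i * C.form i j).sum : ℂˣ) : ℂ) • (e j * K)) ∧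
      (∀ j, K * f j = ((q ^ (-(l.map fun i => n i * C.form i j).sum) : ℂˣ) : ℂ) • (f j * K)) ∧
      (∀ j, K * kInv j = kInv j * K) ∧
      ∀ μ, ∀ v ∈ weightSpace k μ, v ≠ 0 → ∃ b : ℂ, b ≠ 0 ∧ K v = b • v := by
    intro l
    induction l with
    | nil => exact ⟨1, by simp, by simp, by simp, fun μ v _ _ => ⟨1, one_ne_zero, by simp⟩⟩
    | cons i l ih =>
      obtain ⟨K, h1, h2, h5, h3⟩ := ih
      refine ⟨K * ((u i ^ n i : (Module.End ℂ M)ˣ) : Module.End ℂ M), fun j => ?_, fun j => ?_,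
        fun j => ?_, fun μ v hv hv0 => ?_⟩
      · rw [mul_assoc, zpow_mul_eq_smul (u := u i) (h.k_e i j), mul_smul_comm, ← mul_assoc, h1,
          smul_mul_assoc, smul_smul, ← Units.val_mul, ← zpow_mul, ← zpow_add, mul_assoc,
          List.map_cons, List.sum_cons, mul_comm (C.form i j)]
      · rw [mul_assoc, zpow_mul_eq_smul (u := u i) (h.k_f i j), mul_smul_comm, ← mul_assoc, h2,
          smul_mul_assoc, smul_smul, ← Units.val_mul, ← zpow_mul, ← zpow_add, mul_assoc,
          List.map_cons, List.sum_cons, neg_mul, mul_comm (C.form i j), neg_add]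
      · have h6 := zpow_mul_eq_smul (u := u i) (x := kInv j) (a := 1)
          (by simpa using h.k_kInv_comm i j) (n i)
        rw [one_zpow, Units.val_one, one_smul] at h6
        rw [mul_assoc, h6, ← mul_assoc, h5, mul_assoc]
      · obtain ⟨b, hb, hbv⟩ := h3 μ v hv hv0
        have h4 := h.weight_ne_zero hv hv0 i
        refine ⟨((Units.mk0 _ h4 ^ n i : ℂˣ) : ℂ) * b, mul_ne_zero (Units.ne_zero _) hb, ?_⟩
        rw [Module.End.mul_apply, zpow_apply_of_apply_eq_smul (u := u i) (a := Units.mk0 _ h4)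
          (mem_weightSpace.1 hv i), map_smul, hbv, smul_smul]
  obtain ⟨K, h1, h2, h5, h3⟩ := key Finset.univ.toList
  have hs : ∀ j, (Finset.univ.toList.map fun i => n i * C.form i j).sum = D := fun j => by
    rw [Finset.sum_map_toList, hn]
  simp only [hs] at h1 h2
  refine ⟨K, q ^ D, fun hfin => hq ?_, h1, fun j => by rw [h2, zpow_neg], h5, h3⟩
  rw [isOfFinOrder_iff_zpow_eq_one] at hfin ⊢
  obtain ⟨m, hm, hm1⟩ := hfin
  exact ⟨D * m, mul_ne_zero hD hm, by rw [zpow_mul, hm1]⟩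

theorem prod_map_e_eq_zero [Fintype ι] [FiniteDimensional ℂ M]
    (h : IsUqFamily C q e f k kInv) (hC : C.HasGrading) (hq : ¬ IsOfFinOrder q)
    (hM : ⨆ μ, weightSpace k μ = ⊤) (w : List ι) (hw : Module.finrank ℂ M ≤ w.length) :
    (w.map e).prod = 0 ∧ (w.map (twistedE q e kInv)).prod = 0 := by
  obtain ⟨K, a, ha, hKe, -, hKk, hKv⟩ := h.exists_grading hC hq
  have hKE : ∀ j, K * twistedE q e kInv j = (a : ℂ) • (twistedE q e kInv j * K) := fun j => by
    rw [twistedE, mul_smul_comm, ← mul_assoc, hKk, mul_assoc, hKe, mul_smul_comm, smul_comm,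
      smul_mul_assoc, mul_assoc]
  have key : ∀ x : ι → Module.End ℂ M, (∀ j, K * x j = (a : ℂ) • (x j * K)) →
      (w.map x).prod = 0 := by
    intro x hx
    refine LinearMap.ker_eq_top.1 (top_le_iff.1 ?_)
    rw [← hM, iSup_le_iff]
    intro μ v hv
    by_cases hv0 : v = 0
    · simp [hv0]
    · obtain ⟨b, hb, hbv⟩ := hKv μ v hv hv0
      exact prod_map_apply_eq_zero ha hx hb hbv w hw
  exact ⟨key e hKe, key _ hKE⟩

theorem f_pow_apply_eq_zero [Fintype ι] [FiniteDimensional ℂ M]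
    (h : IsUqFamily C q e f k kInv) (hC : C.HasGrading) (hq : ¬ IsOfFinOrder q)
    {μ : ι → ℂ} {v : M} (hv : v ∈ weightSpace k μ) (i : ι) :
    (f i ^ Module.finrank ℂ M) v = 0 := by
  by_cases hv0 : v = 0
  · simp [hv0]
  obtain ⟨K, a, ha, -, hKf, -, hKv⟩ := h.exists_grading hC hq
  obtain ⟨b, hb, hbv⟩ := hKv μ v hv hv0
  have := prod_map_apply_eq_zero (a := a⁻¹) (by rwa [isOfFinOrder_inv_iff]) hKf hb hbv
    (List.replicate (Module.finrank ℂ M) i) (by simp)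
  simpa using this

/-- The rank one computation: with `Q = qForm C q i i`, the scalar is `s = qInvDiff q * ∑_{t ≤ n} (Q
^ (-t) μ_i - Q ^ t μ_i⁻¹)`, and the second equation is this geometric sum with its denominators
cleared. -/
theorem e_f_pow_apply (h : IsUqFamily C q e f k kInv) {μ : ι → ℂ} {v : M}
    (hv : v ∈ weightSpace k μ) (hv0 : v ≠ 0) {i : ι} (hi : e i v = 0) (n : ℕ) :
    ∃ s : ℂ, e i ((f i ^ (n + 1)) v) = s • (f i ^ n) v ∧
      s * (qForm C q i i - 1) * qForm C q i i ^ n * μ i =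
        qInvDiff q * (μ i ^ 2 - qForm C q i i ^ n) * (qForm C q i i ^ (n + 1) - 1) := by
  have hμ := h.weight_ne_zero hv hv0 i
  have hwt : ∀ n : ℕ, (f i ^ n) v ∈ weightSpace k fun l => qFormInv C q l i ^ n * μ l := by
    intro n
    induction n with
    | zero => simpa using hv
    | succ n ih =>
      have := h.f_mem_weightSpace ih i
      rw [pow_succ', Module.End.mul_apply]
      simpa only [pow_succ', mul_assoc] using this
  have hcomm : ∀ n : ℕ, e i (f i ((f i ^ n) v)) = f i (e i ((f i ^ n) v)) +
      (qInvDiff q * (qFormInv C q i i ^ n * μ i - (qFormInv C q i i ^ n * μ i)⁻¹)) •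
        (f i ^ n) v := by
    intro n
    have h1 : e i * f i = f i * e i + qInvDiff q • (k i - kInv i) := by
      rw [qInvDiff, ← h.e_f_same i]; abel
    rw [← Module.End.mul_apply, h1, LinearMap.add_apply, Module.End.mul_apply, LinearMap.smul_apply,
      LinearMap.sub_apply, mem_weightSpace.1 (hwt n) i, h.kInv_apply (hwt n) i, ← sub_smul,
      smul_smul]
  have hQ : qFormInv C q i i = (qForm C q i i)⁻¹ :=
    eq_inv_of_mul_eq_one_left (qFormInv_mul C q i i)
  have hQ0 : qForm C q i i ≠ 0 := Units.ne_zero _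
  induction n with
  | zero =>
    refine ⟨qInvDiff q * (μ i - (μ i)⁻¹), ?_, ?_⟩
    · simpa [hi] using hcomm 0
    · field_simp
      ring
  | succ n ih =>
    obtain ⟨s, hs, hs2⟩ := ih
    refine ⟨s + qInvDiff q * (qFormInv C q i i ^ (n + 1) * μ i -
      (qFormInv C q i i ^ (n + 1) * μ i)⁻¹), ?_, ?_⟩
    · have h2 := hcomm (n + 1)
      rw [hs, map_smul, ← Module.End.mul_apply (f i) (f i ^ n), ← pow_succ', ← add_smul,
        ← Module.End.mul_apply (f i) (f i ^ (n + 1)), ← pow_succ'] at h2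
      exact h2
    · rw [hQ]
      generalize qForm C q i i = Q at *
      generalize μ i = x at *
      have h3 : (Q⁻¹ ^ (n + 1) * x - (Q⁻¹ ^ (n + 1) * x)⁻¹) * Q ^ (n + 1) * x =
          x ^ 2 - (Q ^ (n + 1)) ^ 2 := by
        rw [mul_inv, inv_pow, inv_inv]
        field_simp
      linear_combination Q * hs2 + qInvDiff q * (Q - 1) * h3

/-- The weights of the singular vectors of a finite-dimensional module are dominant. -/
theorem exists_weight_sq_eq_pow [Fintype ι] [FiniteDimensional ℂ M]
    (h : IsUqFamily C q e f k kInv) (hC : C.HasGrading) (hq : ¬ IsOfFinOrder q) {μ : ι → ℂ} {v : M}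
    (hv : v ∈ weightSpace k μ) (hv0 : v ≠ 0) (he : ∀ i, e i v = 0) (i : ι) :
    ∃ n : ℕ, μ i ^ 2 = qForm C q i i ^ n := by
  classical
  have hex : ∃ n, (f i ^ n) v = 0 := ⟨_, h.f_pow_apply_eq_zero hC hq hv i⟩
  have h1 := Nat.find_spec hex
  obtain ⟨n, hn⟩ : ∃ n, Nat.find hex = n + 1 := by
    refine Nat.exists_eq_succ_of_ne_zero fun h0 => ?_
    rw [h0] at h1
    exact hv0 (by simpa using h1)
  -- `f_i ^ n v` is the last non-zero vector of the string, so the scalar `s` of the next step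
  -- vanishes. Its factor `Q ^ (n + 1) - 1` is non-zero as `q` is not a root of unity, which leaves
  -- `μ_i ^ 2 = Q ^ n`; the sign of `μ_i` stays undetermined.
  have h2 : (f i ^ n) v ≠ 0 := Nat.find_min hex (by omega)
  rw [hn] at h1
  obtain ⟨s, hs, hs2⟩ := h.e_f_pow_apply hv hv0 (he i) n
  rw [h1, map_zero] at hs
  have hs0 : s = 0 := (smul_eq_zero.1 hs.symm).resolve_right h2
  have h3 : qForm C q i i ^ (n + 1) - 1 ≠ 0 := by
    intro h0
    refine hq (isOfFinOrder_iff_zpow_eq_one.2 ⟨C.form i i * ((n + 1 : ℕ) : ℤ), ?_, ?_⟩)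
    · refine mul_ne_zero ?_ (by positivity)
      rw [CartanDatum.form, C.diag]
      have := C.d_pos i
      positivity
    · rw [zpow_mul, zpow_natCast]
      exact Units.ext (by simpa [qForm] using sub_eq_zero.1 h0)
  rw [hs0] at hs2
  simp only [zero_mul] at hs2
  have h4 := (mul_eq_zero.1 hs2.symm).resolve_right h3
  exact ⟨n, sub_eq_zero.1 ((mul_eq_zero.1 h4).resolve_left (qInvDiff_ne_zero hq))⟩

end IsUqFamily

/-! ### Two dimension counts. -/

section LinearAlgebra
variable {M : Type*} [AddCommGroup M] [Module ℂ M] [FiniteDimensional ℂ M]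

/-- The image of `W` is at least as large as `W`, so by rank-nullity `g` is injective on `W`. -/
theorem eq_zero_of_le_map {g : Module.End ℂ M} {W : Submodule ℂ M} (hW : W ≤ W.map g) {v : M}
    (hv : v ∈ W) (hgv : g v = 0) : v = 0 := by
  have h1 := LinearMap.finrank_range_add_finrank_ker (g.domRestrict W)
  rw [LinearMap.range_domRestrict] at h1
  have h2 := Submodule.finrank_mono hW
  have h3 : LinearMap.ker (g.domRestrict W) = ⊥ := Submodule.finrank_eq_zero.1 (by omega)
  have h4 : (⟨v, hv⟩ : W) ∈ LinearMap.ker (g.domRestrict W) := by simpa using hgv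
  rw [h3, Submodule.mem_bot] at h4
  exact congrArg Subtype.val h4

theorem le_map_of_injOn {g : Module.End ℂ M} {U : Submodule ℂ M} (hU : U.map g ≤ U)
    (hg : ∀ m ∈ U, g m = 0 → m = 0) : U ≤ U.map g := by
  have h1 := LinearMap.finrank_range_add_finrank_ker (g.domRestrict U)
  rw [LinearMap.range_domRestrict] at h1
  have h3 : LinearMap.ker (g.domRestrict U) = ⊥ :=
    (Submodule.eq_bot_iff _).2 fun m hm => Subtype.ext (hg m m.2 (by simpa using hm))
  rw [h3, finrank_bot, add_zero] at h1
  exact (Submodule.eq_of_le_of_finrank_eq hU h1).ge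

end LinearAlgebra

/-! ### The Casimir scalars. -/

section Scalars
variable {ι : Type*} (C : CartanDatum ι) (q : ℂˣ)

/-- The weight `μ + ∑ α_i`, summed over the letters of a word. -/
noncomputable def shiftWeight (μ : ι → ℂ) : List ι → ι → ℂ
  | [] => μ
  | j :: w => fun i => qForm C q i j * shiftWeight μ w i

/-- The ratio of the Casimir scalars of the weights `μ + ∑ α_i` and `μ`. -/
noncomputable def casimirRatio (μ : ι → ℂ) : List ι → ℂ
  | [] => 1
  | j :: w => (qForm C q j j * shiftWeight C q μ w j) ^ 2 * casimirRatio μ w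

theorem shiftWeight_apply (μ : ι → ℂ) (w : List ι) (i : ι) :
    shiftWeight C q μ w i = μ i * (w.map (qForm C q i)).prod := by
  induction w with
  | nil => simp [shiftWeight]
  | cons j w ih => simp only [shiftWeight, ih, List.map_cons, List.prod_cons]; ring

/-- With `β` the sum of the letters, the exponent of `q` is `2(μ, β) + (β, β) + 2(ρ, β)`, where
`2(ρ, α_i) = (α_i, α_i)`. -/
theorem casimirRatio_eq (μ : ι → ℂ) (w : List ι) :
    casimirRatio C q μ w = (w.map fun i => μ i ^ 2).prod *
      (w.map fun i => (w.map (qForm C q i)).prod).prod * (w.map fun i => qForm C q i i).prod := by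
  induction w with
  | nil => simp [casimirRatio]
  | cons j w ih =>
    rw [casimirRatio, ih, shiftWeight_apply]
    simp only [List.map_cons, List.prod_cons, List.prod_map_mul]
    have : (w.map fun i => qForm C q i j) = w.map (qForm C q j) :=
      List.map_congr_left fun i _ => qForm_comm C q i j
    rw [this]
    ring

/-- For `ν = μ + β` the exponent of the ratio equals `(β, μ + ν + 2ρ)`, which is a sum over the
letters. The square is taken because dominance is known only for the squares of the weights. -/
theorem casimirRatio_sq (μ : ι → ℂ) (w : List ι) :
    casimirRatio C q μ w ^ 2 =
      (w.map fun i => μ i ^ 2 * shiftWeight C q μ w i ^ 2 * qForm C q i i ^ 2).prod := by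
  have h2 : ∀ g : ι → ℂ, (w.map fun i => g i ^ 2).prod = (w.map g).prod ^ 2 := by
    intro g
    simp only [pow_two, List.prod_map_mul]
  rw [casimirRatio_eq, List.prod_map_mul, List.prod_map_mul]
  simp only [shiftWeight_apply, mul_pow, List.prod_map_mul, h2]
  ring

variable {C q}

/-- Dominance of `μ` and `ν` makes each factor in `casimirRatio_sq` a strictly positive power of
`q`, thanks to the contribution of `2ρ`. -/
theorem casimirRatio_ne_one (hq : ¬ IsOfFinOrder q) {μ : ι → ℂ} {w : List ι} (hw : w ≠ [])
    (hμ : ∀ i, ∃ n : ℕ, μ i ^ 2 = qForm C q i i ^ n)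
    (hν : ∀ i, ∃ n : ℕ, shiftWeight C q μ w i ^ 2 = qForm C q i i ^ n) :
    casimirRatio C q μ w ≠ 1 := by
  intro h1
  have h2 := casimirRatio_sq C q μ w
  rw [h1, one_pow] at h2
  have h3 : ∀ i, ∃ N : ℕ, 0 < N ∧
      μ i ^ 2 * shiftWeight C q μ w i ^ 2 * qForm C q i i ^ 2 = (q : ℂ) ^ N := by
    intro i
    obtain ⟨n, hn⟩ := hμ i
    obtain ⟨m, hm⟩ := hν i
    refine ⟨2 * C.d i * (n + m + 2), by have := C.d_pos i; positivity, ?_⟩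
    have h4 : qForm C q i i = (q : ℂ) ^ (2 * C.d i) := by
      rw [qForm, CartanDatum.form_self, ← Units.val_pow_eq_pow_val, mul_comm 2, pow_mul]
      rfl
    rw [hn, hm, h4]
    ring
  choose N hN hN2 using h3
  simp only [hN2] at h2
  have h5 : ∀ u : List ι, (u.map fun i => (q : ℂ) ^ N i).prod = (q : ℂ) ^ (u.map N).sum := by
    intro u
    induction u with
    | nil => simp
    | cons i u ih => simp [ih, pow_add]
  rw [h5] at h2
  refine hq (isOfFinOrder_iff_pow_eq_one.2 ⟨(w.map N).sum, ?_, Units.ext (by simpa using h2.symm)⟩)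
  obtain ⟨i, w, rfl⟩ := List.exists_cons_of_ne_nil hw
  have := hN i
  simp only [List.map_cons, List.sum_cons]
  omega

end Scalars

/-! ### Singular vectors in the sum of the images of the `f_α`. -/

namespace IsUqFamily
variable {ι M : Type*} [AddCommGroup M] [Module ℂ M] [FiniteDimensional ℂ M]
  {C : CartanDatum ι} {q : ℂˣ} {e f k kInv : ι → Module.End ℂ M}

/-- Raising `m` by `e_j` multiplies its `T`-eigenvalue by the square of the new weight at `j`,
exactly as `casimirRatio` grows. After maximal raising the vector is singular, so its eigenvalue is
`1`, contrary to `casimirRatio_ne_one`. -/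
theorem eq_zero_of_casimirRatio [Fintype ι] (h : IsUqFamily C q e f k kInv) (hC : C.HasGrading)
    (hq : ¬ IsOfFinOrder q) {T : Module.End ℂ M}
    (hTe : ∀ j, e j * T = T * (kInv j * kInv j) * e j)
    (hTv : ∀ v, (∀ j, e j v = 0) → T v = v)
    {μ : ι → ℂ} (hμ : ∀ i, ∃ n : ℕ, μ i ^ 2 = qForm C q i i ^ n) {w : List ι} (hw : w ≠ [])
    {N : ℕ} (hN : ∀ w : List ι, N ≤ w.length → (w.map e).prod = 0)
    {m : M} (hm : m ∈ weightSpace k (shiftWeight C q μ w)) (hTm : T m = casimirRatio C q μ w • m) :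
    m = 0 := by
  by_contra hm0
  have hstep : ∀ u : List ι, (u.map e).prod m ∈ weightSpace k (shiftWeight C q μ (u ++ w)) ∧
      T ((u.map e).prod m) = casimirRatio C q μ (u ++ w) • (u.map e).prod m := by
    intro u
    induction u with
    | nil => exact ⟨by simpa using hm, by simpa using hTm⟩
    | cons j u ih =>
      set m' := (u.map e).prod m with hm'
      have h1 := h.e_mem_weightSpace ih.1 j
      have h2 : ((j :: u).map e).prod m = e j m' := by simp [hm']
      rw [h2]
      refine ⟨h1, ?_⟩
      by_cases h0 : e j m' = 0
      · simp [h0]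
      have h3 := LinearMap.congr_fun (hTe j) m'
      simp only [Module.End.mul_apply, ih.2, map_smul, h.kInv_apply h1] at h3
      have h4 := h.weight_ne_zero h1 h0 j
      rw [List.cons_append, casimirRatio, mul_smul, h3, smul_smul, smul_smul, pow_two,
        mul_inv_cancel_right₀ h4, mul_inv_cancel₀ h4, one_smul]
  -- Otherwise arbitrarily long words in the `e_α` would act non-trivially on `m`.
  have hmax : ∃ u : List ι, (u.map e).prod m ≠ 0 ∧ ∀ j, e j ((u.map e).prod m) = 0 := by
    by_contra hcon
    push Not at hcon
    have : ∀ n : ℕ, ∃ u : List ι, u.length = n ∧ (u.map e).prod m ≠ 0 := by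
      intro n
      induction n with
      | zero => exact ⟨[], rfl, by simpa using hm0⟩
      | succ n ih =>
        obtain ⟨u, hu, hum⟩ := ih
        obtain ⟨j, hj⟩ := hcon u hum
        exact ⟨j :: u, by simp [hu], by simpa using hj⟩
    obtain ⟨u, hu, hum⟩ := this N
    exact hum (by rw [hN u hu.ge]; rfl)
  obtain ⟨u, hu, huj⟩ := hmax
  obtain ⟨h1, h2⟩ := hstep u
  refine casimirRatio_ne_one hq (by simp [hw]) hμ
    (h.exists_weight_sq_eq_pow hC hq h1 hu huj) ?_
  rw [hTv _ huj] at h2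
  exact smul_left_injective ℂ hu (by simpa using h2.symm)

/-- A singular vector that is a sum of vectors in the images of the `f_α` vanishes. -/
theorem eq_zero_of_mem_iSup_map_f [Fintype ι] [DecidableEq ι] (h : IsUqFamily C q e f k kInv)
    (hC : C.HasGrading) (hq : ¬ IsOfFinOrder q) (hM : ⨆ μ, weightSpace k μ = ⊤)
    (he : ∀ x ∈ radical C q, eval (twistedE q e kInv) x = 0)
    (hf : ∀ x ∈ radical C q, evalRev f x = 0)
    {μ : ι → ℂ} {v : M} (hv : v ∈ weightSpace k μ) (hev : ∀ j, e j v = 0)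
    (hvf : v ∈ ⨆ j, (weightSpace k (shiftWeight C q μ [j])).map (f j)) : v = 0 := by
  by_contra hv0
  have hN := fun w hw => (h.prod_map_e_eq_zero hC hq hM w hw).1
  obtain ⟨T, hTe, hTf, hTk, hTy⟩ := h.exists_quasiCasimir (qInvDiff_ne_zero hq) he hf
    fun w hw => (h.prod_map_e_eq_zero hC hq hM w hw).2
  -- `hTy` concerns operators; it is applied to the rank one operator `φ(·) v`, whose image lies in
  -- the line of `v`.
  have hTv : ∀ v, (∀ j, e j v = 0) → T v = v := by
    intro v hv
    by_cases hv0 : v = 0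
    · simp [hv0]
    obtain ⟨φ, hφ⟩ := Module.Projective.exists_dual_eq_one ℂ hv0
    have h1 := hTy (φ.smulRight v) fun j => LinearMap.ext fun x => by simp [hv]
    simpa [hφ] using LinearMap.congr_fun h1 v
  have hμ := h.exists_weight_sq_eq_pow hC hq hv hv0 hev
  -- It remains to see that the sum of the spaces `f_j U_j` lies in its own image under `T - 1`.
  refine hv0 (eq_zero_of_le_map (g := T - 1) ?_ hvf (by simp [hTv v hev]))
  refine iSup_le fun j => ?_
  rintro _ ⟨m, hm, rfl⟩
  set U := weightSpace k (shiftWeight C q μ [j]) with hU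
  have hTU : ∀ m ∈ U, T m ∈ U := fun m hm => mem_weightSpace.2 fun i => by
    rw [← Module.End.mul_apply, ← hTk, Module.End.mul_apply, mem_weightSpace.1 hm, map_smul]
  set a := casimirRatio C q μ [j] with ha
  have hle : U ≤ U.map (T - a • (1 : Module.End ℂ M)) := by
    refine le_map_of_injOn ?_ fun m hm h0 => ?_
    · rintro _ ⟨m, hm, rfl⟩
      exact U.sub_mem (hTU m hm) (U.smul_mem _ hm)
    · exact h.eq_zero_of_casimirRatio hC hq hTe hTv hμ (by simp) hN hm
        (by simpa [sub_eq_zero] using h0)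
  obtain ⟨m', hm', rfl⟩ := hle hm
  -- Because `a T f_j = f_j T` on `U`, the operator `T - 1` takes `a f_j m'` to `f_j (T - a) m'`.
  refine ⟨a • f j m', Submodule.smul_mem _ _ (Submodule.mem_iSup_of_mem j ⟨m', hm', rfl⟩), ?_⟩
  have hx : qForm C q j j * μ j ≠ 0 :=
    mul_ne_zero (Units.ne_zero _) (h.weight_ne_zero hv hv0 j)
  have h1 := LinearMap.congr_fun (hTf j) m'
  have h2 : kInv j m' = (qForm C q j j * μ j)⁻¹ • m' := h.kInv_apply hm' j
  simp only [Module.End.mul_apply, h2, map_smul] at h1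
  have h3 : a • T (f j m') = f j (T m') := by
    rw [h1, ha, casimirRatio, casimirRatio, shiftWeight, smul_smul, smul_smul, mul_one, pow_two,
      mul_inv_cancel_right₀ hx, mul_inv_cancel₀ hx, one_smul]
  simp [h3, smul_sub]

end IsUqFamily

/-! ### Orthogonality, weight projections and the vectors killed by all `e_α`. -/

theorem nondegenerate_of_isSymm {M : Type*} [AddCommGroup M] [Module ℂ M]
    {B : LinearMap.BilinForm ℂ M} (hB : B.IsSymm) (h : ∀ v, (∀ w, B v w = 0) → v = 0) :
    B.Nondegenerate :=
  ⟨h, fun v hv => h v fun w => by rw [hB.eq]; exact hv w⟩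

theorem eq_of_eqOn_weightSpace {ι M N : Type*} [AddCommGroup M] [Module ℂ M] [AddCommGroup N]
    [Module ℂ N] {k : ι → Module.End ℂ M} (hM : ⨆ μ, weightSpace k μ = ⊤) {φ ψ : M →ₗ[ℂ] N}
    (h : ∀ μ, ∀ m ∈ weightSpace k μ, φ m = ψ m) : φ = ψ := by
  have : (⊤ : Submodule ℂ M) ≤ LinearMap.eqLocus φ ψ := by
    rw [← hM]; exact iSup_le fun μ m hm => h μ m hm
  exact LinearMap.ext fun m => this Submodule.mem_top

namespace IsUqFamily
variable {ι M : Type*} [AddCommGroup M] [Module ℂ M]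
  {C : CartanDatum ι} {q : ℂˣ} {e f k kInv : ι → Module.End ℂ M}

theorem weightProj_e (h : IsUqFamily C q e f k kInv) (hM : ⨆ μ, weightSpace k μ = ⊤)
    {P : (ι → ℂ) → Module.End ℂ M} (hP : ∀ μ, ∀ m ∈ weightSpace k μ, P μ m = m)
    (hP0 : ∀ μ ν, μ ≠ ν → ∀ m ∈ weightSpace k ν, P μ m = 0) (μ : ι → ℂ) (j : ι) (m : M) :
    e j (P μ m) = P (fun i => qForm C q i j * μ i) (e j m) := by
  refine LinearMap.congr_fun (f := e j ∘ₗ P μ) (g := P (fun i => qForm C q i j * μ i) ∘ₗ e j)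
    (eq_of_eqOn_weightSpace hM fun ν m hm => ?_) m
  have h1 := h.e_mem_weightSpace hm j
  by_cases hμν : μ = ν
  · subst hμν
    rw [LinearMap.comp_apply, LinearMap.comp_apply, hP _ _ hm, hP _ _ h1]
  · rw [LinearMap.comp_apply, LinearMap.comp_apply, hP0 _ _ hμν _ hm, hP0 _ _ _ _ h1, map_zero]
    intro h0
    exact hμν (funext fun i => mul_left_cancel₀ (Units.ne_zero _) (congrFun h0 i))

theorem weightProj_f (h : IsUqFamily C q e f k kInv) (hM : ⨆ μ, weightSpace k μ = ⊤)
    {P : (ι → ℂ) → Module.End ℂ M} (hP : ∀ μ, ∀ m ∈ weightSpace k μ, P μ m = m)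
    (hP0 : ∀ μ ν, μ ≠ ν → ∀ m ∈ weightSpace k ν, P μ m = 0) (μ : ι → ℂ) (j : ι) (m : M) :
    P μ (f j m) = f j (P (shiftWeight C q μ [j]) m) := by
  refine LinearMap.congr_fun (f := P μ ∘ₗ f j) (g := f j ∘ₗ P (shiftWeight C q μ [j]))
    (eq_of_eqOn_weightSpace hM fun ν m hm => ?_) m
  have h1 := h.f_mem_weightSpace hm j
  by_cases hμν : shiftWeight C q μ [j] = ν
  · have h2 : (fun i => qFormInv C q i j * ν i) = μ := by
      subst hμν
      funext i
      simp only [shiftWeight]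
      rw [← mul_assoc, qFormInv_mul, one_mul]
    rw [h2] at h1
    rw [LinearMap.comp_apply, LinearMap.comp_apply, hP _ _ h1, hμν, hP _ _ hm]
  · rw [LinearMap.comp_apply, LinearMap.comp_apply, hP0 _ _ hμν _ hm, hP0 _ _ _ _ h1, map_zero]
    rintro rfl
    refine hμν (funext fun i => ?_)
    simp only [shiftWeight]
    rw [← mul_assoc, qForm_mul_inv, one_mul]

/-- The vectors killed by all `e_α` are sums of singular vectors. -/
theorem mem_span_singular (h : IsUqFamily C q e f k kInv) (hM : ⨆ μ, weightSpace k μ = ⊤) {v : M}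
    (hv : ∀ j, e j v = 0) :
    v ∈ Submodule.span ℂ {v | v ≠ 0 ∧ (∃ μ, v ∈ weightSpace k μ) ∧ ∀ j, e j v = 0} := by
  obtain ⟨P, hPm, hP, hP0, hPp⟩ := exists_weightProj h.commute_k hM
  refine hPp _ v fun μ => ?_
  by_cases h0 : P μ v = 0
  · rw [h0]; exact Submodule.zero_mem _
  · refine Submodule.subset_span ⟨h0, ⟨μ, hPm μ v⟩, fun j => ?_⟩
    rw [h.weightProj_e hM hP hP0, hv, map_zero]

/-- Up to rescaling the letters, words in the `f_α` are adjoint to words in the `E_α`. Taking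
adjoints reverses products, which is why one side uses `evalRev` and the other `eval`. -/
theorem evalRev_eq_zero_of_form [DecidableEq ι]
    (hq : qInvDiff q ≠ 0) {B : LinearMap.BilinForm ℂ M}
    (hB : B.Nondegenerate) (hBf : ∀ i m m', B (f i m) m' = -B m (kInv i (e i m')))
    (he : ∀ x ∈ radical C q, eval (twistedE q e kInv) x = 0) :
    ∀ x ∈ radical C q, evalRev f x = 0 := by
  have hadj : ∀ x m m', B (evalRev f x m) m' =
      B m (eval (twistedE q e kInv) (twist (fun _ => qInvDiff q) x) m') := by
    intro x m m'
    refine LinearMap.congr_fun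
      (f := B.flip m' ∘ₗ (LinearMap.applyₗ m) ∘ₗ evalRev f)
      (g := B m ∘ₗ (LinearMap.applyₗ m') ∘ₗ eval (twistedE q e kInv) ∘ₗ twist _)
      (hom_ext fun w => ?_) x
    induction w generalizing m m' with
    | nil => simp [eval_single, evalRev_single]
    | cons i w ih =>
      simp only [LinearMap.comp_apply, LinearMap.applyₗ_apply_apply] at ih ⊢
      rw [← cons_single, evalRev_cons, twist_cons, map_smul, eval_cons, Module.End.mul_apply, ih,
        hBf, LinearMap.smul_apply, Module.End.mul_apply, twistedE, LinearMap.smul_apply, smul_smul,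
        mul_neg, mul_inv_cancel₀ hq, neg_one_smul, map_neg, Module.End.mul_apply]
  intro x hx
  refine LinearMap.ext fun m => hB.1 _ fun m' => ?_
  rw [hadj, he _ (twist_mem_radical hx _), LinearMap.zero_apply, map_zero]

variable [FiniteDimensional ℂ M]

/-- A vector killed by all `e_α` that is orthogonal to all such vectors vanishes. -/
theorem eq_zero_of_orthogonal [Fintype ι] [DecidableEq ι] (h : IsUqFamily C q e f k kInv)
    (hC : C.HasGrading) (hq : ¬ IsOfFinOrder q) (hM : ⨆ μ, weightSpace k μ = ⊤)
    (he : ∀ x ∈ radical C q, eval (twistedE q e kInv) x = 0)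
    {B : LinearMap.BilinForm ℂ M} (hBs : B.IsSymm) (hB : B.Nondegenerate)
    (hBf : ∀ i m m', B (f i m) m' = -B m (kInv i (e i m')))
    {v : M} (hv : ∀ j, e j v = 0) (hvo : ∀ w, (∀ j, e j w = 0) → B v w = 0) : v = 0 := by
  have hf := evalRev_eq_zero_of_form (qInvDiff_ne_zero hq) hB hBf he
  have hvf : v ∈ ⨆ j, LinearMap.range (f j) := by
    -- By adjointness a vector orthogonal to all images of the `f_α` is killed by all `e_α`, hence
    -- orthogonal to `v`; the double orthogonal complement then gives `hvf`.
    rw [← LinearMap.BilinForm.orthogonal_orthogonal hB hBs.isRefl (⨆ j, LinearMap.range (f j))]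
    intro w hw
    change B w v = 0
    rw [hBs.eq]
    refine hvo w fun j => ?_
    have h1 : kInv j (e j w) = 0 := hB.2 _ fun m => by
      have h2 : B (f j m) w = 0 := hw (f j m) (Submodule.mem_iSup_of_mem j ⟨m, rfl⟩)
      rw [hBf] at h2
      exact neg_eq_zero.1 h2
    have h3 : k j (kInv j (e j w)) = e j w := by
      rw [← Module.End.mul_apply, h.k_kInv, Module.End.one_apply]
    rw [← h3, h1, map_zero]
  obtain ⟨P, hPm, hP, hP0, hPp⟩ := exists_weightProj h.commute_k hM
  rw [← Submodule.mem_bot ℂ]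
  refine hPp _ v fun μ => (Submodule.mem_bot ℂ).2 ?_
  -- Every weight component of `v` is again killed by the `e_α`, and it lies in the sum of the `f_j`
  -- applied to the weight spaces `μ + α_j`.
  refine h.eq_zero_of_mem_iSup_map_f hC hq hM he hf (hPm μ v)
    (fun j => by rw [h.weightProj_e hM hP hP0, hv, map_zero]) ?_
  have h4 : (⨆ j, LinearMap.range (f j)) ≤
      (⨆ j, (weightSpace k (shiftWeight C q μ [j])).map (f j)).comap (P μ) := by
    refine iSup_le fun j => ?_
    rintro _ ⟨m, rfl⟩
    rw [Submodule.mem_comap, h.weightProj_f hM hP hP0]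
    exact Submodule.mem_iSup_of_mem j ⟨_, hPm _ m, rfl⟩
  exact h4 hvf

end IsUqFamily

/-! ### Triangular decomposition and the anti-automorphism `ω`. -/

namespace Uq
variable {ι : Type*} {C : CartanDatum ι} {q : ℂˣ}

theorem mem_of_generators (S : Subalgebra ℂ (Uq C q)) (he : ∀ i, e C q i ∈ S)
    (hf : ∀ i, f C q i ∈ S) (hk : ∀ i, k C q i ∈ S) (hkInv : ∀ i, kInv C q i ∈ S) (x : Uq C q) :
    x ∈ S := by
  obtain ⟨a, rfl⟩ : ∃ a, mk C q a = x := RingQuot.mkAlgHom_surjective ℂ (UqRel C q) x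
  have h1 : Algebra.adjoin ℂ (Set.range (FreeAlgebra.ι ℂ : UqGen ι → _)) ≤ S.comap (mk C q) := by
    refine Algebra.adjoin_le ?_
    rintro _ ⟨g, rfl⟩
    cases g with
    | e i => exact he i
    | f i => exact hf i
    | k i => exact hk i
    | kInv i => exact hkInv i
  rw [FreeAlgebra.adjoin_range_ι] at h1
  exact h1 Algebra.mem_top

theorem map_mem_of_generators {V : Type*} [AddCommGroup V] [Module ℂ V] (ρ : UqRep C q V)
    {p : Submodule ℂ V} (he : ∀ i, ∀ v ∈ p, ρ (e C q i) v ∈ p)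
    (hf : ∀ i, ∀ v ∈ p, ρ (f C q i) v ∈ p) (hk : ∀ i, ∀ v ∈ p, ρ (k C q i) v ∈ p)
    (hkInv : ∀ i, ∀ v ∈ p, ρ (kInv C q i) v ∈ p) (x : Uq C q) : ∀ v ∈ p, ρ x v ∈ p := by
  let S : Subalgebra ℂ (Uq C q) :=
    { carrier := {x | ∀ v ∈ p, ρ x v ∈ p}
      mul_mem' := fun {a b} ha hb v hv => by
        rw [map_mul, Module.End.mul_apply]; exact ha _ (hb v hv)
      add_mem' := fun {a b} ha hb v hv => by
        rw [map_add, LinearMap.add_apply]; exact p.add_mem (ha v hv) (hb v hv)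
      algebraMap_mem' := fun c v hv => by
        rw [AlgHom.commutes, Module.algebraMap_end_apply]; exact p.smul_mem c hv }
  exact mem_of_generators S he hf hk hkInv x

theorem omega_mul (x y : Uq C q) : (omega (x * y)).unop = (omega y).unop * (omega x).unop := by
  rw [map_mul, MulOpposite.unop_mul]

@[simp] theorem omega_e (i : ι) : (omega (e C q i)).unop = -(f C q i * k C q i) := by simp [omega]
@[simp] theorem omega_f (i : ι) : (omega (f C q i)).unop = -(kInv C q i * e C q i) := by
  simp [omega]
@[simp] theorem omega_k (i : ι) : (omega (k C q i)).unop = k C q i := by simp [omega]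
@[simp] theorem omega_kInv (i : ι) : (omega (kInv C q i)).unop = kInv C q i := by simp [omega]

theorem omega_omega (x : Uq C q) : (omega (omega x).unop).unop = x := by
  let S : Subalgebra ℂ (Uq C q) :=
    { carrier := {x | (omega (omega x).unop).unop = x}
      mul_mem' := fun {a b} ha hb => by
        change (omega (omega (a * b)).unop).unop = a * b
        rw [omega_mul, omega_mul]
        exact congrArg₂ (· * ·) ha hb
      add_mem' := fun {a b} ha hb => by
        change (omega (omega (a + b)).unop).unop = a + b
        rw [map_add, MulOpposite.unop_add, map_add, MulOpposite.unop_add]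
        exact congrArg₂ (· + ·) ha hb
      algebraMap_mem' := fun c => by simp [AlgHom.commutes] }
  have h := isUqFamily (C := C) (q := q)
  refine mem_of_generators S (fun i => ?_) (fun i => ?_) (fun i => ?_) (fun i => ?_) x
  · change (omega (omega (e C q i)).unop).unop = _
    rw [omega_e, map_neg, MulOpposite.unop_neg, omega_mul, omega_f, omega_k, mul_neg, neg_neg,
      ← mul_assoc, h.k_kInv, one_mul]
  · change (omega (omega (f C q i)).unop).unop = _
    rw [omega_f, map_neg, MulOpposite.unop_neg, omega_mul, omega_e, omega_kInv, neg_mul, neg_neg,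
      mul_assoc, h.k_kInv, mul_one]
  · change (omega (omega (k C q i)).unop).unop = _
    simp
  · change (omega (omega (kInv C q i)).unop).unop = _
    simp

variable (C q) in
/-- The multiplicative monoid generated by the `q^{±h_α}`. -/
noncomputable def torus : Submonoid (Uq C q) := Submonoid.closure (Set.range (k C q) ∪ Set.range (kInv C q))

theorem e_mul_torus {κ : Uq C q} (hκ : κ ∈ torus C q) (j : ι) :
    ∃ s : ℂ, e C q j * κ = s • (κ * e C q j) := by
  have h := isUqFamily (C := C) (q := q)
  induction hκ using Submonoid.closure_induction with
  | mem x hx =>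
    rcases hx with ⟨i, rfl⟩ | ⟨i, rfl⟩
    · refine ⟨qFormInv C q i j, ?_⟩
      rw [h.k_e, ← qForm, smul_smul, qFormInv_mul, one_smul]
    · refine ⟨qForm C q i j, ?_⟩
      rw [h.kInv_e, ← qFormInv, smul_smul, qForm_mul_inv, one_smul]
  | one => exact ⟨1, by simp⟩
  | mul x y _ _ hx hy =>
    obtain ⟨s, hs⟩ := hx
    obtain ⟨t, ht⟩ := hy
    refine ⟨s * t, ?_⟩
    rw [← mul_assoc, hs, smul_mul_assoc, mul_assoc, ht, mul_smul_comm, smul_smul, mul_assoc]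

/-- The weak triangular decomposition: `U = U^- U^0 + ∑ U e_α`. -/
theorem triangular [DecidableEq ι] (x : Uq C q) :
    x ∈ Submodule.span ℂ ({x | ∃ (a : WordSpace ι) (κ : Uq C q), κ ∈ torus C q ∧
      x = evalRev (f C q) a * κ} ∪ {x | ∃ y j, x = y * e C q j}) := by
  have h := isUqFamily (C := C) (q := q)
  set A : Set (Uq C q) := {x | ∃ (a : WordSpace ι) (κ : Uq C q), κ ∈ torus C q ∧
      x = evalRev (f C q) a * κ} with hA
  set A' : Set (Uq C q) := {x | ∃ y j, x = y * e C q j} with hA'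
  have hk : ∀ i, k C q i ∈ torus C q := fun i => Submonoid.subset_closure (Or.inl ⟨i, rfl⟩)
  have hkInv : ∀ i, kInv C q i ∈ torus C q := fun i => Submonoid.subset_closure (Or.inr ⟨i, rfl⟩)
  -- The elements of `A'` stay in `A'` under left multiplication, so only those of `A` need to be
  -- checked.
  have hmul : ∀ g : Uq C q, (∀ s ∈ A, g * s ∈ Submodule.span ℂ (A ∪ A')) →
      ∀ y ∈ Submodule.span ℂ (A ∪ A'),
        (Algebra.lmul ℂ (Uq C q)) g y ∈ Submodule.span ℂ (A ∪ A') := by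
    intro g hg y hy
    have : Submodule.span ℂ (A ∪ A') ≤
        (Submodule.span ℂ (A ∪ A')).comap (Algebra.lmul ℂ (Uq C q) g) := by
      refine Submodule.span_le.2 ?_
      rintro s (hs | ⟨y, j, rfl⟩)
      · exact hg s hs
      · exact Submodule.subset_span (Or.inr ⟨g * y, j, by simp [mul_assoc]⟩)
    exact this hy
  have hsub : ∀ (a : WordSpace ι) (κ : Uq C q), κ ∈ torus C q →
      evalRev (f C q) a * κ ∈ Submodule.span ℂ (A ∪ A') := fun a κ hκ =>
    Submodule.subset_span (Or.inl ⟨a, κ, hκ, rfl⟩)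
  have h1 : (1 : Uq C q) ∈ Submodule.span ℂ (A ∪ A') := by
    simpa [evalRev_single] using hsub (Finsupp.single [] 1) 1 (Submonoid.one_mem _)
  have := map_mem_of_generators (Algebra.lmul ℂ (Uq C q)) (p := Submodule.span ℂ (A ∪ A'))
    (fun i => hmul _ ?_) (fun i => hmul _ ?_) (fun i => hmul _ ?_) (fun i => hmul _ ?_) x 1 h1
  · simpa using this
  · rintro _ ⟨a, κ, hκ, rfl⟩
    obtain ⟨s, hs⟩ := e_mul_torus hκ i
    rw [← mul_assoc, h.e_evalRev, sub_mul, add_mul, mul_assoc, hs, smul_mul_assoc, smul_mul_assoc,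
      mul_assoc, mul_assoc]
    refine Submodule.sub_mem _ (Submodule.add_mem _ (Submodule.subset_span (Or.inr
      ⟨s • (evalRev (f C q) a * κ), i, by simp [mul_assoc]⟩)) ?_) ?_
    · exact Submodule.smul_mem _ _ (hsub _ _ (Submonoid.mul_mem _ (hk i) hκ))
    · exact Submodule.smul_mem _ _ (hsub _ _ (Submonoid.mul_mem _ (hkInv i) hκ))
  · rintro _ ⟨a, κ, hκ, rfl⟩
    rw [← mul_assoc, ← evalRev_snoc]
    exact hsub _ _ hκ
  · rintro _ ⟨a, κ, hκ, rfl⟩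
    rw [← mul_assoc, h.k_evalRev, mul_assoc]
    exact hsub _ _ (Submonoid.mul_mem _ (hk i) hκ)
  · rintro _ ⟨a, κ, hκ, rfl⟩
    rw [← mul_assoc, h.kInv_evalRev, mul_assoc]
    exact hsub _ _ (Submonoid.mul_mem _ (hkInv i) hκ)

/-- A functional on `U` that behaves like a highest weight matrix coefficient is invariant under
the anti-automorphism `ω`. -/
theorem apply_omega_eq [DecidableEq ι] {ε : Uq C q →ₗ[ℂ] ℂ} (he : ∀ u j, ε (u * e C q j) = 0)
    (hf : ∀ u j, ε (f C q j * u) = 0) {μ : ι → ℂ} (hk : ∀ u j, ε (k C q j * u) = μ j * ε u)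
    (hk' : ∀ u j, ε (u * k C q j) = μ j * ε u)
    (hkInv : ∀ u j, ε (kInv C q j * u) = (μ j)⁻¹ * ε u)
    (hkInv' : ∀ u j, ε (u * kInv C q j) = (μ j)⁻¹ * ε u) (u : Uq C q) :
    ε (omega u).unop = ε u := by
  have h := isUqFamily (C := C) (q := q)
  have htorus : ∀ κ ∈ torus C q, ∃ c : ℂ, (∀ u, ε (κ * u) = c * ε u) ∧
      (∀ u, ε (u * κ) = c * ε u) ∧ (∀ u, ε ((omega κ).unop * u) = c * ε u) := by
    intro κ hκ
    induction hκ using Submonoid.closure_induction with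
    | mem x hx =>
      rcases hx with ⟨i, rfl⟩ | ⟨i, rfl⟩
      · exact ⟨μ i, fun u => hk u i, fun u => hk' u i, fun u => by rw [omega_k, hk]⟩
      · exact ⟨(μ i)⁻¹, fun u => hkInv u i, fun u => hkInv' u i, fun u => by
          rw [omega_kInv, hkInv]⟩
    | one => exact ⟨1, by simp, by simp, by simp⟩
    | mul x y _ _ hx hy =>
      obtain ⟨c, h1, h2, h3⟩ := hx
      obtain ⟨c', h1', h2', h3'⟩ := hy
      refine ⟨c * c', fun u => ?_, fun u => ?_, fun u => ?_⟩
      · rw [mul_assoc, h1, h1', mul_assoc]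
      · rw [← mul_assoc, h2', h2]; ring
      · rw [omega_mul, mul_assoc, h3', h3]; ring
  let φ : Uq C q →ₗ[ℂ] ℂ := ε ∘ₗ (MulOpposite.opLinearEquiv ℂ).symm.toLinearMap ∘ₗ
    (omega (C := C) (q := q)).toLinearMap
  have key : Submodule.span ℂ ({x | ∃ (a : WordSpace ι) (κ : Uq C q), κ ∈ torus C q ∧
      x = evalRev (f C q) a * κ} ∪ {x | ∃ y j, x = y * e C q j}) ≤ LinearMap.eqLocus φ ε := by
    refine Submodule.span_le.2 ?_
    rintro _ (⟨a, κ, hκ, rfl⟩ | ⟨y, j, rfl⟩)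
    · obtain ⟨c, h1, h2, h3⟩ := htorus κ hκ
      change ε (omega (evalRev (f C q) a * κ)).unop = ε (evalRev (f C q) a * κ)
      rw [omega_mul, h2, h3]
      congr 1
      refine LinearMap.congr_fun (f := φ ∘ₗ evalRev (f C q)) (g := ε ∘ₗ evalRev (f C q))
        (hom_ext fun w => ?_) a
      change ε (omega (evalRev (f C q) (Finsupp.single w 1))).unop =
        ε (evalRev (f C q) (Finsupp.single w 1))
      rcases List.eq_nil_or_concat w with rfl | ⟨w, j, rfl⟩
      · simp [evalRev_single]
      -- `ω` turns the leading `f_j` into a trailing `-q^{-h_j} e_j`, and `ε` kills both.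
      · rw [List.concat_eq_append, ← snoc_single, evalRev_snoc, hf, omega_mul, omega_f, mul_neg,
          map_neg, ← mul_assoc, he, neg_zero]
    · change ε (omega (y * e C q j)).unop = ε (y * e C q j)
      rw [he, omega_mul, omega_e, neg_mul, map_neg, mul_assoc, hf, neg_zero]
  exact key (triangular u)

end Uq

/-! ### Highest weight modules and Shapovalov forms. -/

namespace UqRep
variable {ι : Type*} {C : CartanDatum ι} {q : ℂˣ}
  {V : Type*} [AddCommGroup V] [Module ℂ V]

/-- The action of `e_α`. -/
noncomputable abbrev eEnd (ρ : UqRep C q V) (i : ι) : Module.End ℂ V := ρ (Uq.e C q i)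
/-- The action of `f_α`. -/
noncomputable abbrev fEnd (ρ : UqRep C q V) (i : ι) : Module.End ℂ V := ρ (Uq.f C q i)
/-- The action of `q^{h_α}`. -/
noncomputable abbrev kEnd (ρ : UqRep C q V) (i : ι) : Module.End ℂ V := ρ (Uq.k C q i)
/-- The action of `q^{-h_α}`. -/
noncomputable abbrev kInvEnd (ρ : UqRep C q V) (i : ι) : Module.End ℂ V := ρ (Uq.kInv C q i)

theorem isUqFamily (ρ : UqRep C q V) : IsUqFamily C q ρ.eEnd ρ.fEnd ρ.kEnd ρ.kInvEnd :=
  Uq.isUqFamily.map ρ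

/-- A vector that generates the module. -/
def IsGenerator (ρ : UqRep C q V) (v : V) : Prop := ∀ w : V, ∃ x : Uq C q, ρ x v = w

variable {ρ : UqRep C q V} {v₀ : V}

theorem IsGenerator.eq_top (hg : ρ.IsGenerator v₀) {p : Submodule ℂ V} (hv : v₀ ∈ p)
    (he : ∀ i, ∀ v ∈ p, ρ.eEnd i v ∈ p) (hf : ∀ i, ∀ v ∈ p, ρ.fEnd i v ∈ p)
    (hk : ∀ i, ∀ v ∈ p, ρ.kEnd i v ∈ p) (hkInv : ∀ i, ∀ v ∈ p, ρ.kInvEnd i v ∈ p) : p = ⊤ := by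
  refine (Submodule.eq_top_iff').2 fun w => ?_
  obtain ⟨x, rfl⟩ := hg w
  exact Uq.map_mem_of_generators ρ he hf hk hkInv x v₀ hv

section HighestWeight
variable {μ : ι → ℂ} (hg : ρ.IsGenerator v₀) (hμ : v₀ ∈ weightSpace ρ.kEnd μ)
  (he : ∀ i, ρ.eEnd i v₀ = 0)
include hg hμ he

theorem exists_evalRev_apply_eq (v : V) : ∃ a, evalRev ρ.fEnd a v₀ = v := by
  classical
  have h := ρ.isUqFamily
  let p : Submodule ℂ V := LinearMap.range ((LinearMap.applyₗ v₀) ∘ₗ evalRev ρ.fEnd)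
  have hp : p = ⊤ := by
    refine hg.eq_top ⟨Finsupp.single [] 1, by simp [evalRev_single]⟩ ?_ ?_ ?_ ?_
    · rintro i _ ⟨a, rfl⟩
      simp only [LinearMap.comp_apply, LinearMap.applyₗ_apply_apply]
      rw [← Module.End.mul_apply, h.e_evalRev]
      simp only [LinearMap.sub_apply, LinearMap.add_apply, LinearMap.smul_apply,
        Module.End.mul_apply, he, map_zero, zero_add, mem_weightSpace.1 hμ, h.kInv_apply hμ,
        map_smul]
      exact p.sub_mem (p.smul_mem _ (p.smul_mem _ ⟨_, rfl⟩)) (p.smul_mem _ (p.smul_mem _ ⟨_, rfl⟩))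
    · rintro i _ ⟨a, rfl⟩
      simp only [LinearMap.comp_apply, LinearMap.applyₗ_apply_apply]
      rw [← Module.End.mul_apply, ← evalRev_snoc]
      exact ⟨_, rfl⟩
    · rintro i _ ⟨a, rfl⟩
      simp only [LinearMap.comp_apply, LinearMap.applyₗ_apply_apply]
      rw [← Module.End.mul_apply, h.k_evalRev, Module.End.mul_apply, mem_weightSpace.1 hμ, map_smul]
      exact p.smul_mem _ ⟨_, rfl⟩
    · rintro i _ ⟨a, rfl⟩
      simp only [LinearMap.comp_apply, LinearMap.applyₗ_apply_apply]
      rw [← Module.End.mul_apply, h.kInv_evalRev, Module.End.mul_apply, h.kInv_apply hμ, map_smul]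
      exact p.smul_mem _ ⟨_, rfl⟩
  have : v ∈ p := hp ▸ Submodule.mem_top
  exact this

/-- The highest weight vector and the images of the `f_α` span a highest weight module. -/
theorem span_singleton_sup_range_f : (ℂ ∙ v₀) ⊔ ⨆ j, LinearMap.range (ρ.fEnd j) = ⊤ := by
  refine (Submodule.eq_top_iff').2 fun v => ?_
  obtain ⟨a, rfl⟩ := exists_evalRev_apply_eq hg hμ he v
  set p := (ℂ ∙ v₀) ⊔ ⨆ j, LinearMap.range (ρ.fEnd j)
  have : (p.mkQ ∘ₗ (LinearMap.applyₗ v₀) ∘ₗ evalRev ρ.fEnd) = 0 := hom_ext fun w => by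
    simp only [LinearMap.comp_apply, LinearMap.applyₗ_apply_apply, LinearMap.zero_apply,
      Submodule.mkQ_apply, Submodule.Quotient.mk_eq_zero]
    rcases List.eq_nil_or_concat w with rfl | ⟨w, j, rfl⟩
    · simpa [evalRev_single] using Submodule.mem_sup_left (Submodule.mem_span_singleton_self v₀)
    · rw [List.concat_eq_append, ← snoc_single, evalRev_snoc]
      exact Submodule.mem_sup_right (Submodule.mem_iSup_of_mem j ⟨_, rfl⟩)
  have h2 := LinearMap.congr_fun this a
  simpa only [LinearMap.comp_apply, LinearMap.applyₗ_apply_apply, LinearMap.zero_apply,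
      Submodule.mkQ_apply, Submodule.Quotient.mk_eq_zero] using h2

theorem iSup_weightSpace_eq_top : ⨆ ν, weightSpace ρ.kEnd ν = ⊤ := by
  have h := ρ.isUqFamily
  refine (Submodule.eq_top_iff').2 fun v => ?_
  obtain ⟨a, rfl⟩ := exists_evalRev_apply_eq hg hμ he v
  set p := ⨆ ν, weightSpace ρ.kEnd ν
  have hw : ∀ w : List ι, ∃ ν, (w.map ρ.fEnd).prod v₀ ∈ weightSpace ρ.kEnd ν := by
    intro w
    induction w with
    | nil => exact ⟨μ, by simpa using hμ⟩
    | cons j w ih =>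
      obtain ⟨ν, hν⟩ := ih
      exact ⟨_, by simpa using h.f_mem_weightSpace hν j⟩
  have : (p.mkQ ∘ₗ (LinearMap.applyₗ v₀) ∘ₗ evalRev ρ.fEnd) = 0 := hom_ext fun w => by
    simp only [LinearMap.comp_apply, LinearMap.applyₗ_apply_apply, LinearMap.zero_apply,
      Submodule.mkQ_apply, Submodule.Quotient.mk_eq_zero, evalRev_single]
    obtain ⟨ν, hν⟩ := hw w.reverse
    exact Submodule.mem_iSup_of_mem ν hν
  have h2 := LinearMap.congr_fun this a
  simpa only [LinearMap.comp_apply, LinearMap.applyₗ_apply_apply, LinearMap.zero_apply,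
      Submodule.mkQ_apply, Submodule.Quotient.mk_eq_zero] using h2

omit hg hμ he in
/-- The vectors killed by the radical of the form. -/
noncomputable def radicalKernel [DecidableEq ι] (ρ : UqRep C q V) : Submodule ℂ V :=
  ⨅ x : radical C q, LinearMap.ker (eval (IsUqFamily.twistedE q ρ.eEnd ρ.kInvEnd) x)

omit hg hμ he in
theorem mem_radicalKernel [DecidableEq ι] {v : V} : v ∈ ρ.radicalKernel ↔
    ∀ x ∈ radical C q, eval (IsUqFamily.twistedE q ρ.eEnd ρ.kInvEnd) x v = 0 := by
  simp [radicalKernel, Submodule.mem_iInf]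

omit hg hμ he in
theorem kInv_mem_radicalKernel [DecidableEq ι] (i : ι) {v : V} (hv : v ∈ ρ.radicalKernel) :
    ρ.kInvEnd i v ∈ ρ.radicalKernel := by
  refine mem_radicalKernel.2 fun x hx => ?_
  have h1 := ρ.isUqFamily.kInv_eval i (twist (qForm C q i) x)
  rw [twist_twist_inv _ _ (qFormInv_mul C q i)] at h1
  rw [← Module.End.mul_apply, ← h1, Module.End.mul_apply,
    mem_radicalKernel.1 hv _ (twist_mem_radical hx _), map_zero]

omit hg hμ he in
theorem k_mem_radicalKernel [DecidableEq ι] (i : ι) {v : V} (hv : v ∈ ρ.radicalKernel) :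
    ρ.kEnd i v ∈ ρ.radicalKernel := by
  refine mem_radicalKernel.2 fun x hx => ?_
  have h1 := ρ.isUqFamily.k_eval i (twist (qFormInv C q i) x)
  rw [twist_twist_inv _ _ (qForm_mul_inv C q i)] at h1
  rw [← Module.End.mul_apply, ← h1, Module.End.mul_apply,
    mem_radicalKernel.1 hv _ (twist_mem_radical hx _), map_zero]

omit hg hμ he in
theorem e_mem_radicalKernel [DecidableEq ι] (hq : qInvDiff q ≠ 0) (i : ι) {v : V}
    (hv : v ∈ ρ.radicalKernel) : ρ.eEnd i v ∈ ρ.radicalKernel := by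
  have h1 : ρ.eEnd i v = ρ.kEnd i ((-qInvDiff q) •
      IsUqFamily.twistedE q ρ.eEnd ρ.kInvEnd i v) := by
    rw [IsUqFamily.twistedE, LinearMap.smul_apply, smul_smul, neg_mul_neg, mul_inv_cancel₀ hq,
      one_smul, ← Module.End.mul_apply, ← mul_assoc, ρ.isUqFamily.k_kInv, one_mul]
  rw [h1]
  refine k_mem_radicalKernel i (Submodule.smul_mem _ _ (mem_radicalKernel.2 fun x hx => ?_))
  rw [← Module.End.mul_apply, ← eval_snoc, mem_radicalKernel.1 hv _ (snoc_mem_radical hx i)]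

-- By `eval_f`, a radical element moved past `f_i` becomes a combination of its twists and skew
-- derivatives, which are again in the radical.
omit hg hμ he in
theorem f_mem_radicalKernel [DecidableEq ι] (hq : qInvDiff q ≠ 0) (i : ι) {v : V}
    (hv : v ∈ ρ.radicalKernel) : ρ.fEnd i v ∈ ρ.radicalKernel := by
  refine mem_radicalKernel.2 fun x hx => ?_
  rw [← Module.End.mul_apply, ρ.isUqFamily.eval_f hq, LinearMap.add_apply, LinearMap.sub_apply,
    Module.End.mul_apply, Module.End.mul_apply, mem_radicalKernel.1 hv _ (twist_mem_radical hx _),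
    mem_radicalKernel.1 hv _ (twist_mem_radical (leftDeriv_mem_radical hx i) _), map_zero,
    sub_zero, zero_add, Module.End.mul_apply]
  exact mem_radicalKernel.1 (kInv_mem_radicalKernel i (kInv_mem_radicalKernel i hv)) _
    (rightDeriv_mem_radical hx i)

-- Radical elements have no constant term, so they kill `v₀`, and the vectors they kill form a
-- submodule. No set of generators of the radical is needed.
omit hμ in
theorem radicalKernel_eq_top [DecidableEq ι] (hq : qInvDiff q ≠ 0) : ρ.radicalKernel = ⊤ := by
  refine hg.eq_top (mem_radicalKernel.2 fun x hx => ?_)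
    (fun i v => e_mem_radicalKernel hq i) (fun i v => f_mem_radicalKernel hq i)
    (fun i v => k_mem_radicalKernel i) (fun i v => kInv_mem_radicalKernel i)
  have : (LinearMap.applyₗ v₀) ∘ₗ eval (IsUqFamily.twistedE q ρ.eEnd ρ.kInvEnd) =
      LinearMap.toSpanSingleton ℂ V v₀ ∘ₗ Finsupp.lapply [] := hom_ext fun w => by
    rcases List.eq_nil_or_concat w with rfl | ⟨w, j, rfl⟩
    · simp [eval_single]
    · simp only [LinearMap.comp_apply, LinearMap.applyₗ_apply_apply]
      rw [List.concat_eq_append, ← snoc_single, eval_snoc]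
      simp [IsUqFamily.twistedE, he]
  have h2 := LinearMap.congr_fun this x
  simpa [apply_nil_of_mem_radical hx] using h2

/-- The images of the `f_α` are spanned by eigenvectors of the height operator `K` with eigenvalues
`a ^ (-t) * b`, `t > 0`, all different from the eigenvalue `b` of `v₀`. -/
theorem notMem_iSup_range_f [Fintype ι] (hC : C.HasGrading) (hq : ¬ IsOfFinOrder q)
    (hv₀ : v₀ ≠ 0) : v₀ ∉ ⨆ j, LinearMap.range (ρ.fEnd j) := by
  obtain ⟨K, a, ha, -, hKf, -, hKv⟩ := ρ.isUqFamily.exists_grading hC hq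
  obtain ⟨b, hb, hbv⟩ := hKv μ v₀ hμ hv₀
  have heig : ∀ w : List ι, K ((w.map ρ.fEnd).prod v₀) =
      (((a⁻¹ ^ w.length : ℂˣ) : ℂ) * b) • (w.map ρ.fEnd).prod v₀ := by
    intro w
    induction w with
    | nil => simp [hbv]
    | cons i w ih =>
      rw [List.map_cons, List.prod_cons, Module.End.mul_apply, ← Module.End.mul_apply, hKf,
        LinearMap.smul_apply, Module.End.mul_apply, ih, map_smul, smul_smul, List.length_cons,
        pow_succ', Units.val_mul, mul_assoc]
  have hle : (⨆ j, LinearMap.range (ρ.fEnd j)) ≤ ⨆ c, ⨆ _ : c ≠ b, K.eigenspace c := by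
    refine iSup_le fun j => ?_
    rintro _ ⟨v, rfl⟩
    obtain ⟨x, rfl⟩ := exists_evalRev_apply_eq hg hμ he v
    set p := ⨆ c, ⨆ _ : c ≠ b, K.eigenspace c
    have : (p.mkQ ∘ₗ ρ.fEnd j ∘ₗ (LinearMap.applyₗ v₀) ∘ₗ evalRev ρ.fEnd) = 0 :=
      hom_ext fun w => by
      simp only [LinearMap.comp_apply, LinearMap.applyₗ_apply_apply, LinearMap.zero_apply,
        Submodule.mkQ_apply, Submodule.Quotient.mk_eq_zero, evalRev_single]
      have h3 := heig (j :: w.reverse)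
      rw [List.map_cons, List.prod_cons, Module.End.mul_apply] at h3
      refine Submodule.mem_iSup_of_mem _ (Submodule.mem_iSup_of_mem ?_
        (Module.End.mem_eigenspace_iff.2 h3))
      intro h4
      have h5 : a⁻¹ ^ (j :: w.reverse).length = 1 := Units.ext (mul_right_cancel₀ hb (by simpa using h4))
      refine ha (isOfFinOrder_inv_iff.1 (isOfFinOrder_iff_pow_eq_one.2 ⟨_, by simp, h5⟩))
    have h2 := LinearMap.congr_fun this x
    simpa only [LinearMap.comp_apply, LinearMap.applyₗ_apply_apply, LinearMap.zero_apply,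
      Submodule.mkQ_apply, Submodule.Quotient.mk_eq_zero] using h2
  intro hmem
  have hdisj := (Module.End.eigenspaces_iSupIndep K) b
  exact hv₀ (Submodule.disjoint_def.1 hdisj v₀ (Module.End.mem_eigenspace_iff.2 hbv) (hle hmem))

/-- The highest weight functional. -/
theorem exists_highestWeight_functional [Fintype ι] (hC : C.HasGrading) (hq : ¬ IsOfFinOrder q)
    (hv₀ : v₀ ≠ 0) : ∃ φ : V →ₗ[ℂ] ℂ, φ v₀ = 1 ∧ (∀ j v, φ (ρ.fEnd j v) = 0) ∧
      (∀ j v, φ (ρ.kEnd j v) = μ j * φ v) ∧ ∀ j v, φ (ρ.kInvEnd j v) = (μ j)⁻¹ * φ v := by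
  have h := ρ.isUqFamily
  obtain ⟨φ, hφ, hφ'⟩ := Submodule.exists_dual_map_eq_bot_of_notMem
    (notMem_iSup_range_f hg hμ he hC hq hv₀) inferInstance
  have hf : ∀ j v, φ (ρ.fEnd j v) = 0 := fun j v => by
    have : φ (ρ.fEnd j v) ∈ (⨆ j, LinearMap.range (ρ.fEnd j)).map φ :=
      ⟨_, Submodule.mem_iSup_of_mem j ⟨v, rfl⟩, rfl⟩
    rwa [hφ', Submodule.mem_bot] at this
  have key : ∀ (g : Module.End ℂ V) (c : ℂ), g v₀ = c • v₀ →
      (∀ j v, φ (g (ρ.fEnd j v)) = 0) → ∀ v, φ (g v) = c * φ v := by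
    intro g c hg0 hgf v
    -- Both functionals vanish on the images of the `f_α`, and with `v₀` these span the module.
    have hle : (⊤ : Submodule ℂ V) ≤ LinearMap.eqLocus (φ ∘ₗ g) (c • φ) := by
      rw [← span_singleton_sup_range_f hg hμ he]
      refine sup_le ?_ (iSup_le fun j => ?_)
      · rw [Submodule.span_singleton_le_iff_mem]
        simp [hg0]
      · rintro _ ⟨v, rfl⟩
        simp [hf, hgf]
    exact hle (Submodule.mem_top (x := v))
  have hk : ∀ j v, φ (ρ.kEnd j v) = μ j * φ v := fun j =>
    key _ _ (mem_weightSpace.1 hμ j) fun i v => by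
      rw [← Module.End.mul_apply, h.k_f, LinearMap.smul_apply, map_smul, Module.End.mul_apply, hf,
        smul_zero]
  have hkInv : ∀ j v, φ (ρ.kInvEnd j v) = (μ j)⁻¹ * φ v := fun j =>
    key _ _ (h.kInv_apply hμ j) fun i v => by
      rw [← Module.End.mul_apply, h.kInv_f, LinearMap.smul_apply, map_smul, Module.End.mul_apply,
        hf, smul_zero]
  refine ⟨(φ v₀)⁻¹ • φ, by simp [hφ], fun j v => by simp [hf], fun j v => ?_, fun j v => ?_⟩
  · rw [LinearMap.smul_apply, LinearMap.smul_apply, hk, smul_eq_mul, smul_eq_mul]; ring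
  · rw [LinearMap.smul_apply, LinearMap.smul_apply, hkInv, smul_eq_mul, smul_eq_mul]; ring

/-- The form `β(x, y) = φ(ω(x) y v₀)` on the algebra is symmetric because `ε(x) = φ(x v₀)` is
`ω`-invariant. It depends on `y` only through `y v₀`, hence by symmetry on `x` only through `x v₀`,
and so descends to the module. -/
theorem exists_shapovalov [Fintype ι] (hC : C.HasGrading) (hq : ¬ IsOfFinOrder q)
    (hv₀ : v₀ ≠ 0) : ∃ B, ρ.IsShapovalovForm B := by
  classical
  obtain ⟨φ, hφ, hf, hk, hkInv⟩ := exists_highestWeight_functional hg hμ he hC hq hv₀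
  let π : Uq C q →ₗ[ℂ] V := LinearMap.applyₗ v₀ ∘ₗ ρ.toLinearMap
  have hπ : ∀ x, π x = ρ x v₀ := fun _ => rfl
  let ε : Uq C q →ₗ[ℂ] ℂ := φ ∘ₗ π
  have hε : ∀ x y, ε (x * y) = φ (ρ x (ρ y v₀)) := fun x y => by
    change φ (ρ (x * y) v₀) = _
    rw [map_mul, Module.End.mul_apply]
  have hε1 : ∀ x, ε x = φ (ρ x v₀) := fun _ => rfl
  have hεω : ∀ u, ε (Uq.omega u).unop = ε u := by
    refine Uq.apply_omega_eq (μ := μ) (fun u j => ?_) (fun u j => ?_) (fun u j => ?_)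
      (fun u j => ?_) (fun u j => ?_) (fun u j => ?_)
    · rw [hε, he, map_zero, map_zero]
    · rw [hε, hf]
    · rw [hε, hk, hε1]
    · rw [hε, mem_weightSpace.1 hμ, map_smul, map_smul, hε1, smul_eq_mul]
    · rw [hε, hkInv, hε1]
    · rw [hε, ρ.isUqFamily.kInv_apply hμ, map_smul, map_smul, hε1, smul_eq_mul]
  let β : Uq C q →ₗ[ℂ] Uq C q →ₗ[ℂ] ℂ :=
    (LinearMap.mul ℂ (Uq C q)).compr₂ ε ∘ₗ (MulOpposite.opLinearEquiv ℂ).symm.toLinearMap ∘ₗ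
      (Uq.omega (C := C) (q := q)).toLinearMap
  have hβ : ∀ x y, β x y = ε ((Uq.omega x).unop * y) := fun _ _ => rfl
  have hβs : ∀ x y, β x y = β y x := fun x y => by
    rw [hβ, ← hεω, Uq.omega_mul, Uq.omega_omega, hβ]
  have hβπ : ∀ x y y', π y = π y' → β x y = β x y' := fun x y y' hy => by
    rw [hβ, hβ, hε, hε, ← hπ, hy, hπ]
  have hsurj : Function.Surjective π := hg
  obtain ⟨s, hs⟩ := π.exists_rightInverse_of_surjective (LinearMap.range_eq_top.2 hsurj)
  have hs' : ∀ v, π (s v) = v := fun v => LinearMap.congr_fun hs v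
  have hB : ∀ x y, β (s (π x)) (s (π y)) = β x y := fun x y => by
    rw [hβπ _ _ y (hs' _), hβs, hβπ _ _ x (hs' _), hβs]
  refine ⟨β.compl₁₂ s s, ⟨⟨fun v w => hβs _ _⟩, fun x v w => ?_⟩, fun h0 => ?_⟩
  · obtain ⟨a, rfl⟩ := hsurj v
    obtain ⟨b, rfl⟩ := hsurj w
    have h1 : ∀ x a, ρ x (π a) = π (x * a) := fun x a => by
      rw [hπ, hπ, map_mul, Module.End.mul_apply]
    simp only [LinearMap.compl₁₂_apply, h1, hB]
    rw [hβ, hβ, Uq.omega_mul, mul_assoc]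
  · have h1 := LinearMap.congr_fun (LinearMap.congr_fun h0 v₀) v₀
    have h2 : π 1 = v₀ := by simp [hπ]
    rw [← h2, LinearMap.compl₁₂_apply, hB, hβ] at h1
    simp [hε1, hφ] at h1

end HighestWeight

/-- Contravariance makes the kernel of the form a submodule. -/
theorem IsShapovalovForm.nondegenerate {B : LinearMap.BilinForm ℂ V} (hB : ρ.IsShapovalovForm B)
    (hirr : ρ.IsIrreducible) : B.Nondegenerate := by
  refine nondegenerate_of_isSymm hB.1.1 fun v hv => ?_
  rcases hirr.2 (LinearMap.ker B) fun x w hw => LinearMap.mem_ker.2 (LinearMap.ext fun w' => by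
    rw [hB.1.2, LinearMap.mem_ker.1 hw]; rfl) with h | h
  · have : v ∈ LinearMap.ker B := LinearMap.mem_ker.2 (LinearMap.ext hv)
    rwa [h, Submodule.mem_bot] at this
  · exact absurd (LinearMap.ker_eq_top.1 h) hB.2

end UqRep

/-! ### Tensor products of forms and of modules. -/

theorem tmul_tmul_tmul {V Z : Type*} [AddCommGroup V] [Module ℂ V] [AddCommGroup Z] [Module ℂ Z]
    (B : LinearMap.BilinForm ℂ V) (B' : LinearMap.BilinForm ℂ Z) (v v' : V) (z z' : Z) :
    LinearMap.BilinForm.tmul B B' (v ⊗ₜ z) (v' ⊗ₜ z') = B v v' * B' z z' := by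
  rw [LinearMap.BilinForm.tmul, LinearMap.BilinForm.tensorDistrib_tmul, smul_eq_mul, mul_comm]

theorem isSymm_tmul {V Z : Type*} [AddCommGroup V] [Module ℂ V] [AddCommGroup Z] [Module ℂ Z]
    {B : LinearMap.BilinForm ℂ V} {B' : LinearMap.BilinForm ℂ Z} (hs : B.IsSymm)
    (hs' : B'.IsSymm) : LinearMap.BilinForm.IsSymm (LinearMap.BilinForm.tmul B B') := by
  refine ⟨fun x y => ?_⟩
  induction x with
  | zero => simp
  | add a b ha hb => simp only [map_add, LinearMap.add_apply, ha, hb]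
  | tmul v z =>
    induction y with
    | zero => simp
    | add a b ha hb => simp only [map_add, LinearMap.add_apply, ha, hb]
    | tmul v' z' => rw [tmul_tmul_tmul, tmul_tmul_tmul, hs.eq, hs'.eq]

theorem nondegenerate_tmul {V Z : Type*} [AddCommGroup V] [Module ℂ V] [FiniteDimensional ℂ V]
    [AddCommGroup Z] [Module ℂ Z] [FiniteDimensional ℂ Z] {B : LinearMap.BilinForm ℂ V}
    {B' : LinearMap.BilinForm ℂ Z} (hB : B.Nondegenerate) (hB' : B'.Nondegenerate)
    (hs : B.IsSymm) (hs' : B'.IsSymm) : (LinearMap.BilinForm.tmul B B').Nondegenerate := by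
  classical
  refine nondegenerate_of_isSymm (isSymm_tmul hs hs') fun x hx => ?_
  let b := Module.finBasis ℂ V
  let b' := Module.finBasis ℂ Z
  refine (b.tensorProduct b').repr.map_eq_zero_iff.1 (Finsupp.ext fun p => ?_)
  -- Pairing with the product of dual basis vectors reads off the coordinate of `x` at `p`.
  have h1 := hx (B.dualBasis hB b p.1 ⊗ₜ B'.dualBasis hB' b' p.2)
  rw [← (b.tensorProduct b').sum_repr x, map_sum, LinearMap.sum_apply,
    Finset.sum_eq_single p] at h1
  · simpa [Module.Basis.tensorProduct_apply', tmul_tmul_tmul,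
        LinearMap.BilinForm.apply_dualBasis_right, hs, hs'] using h1
  · intro p' _ hp'
    have : p'.1 ≠ p.1 ∨ p'.2 ≠ p.2 := by
      by_contra hcon
      push Not at hcon
      exact hp' (Prod.ext hcon.1 hcon.2)
    rcases this with h | h <;>
      simp [Module.Basis.tensorProduct_apply',
        LinearMap.BilinForm.apply_dualBasis_right, hs, hs', h]
  · simp

namespace UqRep
variable {ι : Type*} {C : CartanDatum ι} {q : ℂˣ}
  {V : Type*} [AddCommGroup V] [Module ℂ V] {Z : Type*} [AddCommGroup Z] [Module ℂ Z]
  (ρ : UqRep C q V) (τ : UqRep C q Z)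

theorem tensor_e (i : ι) (v : V) (z : Z) : (ρ.tensor τ).eEnd i (v ⊗ₜ z) =
    ρ.eEnd i v ⊗ₜ τ.kEnd i z + v ⊗ₜ τ.eEnd i z := by
  simp [eEnd, tensor, Uq.comul, Module.endTensorEndAlgHom_apply]

theorem tensor_f (i : ι) (v : V) (z : Z) : (ρ.tensor τ).fEnd i (v ⊗ₜ z) =
    ρ.fEnd i v ⊗ₜ z + ρ.kInvEnd i v ⊗ₜ τ.fEnd i z := by
  simp [fEnd, tensor, Uq.comul, Module.endTensorEndAlgHom_apply]

theorem tensor_k (i : ι) (v : V) (z : Z) : (ρ.tensor τ).kEnd i (v ⊗ₜ z) =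
    ρ.kEnd i v ⊗ₜ τ.kEnd i z := by
  simp [kEnd, tensor, Uq.comul, Module.endTensorEndAlgHom_apply]

theorem tensor_kInv (i : ι) (v : V) (z : Z) : (ρ.tensor τ).kInvEnd i (v ⊗ₜ z) =
    ρ.kInvEnd i v ⊗ₜ τ.kInvEnd i z := by
  simp [kInvEnd, tensor, Uq.comul, Module.endTensorEndAlgHom_apply]

variable {ρ τ}

theorem tensor_iSup_weightSpace_eq_top (hV : ⨆ μ, weightSpace ρ.kEnd μ = ⊤)
    (hZ : ⨆ μ, weightSpace τ.kEnd μ = ⊤) : ⨆ μ, weightSpace (ρ.tensor τ).kEnd μ = ⊤ := by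
  set p := ⨆ μ, weightSpace (ρ.tensor τ).kEnd μ
  have h1 : (TensorProduct.mk ℂ V Z).compr₂ p.mkQ = 0 := by
    refine eq_of_eqOn_weightSpace hV fun μ v hv => eq_of_eqOn_weightSpace hZ fun ν z hz => ?_
    simp only [LinearMap.compr₂_apply, TensorProduct.mk_apply, LinearMap.zero_apply,
      Submodule.mkQ_apply, Submodule.Quotient.mk_eq_zero]
    refine Submodule.mem_iSup_of_mem (fun i => μ i * ν i) (mem_weightSpace.2 fun i => ?_)
    rw [tensor_k, mem_weightSpace.1 hv, mem_weightSpace.1 hz, TensorProduct.smul_tmul_smul]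
  rw [← Submodule.ker_mkQ p, LinearMap.ker_eq_top]
  exact TensorProduct.ext h1

/-- On `v₀ ⊗ Z` the `e_α` act, up to rescaling, on the second factor alone, so the radical kills
these vectors. The remaining `v ⊗ z` follow by applying `f_j` to the left factor. -/
theorem tensor_radicalKernel_eq_top [DecidableEq ι] (hq : qInvDiff q ≠ 0) {v₀ : V} {μ : ι → ℂ}
    (hg : ρ.IsGenerator v₀) (hμ : v₀ ∈ weightSpace ρ.kEnd μ) (he : ∀ i, ρ.eEnd i v₀ = 0)
    (hτ : τ.radicalKernel = ⊤) : (ρ.tensor τ).radicalKernel = ⊤ := by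
  have h := ρ.isUqFamily
  let E := IsUqFamily.twistedE q τ.eEnd τ.kInvEnd
  let E' := IsUqFamily.twistedE q (ρ.tensor τ).eEnd (ρ.tensor τ).kInvEnd
  have hE : ∀ j z, E' j (v₀ ⊗ₜ z) = (μ j)⁻¹ • (v₀ ⊗ₜ[ℂ] E j z) := fun j z => by
    simp only [E, E', IsUqFamily.twistedE, LinearMap.smul_apply, Module.End.mul_apply, tensor_e, he,
      TensorProduct.zero_tmul, zero_add, tensor_kInv, h.kInv_apply hμ, TensorProduct.tmul_smul,
      TensorProduct.smul_tmul']
    rw [smul_comm]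
  have hEx : ∀ x z, eval E' x (v₀ ⊗ₜ z) = v₀ ⊗ₜ[ℂ] eval E (twist (fun j => (μ j)⁻¹) x) z := by
    intro x z
    refine LinearMap.congr_fun (f := LinearMap.applyₗ (v₀ ⊗ₜ[ℂ] z) ∘ₗ eval E')
      (g := TensorProduct.mk ℂ V Z v₀ ∘ₗ LinearMap.applyₗ z ∘ₗ eval E ∘ₗ twist _)
      (hom_ext fun w => ?_) x
    induction w with
    | nil => simp [eval_single]
    | cons j w ih =>
      simp only [LinearMap.comp_apply, LinearMap.applyₗ_apply_apply, TensorProduct.mk_apply] at ih ⊢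
      rw [← cons_single, eval_cons, Module.End.mul_apply, ih, hE, twist_cons, map_smul, eval_cons,
        LinearMap.smul_apply, TensorProduct.tmul_smul, Module.End.mul_apply]
  have h0 : ∀ z, v₀ ⊗ₜ z ∈ (ρ.tensor τ).radicalKernel := fun z =>
    mem_radicalKernel.2 fun x hx => by
      have h2 : z ∈ τ.radicalKernel := hτ ▸ Submodule.mem_top
      have h1 := mem_radicalKernel.1 h2 _ (twist_mem_radical hx fun j => (μ j)⁻¹)
      rw [hEx, h1, TensorProduct.tmul_zero]
  have hw : ∀ (w : List ι), ∃ ν, (w.map ρ.fEnd).prod v₀ ∈ weightSpace ρ.kEnd ν ∧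
      ∀ z, (w.map ρ.fEnd).prod v₀ ⊗ₜ z ∈ (ρ.tensor τ).radicalKernel := by
    intro w
    induction w with
    | nil => exact ⟨μ, by simpa using hμ, by simpa using h0⟩
    | cons j w ih =>
      obtain ⟨ν, hν, hz⟩ := ih
      refine ⟨_, by simpa using h.f_mem_weightSpace hν j, fun z => ?_⟩
      -- For `v` of weight `ν`, `(f_j v) ⊗ z = f_j (v ⊗ z) - ν_j⁻¹ v ⊗ f_j z`.
      have h3 := (ρ.tensor τ).radicalKernel.sub_mem (f_mem_radicalKernel hq j (hz z))
        (((ρ.tensor τ).radicalKernel).smul_mem (ν j)⁻¹ (hz (τ.fEnd j z)))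
      rwa [tensor_f, h.kInv_apply hν, TensorProduct.smul_tmul', add_sub_cancel_right] at h3
  refine top_le_iff.1 ?_
  rw [← TensorProduct.span_tmul_eq_top ℂ V Z, Submodule.span_le]
  rintro _ ⟨v, z, rfl⟩
  obtain ⟨a, rfl⟩ := exists_evalRev_apply_eq hg hμ he v
  have h4 : (ρ.tensor τ).radicalKernel.mkQ ∘ₗ (TensorProduct.mk ℂ V Z).flip z ∘ₗ
      LinearMap.applyₗ v₀ ∘ₗ evalRev ρ.fEnd = 0 := hom_ext fun w => by
    simp only [LinearMap.comp_apply, LinearMap.applyₗ_apply_apply, LinearMap.zero_apply,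
      Submodule.mkQ_apply, Submodule.Quotient.mk_eq_zero, evalRev_single, LinearMap.flip_apply,
      TensorProduct.mk_apply]
    obtain ⟨ν, -, h5⟩ := hw w.reverse
    exact h5 z
  have h6 := LinearMap.congr_fun h4 a
  rw [SetLike.mem_coe]
  simpa only [LinearMap.comp_apply, LinearMap.applyₗ_apply_apply, LinearMap.zero_apply,
    Submodule.mkQ_apply, Submodule.Quotient.mk_eq_zero, LinearMap.flip_apply,
    TensorProduct.mk_apply] using h6

/-- In `Δ(q^{-h} e)` the factors `q^{-h}` and `q^h` cancel in the first term, leaving `q^{-h} e ⊗ 1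
+ q^{-h} ⊗ q^{-h} e`, which matches `Δ(f)` termwise since `q^{-h}` is self-adjoint. -/
theorem tensor_contravariant_f {B : LinearMap.BilinForm ℂ V} {B' : LinearMap.BilinForm ℂ Z}
    (hB : ρ.IsContravariant B) (hB' : τ.IsContravariant B') (i : ι) (m m' : V ⊗[ℂ] Z) :
    LinearMap.BilinForm.tmul B B' ((ρ.tensor τ).fEnd i m) m' =
      -LinearMap.BilinForm.tmul B B' m ((ρ.tensor τ).kInvEnd i ((ρ.tensor τ).eEnd i m')) := by
  have hf : ∀ v w, B (ρ.fEnd i v) w = -B v (ρ.kInvEnd i (ρ.eEnd i w)) := fun v w => by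
    rw [fEnd, hB.2, Uq.omega_f]; simp
  have hf' : ∀ v w, B' (τ.fEnd i v) w = -B' v (τ.kInvEnd i (τ.eEnd i w)) := fun v w => by
    rw [fEnd, hB'.2, Uq.omega_f]; simp
  have hk : ∀ v w, B (ρ.kInvEnd i v) w = B v (ρ.kInvEnd i w) := fun v w => by
    rw [kInvEnd, hB.2, Uq.omega_kInv]
  induction m with
  | zero => simp
  | add a b ha hb => simp only [map_add, LinearMap.add_apply, ha, hb, neg_add]
  | tmul v z =>
    induction m' with
    | zero => simp
    | add a b ha hb => simp only [map_add, ha, hb, neg_add]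
    | tmul v' z' =>
      have h1 : τ.kInvEnd i (τ.kEnd i z') = z' := by
        rw [← Module.End.mul_apply, τ.isUqFamily.kInv_k, Module.End.one_apply]
      rw [tensor_f, tensor_e]
      simp only [map_add, LinearMap.add_apply, tensor_kInv, tmul_tmul_tmul, hf, hf', hk, h1]
      ring

end UqRep

theorem CartanDatum.ofBase_hasGrading {𝔤 : Type*} [LieRing 𝔤] [LieAlgebra ℂ 𝔤]
    [FiniteDimensional ℂ 𝔤] [LieAlgebra.IsSemisimple ℂ 𝔤] {𝔥 : LieSubalgebra ℂ 𝔤}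
    [𝔥.IsCartanSubalgebra] (Pi : (LieAlgebra.IsKilling.rootSystem 𝔥).Base)
    (d : Pi.support → ℕ) (hd : ∀ i, 0 < d i)
    (hsymm : ∀ i j, (d i : ℤ) * Pi.cartanMatrix j i = (d j : ℤ) * Pi.cartanMatrix i j) :
    (CartanDatum.ofBase Pi d hd hsymm).HasGrading := by
  classical
  refine CartanDatum.hasGrading_of_det_ne_zero _ ?_
  change Pi.cartanMatrix.transpose.det ≠ 0
  rw [Matrix.det_transpose, ← Matrix.nondegenerate_iff_det_ne_zero]
  exact Pi.cartanMatrix_nondegenerate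

end QuantumGroup

/-! ### The main theorem. -/

theorem mainTheorem5
    {𝔤 : Type*} [LieRing 𝔤] [LieAlgebra ℂ 𝔤] [FiniteDimensional ℂ 𝔤]
    [LieAlgebra.IsSemisimple ℂ 𝔤]
    (𝔥 : LieSubalgebra ℂ 𝔤) [𝔥.IsCartanSubalgebra]
    (Pi : (LieAlgebra.IsKilling.rootSystem 𝔥).Base)
    (d : Pi.support → ℕ) (hd : ∀ i, 0 < d i)
    (hsymm : ∀ i j, (d i : ℤ) * Pi.cartanMatrix j i = (d j : ℤ) * Pi.cartanMatrix i j)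
    (q : ℂˣ) (hq : ¬ IsOfFinOrder q)
    {V : Type*} [AddCommGroup V] [Module ℂ V] [FiniteDimensional ℂ V]
    {Z : Type*} [AddCommGroup Z] [Module ℂ Z] [FiniteDimensional ℂ Z]
    (ρ : UqRep (CartanDatum.ofBase Pi d hd hsymm) q V)
    (τ : UqRep (CartanDatum.ofBase Pi d hd hsymm) q Z)
    (hρ : ρ.IsHighestWeight) (hρ_irr : ρ.IsIrreducible)
    (hτ : τ.IsHighestWeight) (hτ_irr : τ.IsIrreducible) :
    (∃ B : LinearMap.BilinForm ℂ (TensorProduct ℂ V Z), ρ.IsCanonicalForm τ B) ∧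
      ∀ B : LinearMap.BilinForm ℂ (TensorProduct ℂ V Z), ρ.IsCanonicalForm τ B →
        (B.restrict (ρ.tensor τ).singularSpace).Nondegenerate := by
  classical
  have hC := CartanDatum.ofBase_hasGrading Pi d hd hsymm
  have hq' := qInvDiff_ne_zero hq
  obtain ⟨v₀, ⟨hv₀, ⟨μ, hμ⟩, hev⟩, hgv⟩ := hρ
  obtain ⟨z₀, ⟨hz₀, ⟨ν, hν⟩, hez⟩, hgz⟩ := hτ
  replace hμ : v₀ ∈ weightSpace ρ.kEnd μ := mem_weightSpace.2 hμ
  replace hν : z₀ ∈ weightSpace τ.kEnd ν := mem_weightSpace.2 hν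
  obtain ⟨B₁, hB₁⟩ := UqRep.exists_shapovalov hgv hμ hev hC hq hv₀
  obtain ⟨B₂, hB₂⟩ := UqRep.exists_shapovalov hgz hν hez hC hq hz₀
  refine ⟨⟨_, B₁, B₂, hB₁, hB₂, rfl⟩, ?_⟩
  rintro _ ⟨B, B', hB, hB', rfl⟩
  have hM := UqRep.tensor_iSup_weightSpace_eq_top (UqRep.iSup_weightSpace_eq_top hgv hμ hev)
    (UqRep.iSup_weightSpace_eq_top hgz hν hez)
  have hrad := UqRep.tensor_radicalKernel_eq_top hq' hgv hμ hev
    (UqRep.radicalKernel_eq_top hgz hez hq')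
  have hs := isSymm_tmul hB.1.1 hB'.1.1
  have hnd := nondegenerate_tmul (hB.nondegenerate hρ_irr) (hB'.nondegenerate hτ_irr)
    hB.1.1 hB'.1.1
  have hfam := (ρ.tensor τ).isUqFamily
  refine nondegenerate_of_isSymm ⟨fun v w => hs.eq _ _⟩ fun v hv => Subtype.ext ?_
  have hle : (ρ.tensor τ).singularSpace ≤ ⨅ j, LinearMap.ker ((ρ.tensor τ).eEnd j) :=
    Submodule.span_le.2 fun w hw => Submodule.mem_iInf _ |>.2 fun j => hw.2.2 j
  -- A vector in the radical of the restriction is orthogonal to all vectors killed by the `e_α`,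
  -- since these are sums of singular vectors.
  refine hfam.eq_zero_of_orthogonal hC hq hM (fun x hx => LinearMap.ext fun m => ?_) hs hnd
    (UqRep.tensor_contravariant_f hB.1 hB'.1)
    (fun j => (Submodule.mem_iInf _).1 (hle v.2) j) fun w hw => ?_
  · exact UqRep.mem_radicalKernel.1 (hrad ▸ Submodule.mem_top) x hx
  · have hmem : w ∈ (ρ.tensor τ).singularSpace := by
      refine Submodule.span_mono ?_ (hfam.mem_span_singular hM hw)
      rintro u ⟨hu, ⟨ξ, hξ⟩, hue⟩
      exact ⟨hu, ⟨ξ, mem_weightSpace.1 hξ⟩, hue⟩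
    exact hv ⟨w, hmem⟩
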